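/- Let $n\ge 2$ and let $\Omega\subset\mathbb{R}^n$ be a nonempty, bounded, open, convex set with $C^1$ boundary; write $|\cdot|=\mathcal{H}^{n-1}$ for $(n-1)$-dimensional surface area and $\sigma$ for the surface measure. A set $\Sigma\subset\overline\Omega$ is called piecewise differentiable if, up to a set of zero surface area, it is a finite union of measurable pieces of $C^1$ hypersurfaces; $n(x)$ denotes a unit normal of $\Sigma$ at $x$ (defined up to sign for almost every $x\in\Sigma$), and $$E(\Sigma)=\int_\Sigma\int_\Sigma\frac{|\langle n(x),y-x\rangle\langle y-x,n(y)\rangle|}{\|x-y\|^{n+1}}\,d\sigma(x)\,d\sigma(y)\in[0,\infty].$$ There is a constant $c_\Omega>0$ such that the following holds whenever $m\in\mathbb{N}=\{0,1,2,\dots\}$ and $0\le L-m|\partial\Omega|\le c_\Omega$; moreover the area $|\Omega\cap H|$ of any hyperplane section of $\Omega$, in particular the largest such area, is an admissible choice of $c_\Omega$. Among all piecewise differentiable $\Sigma\subset\overline\Omega$ with $|\Sigma|=L$ the energy $E$ is minimized by $m$ copies of $\partial\Omega$ and a piece of a hyperplane, in the following sense. (i) There is a convex set $K\subset\Omega$ contained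 in a hyperplane with $m|\partial\Omega|+|K|=L$. (ii) Let $K\subset\Omega$ be any measurable subset of a hyperplane with $m|\partial\Omega|+|K|=L$, and let $p\in\Omega$. For $t=(t_1,\dots,t_m)$ with pairwise distinct $t_i\in(0,1]$, let $\Sigma_t$ be the union of $K$ and of the $m$ pairwise disjoint copies $p+t_i(\partial\Omega-p)$ of the boundary. Then, as $t\to(1,\dots,1)$, $$E(\Sigma_t)\longrightarrow\inf\{E(\Sigma):\Sigma\subset\overline\Omega\ \text{piecewise differentiable},\ |\Sigma|=L\}.$$ (iii) If $m\le 1$, then for every such $K$ the set $\Sigma_0=K$ (if $m=0$), respectively $\Sigma_0=\partial\Omega\cup K$ (if $m=1$), is itself piecewise differentiable with $\Sigma_0\subset\overline\Omega$ and $|\Sigma_0|=L$, and $E(\Sigma_0)\le E(\Sigma)$ for all piecewise differentiable $\Sigma\subset\overline\Omega$ with $|\Sigma|=L$. -/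

import Mathlib

open MeasureTheory Set Filter Topology
open scoped ENNReal

noncomputable section

namespace QuadraticCrofton

/-- Euclidean space `ℝⁿ`. -/
abbrev Space (n : ℕ) : Type := EuclideanSpace ℝ (Fin n)

/-- The surface area of a set in `ℝⁿ`: the `(n-1)`-dimensional Hausdorff measure, normalised to be
Lebesgue measure on hyperplanes. -/
def surfaceMeasure (n : ℕ) : Measure (Space n) := Measure.euclideanHausdorffMeasure (n - 1)

/-- `Ω` has `C¹` boundary: near each boundary point `Ω` is the sublevel set `{φ < 0}` of a
`C¹` function with nonvanishing gradient. -/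
def HasC1Boundary {n : ℕ} (Ω : Set (Space n)) : Prop :=
  ∀ x ∈ frontier Ω, ∃ (U : Set (Space n)) (φ : Space n → ℝ), IsOpen U ∧ x ∈ U ∧
    ContDiffOn ℝ 1 φ U ∧ gradient φ x ≠ 0 ∧ Ω ∩ U = {y ∈ U | φ y < 0}

/-- Near `x`, the set `S` is a `C¹` hypersurface through `x` (a regular level set), and `v` is one
of its two unit normal vectors at `x`. -/
def IsUnitNormalAt {n : ℕ} (S : Set (Space n)) (x v : Space n) : Prop :=
  x ∈ S ∧ ∃ (U : Set (Space n)) (φ : Space n → ℝ), IsOpen U ∧ x ∈ U ∧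
    ContDiffOn ℝ 1 φ U ∧ gradient φ x ≠ 0 ∧ S ∩ U = {y ∈ U | φ y = 0} ∧
    ‖v‖ = 1 ∧ v ∈ Submodule.span ℝ {gradient φ x}

/-- `S` is an (embedded, not necessarily closed) `C¹` hypersurface. -/
def IsC1Hypersurface {n : ℕ} (S : Set (Space n)) : Prop :=
  ∀ x ∈ S, ∃ v, IsUnitNormalAt S x v

/-- `ν` is a unit normal field along the piecewise `C¹` hypersurface `A`: up to a set of zero
surface area, `A` consists of finitely many measurable pieces `M i` of `C¹` hypersurfaces `S i`,
and at the points of `M i` the vector `ν` is a unit normal of `S i`. -/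
def IsUnitNormalField {n : ℕ} (A : Set (Space n)) (ν : Space n → Space n) : Prop :=
  ∃ (N : ℕ) (S M : Fin N → Set (Space n)),
    (∀ i, IsC1Hypersurface (S i) ∧ MeasurableSet (M i) ∧ M i ⊆ S i ∧ M i ⊆ A ∧
      ∀ x ∈ M i, IsUnitNormalAt (S i) x (ν x)) ∧
    surfaceMeasure n (A \ ⋃ i, M i) = 0

/-- `A` is a piecewise differentiable `(n-1)`-dimensional set. -/
def IsPiecewiseC1 {n : ℕ} (A : Set (Space n)) : Prop :=
  ∃ ν, IsUnitNormalField A ν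

open Classical in
/-- A unit normal field `n(x)` along `A`. Up to sign it is unique almost everywhere on `A`. -/
def unitNormal {n : ℕ} (A : Set (Space n)) : Space n → Space n :=
  if h : IsPiecewiseC1 A then h.choose else 0

/-- The energy `∫_A ∫_A |⟨n(x), y - x⟩ ⟨y - x, n(y)⟩| / ‖x - y‖ ^ (n + 1) dσ(x) dσ(y)`. The integrand
is nonnegative, and the value lies in `[0, ∞]`. -/
def energy {n : ℕ} (A : Set (Space n)) : ℝ≥0∞ :=
  ∫⁻ y in A, ∫⁻ x in A,
    ENNReal.ofReal (|inner ℝ (unitNormal A x) (y - x) * inner ℝ (y - x) (unitNormal A y)| /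
      ‖x - y‖ ^ (n + 1)) ∂(surfaceMeasure n) ∂(surfaceMeasure n)

/-- The competitors: piecewise differentiable sets in the closed domain, of surface area `L`. -/
def competitors {n : ℕ} (Ω : Set (Space n)) (L : ℝ≥0∞) : Set (Set (Space n)) :=
  {A | A ⊆ closure Ω ∧ IsPiecewiseC1 A ∧ surfaceMeasure n A = L}

/-- The hyperplane `{x | ⟨v, x⟩ = b}` (for `v ≠ 0`). -/
def hyperplane {n : ℕ} (v : Space n) (b : ℝ) : Set (Space n) := {x | inner ℝ v x = b}

/-- `K` is a piece of a hyperplane, inside `Ω`. -/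
def IsFlatPiece {n : ℕ} (Ω K : Set (Space n)) : Prop :=
  MeasurableSet K ∧ ∃ (v : Space n) (b : ℝ), v ≠ 0 ∧ K ⊆ Ω ∩ hyperplane v b

/-- The union of the boundary copies `p + t i • (∂Ω - p)`, `i < m`. For `p` in a convex open `Ω`
and distinct factors `t i ∈ (0, 1]` they are pairwise disjoint. -/
def boundaryCopies {n m : ℕ} (Ω : Set (Space n)) (p : Space n) (t : Fin m → ℝ) :
    Set (Space n) :=
  ⋃ i, AffineMap.homothety p (t i) '' frontier Ω

/-- `m` pairwise distinct scaling factors in `(0, 1]`. -/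
def distinctFactors (m : ℕ) : Set (Fin m → ℝ) :=
  {t | Function.Injective t ∧ ∀ i, t i ∈ Ioc (0 : ℝ) 1}

/-- Among the piecewise differentiable sets of surface area `L` in the closed domain, the energy is
minimized by `m` copies of the boundary and a piece of a hyperplane:

* there is a (convex) piece `K` of a hyperplane for which `m` copies of `∂Ω` and `K` have total
  area `L`; and, for every piece `K` with this property,
* the energy of `K` and `m` nearby disjoint copies of `∂Ω` tends to the infimum of the energy over
  all competitors, when the copies tend to `∂Ω`;
* if `m ≤ 1`, so that there are no repeated copies, then the set made of `m` copies of `∂Ω` and of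
  `K` is itself a competitor, and the infimum is attained there. -/
def MinimizedByCopies {n : ℕ} (Ω : Set (Space n)) (m : ℕ) (L : ℝ≥0∞) : Prop :=
  (∃ K, IsFlatPiece Ω K ∧ Convex ℝ K ∧
    m * surfaceMeasure n (frontier Ω) + surfaceMeasure n K = L) ∧
  ∀ K, IsFlatPiece Ω K → m * surfaceMeasure n (frontier Ω) + surfaceMeasure n K = L →
    (∀ p ∈ Ω, Tendsto (fun t : Fin m → ℝ => energy (boundaryCopies Ω p t ∪ K))
      (𝓝[distinctFactors m] (fun _ => 1)) (𝓝 (⨅ A ∈ competitors Ω L, energy A))) ∧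
    (m ≤ 1 → (⋃ _ : Fin m, frontier Ω) ∪ K ∈ competitors Ω L ∧
      ∀ A ∈ competitors Ω L, energy ((⋃ _ : Fin m, frontier Ω) ∪ K) ≤ energy A)

end QuadraticCrofton

end

/-!
Write a line as `{x | proj b x = a}`, with slope `b` and intercept `a`. For a suitable measure on
the lines, Crofton's formula says that the integral of the number `N` of transversal intersections
with `A` is a multiple of the area of `A`, and its quadratic version says that the energy of `A` is
the integral of `N * (N - 1)`: the energy kernel is the Jacobian of the map that sends two points of
`A` to the line through them.

Almost every line that meets a convex body `Ω` crosses `∂Ω` exactly twice. Since `N - 2m` and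
`N - (2m + 1)` are consecutive integers, `4 m N ≤ N (N - 1) + 2 m (2 m + 1)`, with equality if and
only if `N` is `2m` or `2m + 1`. Integrating over the lines that meet `Ω` bounds the energy from
below by the area. Almost every line meets `m` copies of `∂Ω` and a flat piece in `2m` or `2m + 1`
points, so these sets attain the bound, up to the lines that meet `Ω` but miss some of the copies.
-/

noncomputable section

namespace QuadraticCrofton

/-! ### Splitting off the first coordinate -/

section Coordinates

/-- The decomposition `ℝ^(d+1) = ℝ × ℝ^d` that splits off the first coordinate. The parameter space
`ℝ^d` serves both for hyperplanes and for directions of lines. -/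
def consL (d : ℕ) : (ℝ × Space d) ≃L[ℝ] Space (d + 1) :=
  LinearEquiv.toContinuousLinearEquiv
    { toFun := fun p => WithLp.toLp 2 (Fin.cons p.1 p.2)
      invFun := fun v => (v 0, WithLp.toLp 2 fun i => v i.succ)
      map_add' := fun p q => by
        ext i; refine Fin.cases ?_ (fun i => ?_) i <;> simp
      map_smul' := fun c p => by
        ext i; refine Fin.cases ?_ (fun i => ?_) i <;> simp
      left_inv := fun p => by
        ext <;> simp
      right_inv := fun v => by
        ext i; refine Fin.cases ?_ (fun i => ?_) i <;> simp }

/-- The first coordinate. -/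
def head {d : ℕ} : Space (d + 1) →L[ℝ] ℝ :=
  (ContinuousLinearMap.fst ℝ ℝ (Space d)).comp (consL d).symm.toContinuousLinearMap

/-- All coordinates but the first. -/
def tail {d : ℕ} : Space (d + 1) →L[ℝ] Space d :=
  (ContinuousLinearMap.snd ℝ ℝ (Space d)).comp (consL d).symm.toContinuousLinearMap

variable {d : ℕ}

theorem head_apply (v : Space (d + 1)) : head v = v 0 := rfl

theorem tail_apply (v : Space (d + 1)) (i : Fin d) : tail v i = v i.succ := rfl

@[simp] theorem head_consL (p : ℝ × Space d) : head (consL d p) = p.1 := rfl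

@[simp] theorem tail_consL (p : ℝ × Space d) : tail (consL d p) = p.2 := rfl

theorem consL_head_tail (v : Space (d + 1)) : consL d (head v, tail v) = v :=
  (consL d).apply_symm_apply v

theorem ext_head_tail {v w : Space (d + 1)} (hhead : head v = head w) (htail : tail v = tail w) :
    v = w := by
  rw [← consL_head_tail v, ← consL_head_tail w, hhead, htail]

theorem inner_eq_head_tail (v w : Space (d + 1)) :
    inner ℝ v w = head v * head w + inner ℝ (tail v) (tail w) := by
  simp only [PiLp.inner_apply, Fin.sum_univ_succ, head_apply, tail_apply, RCLike.inner_apply,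
    conj_trivial]
  ring

theorem norm_sq_eq_head_tail (v : Space (d + 1)) : ‖v‖ ^ 2 = head v ^ 2 + ‖tail v‖ ^ 2 := by
  rw [← real_inner_self_eq_norm_sq, ← real_inner_self_eq_norm_sq, inner_eq_head_tail, sq]

/-- The inclusion of `ℝ^d` as the hyperplane of vectors with vanishing first coordinate. -/
def incl : Space d →ₗᵢ[ℝ] Space (d + 1) where
  toLinearMap := (consL d).toLinearMap ∘ₗ LinearMap.inr ℝ ℝ (Space d)
  norm_map' z := by
    refine (pow_left_inj₀ (norm_nonneg _) (norm_nonneg _) two_ne_zero).1 ?_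
    refine (norm_sq_eq_head_tail (consL d (0, z))).trans ?_
    rw [head_consL, tail_consL, zero_pow two_ne_zero, zero_add]

@[simp] theorem head_incl (z : Space d) : head (incl z) = 0 := rfl

@[simp] theorem tail_incl (z : Space d) : tail (incl z) = z := rfl

/-- The vector of `ℝ^(d+1)` with first coordinate `1` and remaining coordinates `b`. Lines that are
not parallel to the hyperplane `head = 0` have a unique direction of this form. -/
def dir (b : Space d) : Space (d + 1) := consL d (1, b)

@[simp] theorem head_dir (b : Space d) : head (dir b) = 1 := rfl

@[simp] theorem tail_dir (b : Space d) : tail (dir b) = b := rfl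

theorem norm_dir_zero : ‖(dir 0 : Space (d + 1))‖ = 1 := by
  refine (pow_left_inj₀ (norm_nonneg _) zero_le_one two_ne_zero).1 ?_
  rw [norm_sq_eq_head_tail]
  simp

theorem dir_ne_zero (b : Space d) : dir b ≠ 0 := fun h => by
  simpa using congrArg head h

theorem continuous_dir : Continuous (dir : Space d → Space (d + 1)) :=
  (consL d).continuous.comp (by fun_prop)

/-- The projection onto `ℝ^d` along the direction `dir b`. Its fibers are the lines of this
direction, so that `(b, a)` is a coordinate of the line `{y | proj b y = a}`. -/
def proj (b : Space d) : Space (d + 1) →L[ℝ] Space d := tail - head.smulRight b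

theorem proj_apply (b : Space d) (v : Space (d + 1)) : proj b v = tail v - head v • b := rfl

@[simp] theorem proj_dir (b : Space d) : proj b (dir b) = 0 := by simp [proj_apply]

@[simp] theorem proj_incl (b z : Space d) : proj b (incl z) = z := by simp [proj_apply]

theorem sub_eq_smul_dir {b : Space d} {y y' : Space (d + 1)} (h : proj b y = proj b y') :
    y' - y = head (y' - y) • dir b := by
  have h0 : proj b (y' - y) = 0 := by rw [map_sub, h, sub_self]
  rw [proj_apply, sub_eq_zero] at h0
  exact ext_head_tail (by simp) (by simpa using h0)

end Coordinates

/-! ### The tangential Jacobian -/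

section TangentJacobian

variable {d : ℕ}

/-- The endomorphism `v ↦ (⟨ν, v⟩, L v)` of `ℝ^(d+1)`. For a unit vector `ν` its determinant tells
how `L` scales the volume of `ν^⊥`. -/
def bordered (ν : Space (d + 1)) (L : Space (d + 1) →L[ℝ] Space d) :
    Space (d + 1) →L[ℝ] Space (d + 1) :=
  (consL d).toContinuousLinearMap.comp ((innerSL ℝ ν).prod L)

@[simp] theorem head_bordered (ν v : Space (d + 1)) (L : Space (d + 1) →L[ℝ] Space d) :
    head (bordered ν L v) = inner ℝ ν v := rfl

@[simp] theorem tail_bordered (ν v : Space (d + 1)) (L : Space (d + 1) →L[ℝ] Space d) :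
    tail (bordered ν L v) = L v := rfl

/-- The tangential Jacobian of a map with derivative `L` along a hypersurface with unit normal `ν`:
the factor by which `L` scales the volume of `ν^⊥`. -/
def tangentJacobian (ν : Space (d + 1)) (L : Space (d + 1) →L[ℝ] Space d) : ℝ :=
  |(bordered ν L).toLinearMap.det|

/-- The endomorphism of `ℝ^(d+1)` that maps the first basis vector to `u` and acts as `G` on the
remaining coordinates. For a unit vector `u` normal to the range of `G`, its determinant tells how
`G` scales volume. -/
def augmented (u : Space (d + 1)) (G : Space d →ₗ[ℝ] Space (d + 1)) :
    Space (d + 1) →ₗ[ℝ] Space (d + 1) :=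
  head.toLinearMap.smulRight u + G ∘ₗ tail.toLinearMap

theorem augmented_apply (u : Space (d + 1)) (G : Space d →ₗ[ℝ] Space (d + 1))
    (v : Space (d + 1)) : augmented u G v = head v • u + G (tail v) := rfl

theorem det_consL_conj (s : ℝ →ₗ[ℝ] ℝ) (G : Space d →ₗ[ℝ] Space d) :
    ((consL d).toLinearEquiv.toLinearMap ∘ₗ (s.prodMap G) ∘ₗ
      (consL d).toLinearEquiv.symm.toLinearMap).det = s.det * G.det := by
  rw [LinearMap.det_conj, LinearMap.det_prodMap]

/-- Since `ν` is a unit normal to the range of `G`, the Gram operator of `augmented ν G` is the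
identity on the first coordinate and the Gram operator of `G` on the others. -/
theorem normDet_augmented {ν : Space (d + 1)} (hν : ‖ν‖ = 1)
    {G : Space d →ₗ[ℝ] Space (d + 1)} (hG : ∀ z, inner ℝ ν (G z) = 0) :
    (augmented ν G).normDet = G.normDet := by
  have hG' : ∀ z, inner ℝ (G z) ν = 0 := fun z => by rw [real_inner_comm, hG]
  have hgram : (augmented ν G).adjoint ∘ₗ augmented ν G =
      (consL d).toLinearEquiv.toLinearMap ∘ₗ
        ((LinearMap.id : ℝ →ₗ[ℝ] ℝ).prodMap (G.adjoint ∘ₗ G)) ∘ₗ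
        (consL d).toLinearEquiv.symm.toLinearMap := by
    refine LinearMap.ext fun v => ext_inner_right ℝ fun w => ?_
    change inner ℝ ((augmented ν G).adjoint (augmented ν G v)) w =
      inner ℝ (consL d (head v, G.adjoint (G (tail v)))) w
    rw [LinearMap.adjoint_inner_left, inner_eq_head_tail (consL d _), head_consL, tail_consL,
      LinearMap.adjoint_inner_left]
    simp [augmented_apply, inner_add_left, inner_add_right, inner_smul_left, inner_smul_right,
      hν, hG, hG', mul_comm]
  refine (pow_left_inj₀ (LinearMap.normDet_nonneg _) (LinearMap.normDet_nonneg _) two_ne_zero).1 ?_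
  have haug := LinearMap.normDet_sq (augmented ν G)
  rw [hgram, det_consL_conj, LinearMap.det_id, one_mul, ← LinearMap.normDet_sq] at haug
  exact haug

theorem tangentJacobian_mul_normDet {ν : Space (d + 1)} (hν : ‖ν‖ = 1)
    {L : Space (d + 1) →L[ℝ] Space d} {G : Space d →ₗ[ℝ] Space (d + 1)}
    (hG : ∀ z, inner ℝ ν (G z) = 0) (hL : ∀ z, L (G z) = z) :
    tangentJacobian ν L * G.normDet = 1 := by
  have hcomp : (bordered ν L).toLinearMap ∘ₗ augmented ν G =
      LinearMap.transvection head.toLinearMap (incl (L ν)) := by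
    refine LinearMap.ext fun v => ?_
    change bordered ν L (augmented ν G v) = v + head v • incl (L ν)
    apply ext_head_tail
    · simp [augmented_apply, hG, hν]
    · simp [augmented_apply, hL, add_comm]
  have hdet := congrArg LinearMap.det hcomp
  rw [LinearMap.det_comp, LinearMap.transvection.det] at hdet
  rw [← normDet_augmented hν hG, LinearMap.normDet_eq_abs_det, tangentJacobian, ← abs_mul, hdet]
  simp

theorem tangentJacobian_smul (ν : Space (d + 1)) (L : Space (d + 1) →L[ℝ] Space d) (c : ℝ) :
    tangentJacobian ν (c • L) = |c| ^ d * tangentJacobian ν L := by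
  have hscale : (bordered ν (c • L)).toLinearMap =
      ((consL d).toLinearEquiv.toLinearMap ∘ₗ
        ((LinearMap.id : ℝ →ₗ[ℝ] ℝ).prodMap (c • (LinearMap.id : Space d →ₗ[ℝ] Space d))) ∘ₗ
      (consL d).toLinearEquiv.symm.toLinearMap) ∘ₗ (bordered ν L).toLinearMap := rfl
  rw [tangentJacobian, tangentJacobian, hscale, LinearMap.det_comp, det_consL_conj, abs_mul]
  simp

theorem tangentJacobian_proj (ν : Space (d + 1)) (b : Space d) :
    tangentJacobian ν (proj b) = |inner ℝ ν (dir b)| := by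
  have hcomp : (bordered ν (proj b)).toLinearMap ∘ₗ augmented (dir b) incl.toLinearMap =
      LinearMap.transvection ((inner ℝ ν (dir b) - 1) • head.toLinearMap +
        (innerSL ℝ ν).toLinearMap ∘ₗ incl.toLinearMap ∘ₗ tail.toLinearMap) (dir 0) := by
    refine LinearMap.ext fun v => ?_
    change bordered ν (proj b) (head v • dir b + incl (tail v)) =
      v + ((inner ℝ ν (dir b) - 1) * head v + inner ℝ ν (incl (tail v))) • dir 0
    apply ext_head_tail
    · simp
      ring
    · simp
  have haug : augmented (dir b) incl.toLinearMap =
      LinearMap.transvection head.toLinearMap (incl b) := by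
    refine LinearMap.ext fun v => ?_
    change head v • dir b + incl (tail v) = v + head v • incl b
    apply ext_head_tail <;> simp [add_comm]
  have hdet := congrArg LinearMap.det hcomp
  rw [haug, LinearMap.det_comp, LinearMap.transvection.det, LinearMap.transvection.det] at hdet
  have hdet' : (bordered ν (proj b)).toLinearMap.det = inner ℝ ν (dir b) := by
    simpa using hdet
  rw [tangentJacobian, hdet']

end TangentJacobian

/-! ### Local comparison of a hypersurface with its image -/

section LocalComparison

open Asymptotics

theorem euclideanHausdorffMeasure_image_le {X Y : Type*} [EMetricSpace X] [EMetricSpace Y]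
    [MeasurableSpace X] [BorelSpace X] [MeasurableSpace Y] [BorelSpace Y] {K : NNReal}
    {f : X → Y} {s : Set X} (h : LipschitzOnWith K f s) (d : ℕ) :
    Measure.euclideanHausdorffMeasure d (f '' s) ≤
      K ^ d * Measure.euclideanHausdorffMeasure d s := by
  have hle := h.hausdorffMeasure_image_le (Nat.cast_nonneg d)
  simp only [Measure.euclideanHausdorffMeasure_def, Measure.smul_apply, ENNReal.smul_def,
    smul_eq_mul, ENNReal.rpow_natCast] at hle ⊢
  exact (mul_le_mul_right hle _).trans_eq (mul_left_comm _ _ _)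

theorem euclideanHausdorffMeasure_le_image {X Y : Type*} [EMetricSpace X] [EMetricSpace Y]
    [MeasurableSpace X] [BorelSpace X] [MeasurableSpace Y] [BorelSpace Y] {K : NNReal}
    {f : X → Y} {s : Set X} (h : AntilipschitzWith K (s.domRestrict f)) (d : ℕ) :
    Measure.euclideanHausdorffMeasure d s ≤
      K ^ d * Measure.euclideanHausdorffMeasure d (f '' s) := by
  have hle := h.le_hausdorffMeasure_image (Nat.cast_nonneg d) univ
  rw [image_univ, range_domRestrict, ENNReal.rpow_natCast,
    ← isometry_subtype_coe.hausdorffMeasure_image (.inl (Nat.cast_nonneg d)), image_univ,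
    Subtype.range_coe] at hle
  simp only [Measure.euclideanHausdorffMeasure_def, Measure.smul_apply, ENNReal.smul_def,
    smul_eq_mul] at hle ⊢
  exact (mul_le_mul_right hle _).trans_eq (mul_left_comm _ _ _)

/-- `ν` is normal at `y₀` to the set `P`, which need not be a hypersurface, in the strict sense that
`⟨ν, y - y'⟩ = o(‖y - y'‖)` as `y, y' → y₀` in `P`. -/
def IsStrictNormalAt {n : ℕ} (P : Set (Space n)) (ν y₀ : Space n) : Prop :=
  (fun p : Space n × Space n => inner ℝ ν (p.1 - p.2)) =o[𝓝[P ×ˢ P] (y₀, y₀)] fun p => p.1 - p.2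

theorem IsStrictNormalAt.mono {n : ℕ} {P Q : Set (Space n)} {ν y₀ : Space n}
    (h : IsStrictNormalAt P ν y₀) (hQ : Q ⊆ P) : IsStrictNormalAt Q ν y₀ :=
  Asymptotics.IsLittleO.mono h (nhdsWithin_mono _ (prod_mono hQ hQ))

variable {d : ℕ}

theorem symm_consL_eq_sub {ν : Space (d + 1)} {L : Space (d + 1) →L[ℝ] Space d}
    (D : Space (d + 1) ≃L[ℝ] Space (d + 1)) (hD : (D : Space (d + 1) →L[ℝ] _) = bordered ν L)
    (v : Space (d + 1)) (z : Space d) :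
    D.symm (consL d (-inner ℝ ν v, z - L v)) = D.symm (incl z) - v := by
  have hDv : D v = bordered ν L v := congrArg (· v) hD
  rw [D.symm_apply_eq, map_sub, D.apply_symm_apply, hDv]
  apply ext_head_tail <;> simp

theorem exists_approximatesLinearOn_id_of_isLittleO {E : Type*} [NormedAddCommGroup E]
    [NormedSpace ℝ E] {ψ : E → E} {P : Set E} {y₀ : E}
    (h : (fun p : E × E => ψ p.1 - ψ p.2 - (p.1 - p.2)) =o[𝓝[P ×ˢ P] (y₀, y₀)]
      fun p => p.1 - p.2) {δ : NNReal} (hδ : 0 < δ) :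
    ∃ U ∈ 𝓝 y₀, ApproximatesLinearOn ψ (.id ℝ E) (P ∩ U) δ := by
  obtain ⟨W, hW, hWP⟩ := mem_nhdsWithin_iff_exists_mem_nhds_inter.1 (h.def (NNReal.coe_pos.2 hδ))
  rw [nhds_prod_eq] at hW
  obtain ⟨U, hU, hUW⟩ := mem_prod_same_iff.1 hW
  exact ⟨U, hU, fun y hy y' hy' => hWP ⟨@hUW (y, y') ⟨hy.2, hy'.2⟩, hy.1, hy'.1⟩⟩

/-- On a set with normal `ν` the increments of `incl ∘ f` are `bordered ν L` of the increments of
the point, up to `o`; hence inverting `bordered ν L` gives a map close to the identity. -/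
theorem IsStrictNormalAt.isLittleO_symm_incl {P : Set (Space (d + 1))}
    {ν y₀ : Space (d + 1)} (hP : IsStrictNormalAt P ν y₀) {f : Space (d + 1) → Space d}
    {L : Space (d + 1) →L[ℝ] Space d} (hf : HasStrictFDerivAt f L y₀)
    (D : Space (d + 1) ≃L[ℝ] Space (d + 1)) (hD : (D : Space (d + 1) →L[ℝ] _) = bordered ν L) :
    (fun p : Space (d + 1) × Space (d + 1) =>
      D.symm (incl (f p.1)) - D.symm (incl (f p.2)) - (p.1 - p.2)) =o[𝓝[P ×ˢ P] (y₀, y₀)]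
      fun p => p.1 - p.2 := by
  have hpair := hP.neg_left.prod_left (hf.isLittleO.mono nhdsWithin_le_nhds)
  let T : ℝ × Space d →L[ℝ] Space (d + 1) :=
    D.symm.toContinuousLinearMap.comp (consL d).toContinuousLinearMap
  refine ((T.isBigO_comp _ _).trans_isLittleO hpair).congr_left fun p => ?_
  rw [← map_sub D.symm, ← map_sub incl]
  exact symm_consL_eq_sub D hD _ _

theorem volume_image_eq_tangentJacobian_mul {ν : Space (d + 1)} (hν : ‖ν‖ = 1)
    {L : Space (d + 1) →L[ℝ] Space d} (D : Space (d + 1) ≃L[ℝ] Space (d + 1))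
    (hD : (D : Space (d + 1) →L[ℝ] _) = bordered ν L) (f : Space (d + 1) → Space d)
    (C : Set (Space (d + 1))) :
    volume (f '' C) = ENNReal.ofReal (tangentJacobian ν L) *
      surfaceMeasure (d + 1) ((fun y => D.symm (incl (f y))) '' C) := by
  let G : Space d →ₗ[ℝ] Space (d + 1) := D.symm.toLinearEquiv.toLinearMap ∘ₗ incl.toLinearMap
  have hDG : ∀ z, bordered ν L (G z) = incl z := fun z =>
    (congrArg (· (G z)) hD).symm.trans (D.apply_symm_apply _)
  have hjac : tangentJacobian ν L * G.normDet = 1 :=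
    tangentJacobian_mul_normDet hν (fun z => congrArg head (hDG z)) fun z => congrArg tail (hDG z)
  have himage := G.euclideanHausdorffMeasure_image_eq_normDet_mul_volume (f '' C)
  rw [finrank_euclideanSpace_fin, image_image] at himage
  change surfaceMeasure (d + 1) ((fun y => D.symm (incl (f y))) '' C) = _ at himage
  rw [himage, ← mul_assoc, ← ENNReal.ofReal_mul (p := tangentJacobian ν L) (abs_nonneg _), hjac,
    ENNReal.ofReal_one, one_mul]

theorem exists_lt_one_pow_le {q : NNReal} (hq : 1 < q) (d : ℕ) :
    ∃ δ : NNReal, 0 < δ ∧ δ < 1 ∧ (1 + δ) ^ d ≤ q ∧ ((1 - δ)⁻¹) ^ d ≤ q := by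
  have hupper : Tendsto (fun δ : NNReal => (1 + δ) ^ d) (𝓝 0) (𝓝 1) := by
    have : ContinuousAt (fun δ : NNReal => (1 + δ) ^ d) 0 := by fun_prop
    simpa [ContinuousAt] using this
  have hlower : Tendsto (fun δ : NNReal => ((1 - δ)⁻¹) ^ d) (𝓝 0) (𝓝 1) := by
    have : ContinuousAt (fun δ : NNReal => ((1 - δ)⁻¹) ^ d) 0 :=
      (ContinuousAt.inv₀ (by fun_prop) (by simp)).pow d
    simpa [ContinuousAt] using this
  have hsmall := (gt_mem_nhds one_pos).and
    ((hupper.eventually (ge_mem_nhds hq)).and (hlower.eventually (ge_mem_nhds hq)))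
  obtain ⟨δ, hδ, hδ0⟩ := ((hsmall.filter_mono nhdsWithin_le_nhds).and
    (self_mem_nhdsWithin : Ioi (0 : NNReal) ∈ 𝓝[>] 0)).exists
  exact ⟨δ, hδ0, hδ.1, hδ.2⟩

theorem lipschitzOnWith_of_approximatesLinearOn_id {E : Type*} [NormedAddCommGroup E]
    [NormedSpace ℝ E] {ψ : E → E} {s : Set E} {δ : NNReal}
    (h : ApproximatesLinearOn ψ (.id ℝ E) s δ) : LipschitzOnWith (1 + δ) ψ s :=
  LipschitzOnWith.of_dist_le_mul fun x hx y hy => by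
    have hxy : ‖ψ x - ψ y - (x - y)‖ ≤ δ * ‖x - y‖ := h x hx y hy
    rw [dist_eq_norm, dist_eq_norm, NNReal.coe_add, NNReal.coe_one]
    linarith [norm_sub_norm_le (ψ x - ψ y) (x - y)]

theorem antilipschitzWith_of_approximatesLinearOn_id {E : Type*} [NormedAddCommGroup E]
    [NormedSpace ℝ E] {ψ : E → E} {s : Set E} {δ : NNReal} (hδ : δ < 1)
    (h : ApproximatesLinearOn ψ (.id ℝ E) s δ) :
    AntilipschitzWith (1 - δ)⁻¹ (s.domRestrict ψ) :=
  AntilipschitzWith.of_le_mul_dist fun x y => by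
    have hxy : ‖ψ x - ψ y - (x - y : E)‖ ≤ δ * ‖(x - y : E)‖ := h x x.2 y y.2
    have hpos : (0 : ℝ) < 1 - δ := sub_pos.2 (mod_cast hδ)
    rw [Subtype.dist_eq, dist_eq_norm, domRestrict_apply, domRestrict_apply, dist_eq_norm,
      NNReal.coe_inv, NNReal.coe_sub hδ.le, NNReal.coe_one, inv_mul_eq_div, le_div_iff₀ hpos]
    linarith [norm_sub_norm_le (x - y : E) (ψ x - ψ y), norm_sub_rev (ψ x - ψ y) (x - y : E)]

theorem IsStrictNormalAt.exists_nhds_measure_image {P : Set (Space (d + 1))}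
    {ν y₀ : Space (d + 1)} (hP : IsStrictNormalAt P ν y₀) (hν : ‖ν‖ = 1)
    {f : Space (d + 1) → Space d} {L : Space (d + 1) →L[ℝ] Space d}
    (hf : HasStrictFDerivAt f L y₀) (hJ : tangentJacobian ν L ≠ 0) {q : NNReal} (hq : 1 < q) :
    ∃ U ∈ 𝓝 y₀, InjOn f (P ∩ U) ∧ ∀ C ⊆ P ∩ U,
      ENNReal.ofReal (tangentJacobian ν L) * surfaceMeasure (d + 1) C ≤ q * volume (f '' C) ∧
      volume (f '' C) ≤
        q * (ENNReal.ofReal (tangentJacobian ν L) * surfaceMeasure (d + 1) C) := by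
  have hdet : (bordered ν L).det ≠ 0 := abs_ne_zero.1 hJ
  obtain ⟨D, hD⟩ : ∃ D : Space (d + 1) ≃L[ℝ] Space (d + 1), (D : Space (d + 1) →L[ℝ] _) =
    bordered ν L := ⟨_, (bordered ν L).coe_toContinuousLinearEquivOfDetNeZero hdet⟩
  obtain ⟨δ, hδ0, hδ1, hδq, hδq'⟩ := exists_lt_one_pow_le hq d
  obtain ⟨U, hU, happrox⟩ :=
    exists_approximatesLinearOn_id_of_isLittleO (ψ := fun y => D.symm (incl (f y)))
      (hP.isLittleO_symm_incl hf D hD) hδ0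
  refine ⟨U, hU, fun y hy y' hy' hyy' => ?_, fun C hC => ?_⟩
  · have hinj := injOn_iff_injective.2
      (antilipschitzWith_of_approximatesLinearOn_id hδ1 happrox).injective
    exact hinj hy hy' (congrArg (fun z => D.symm (incl z)) hyy')
  have hC' := happrox.mono_set hC
  have himage_le : surfaceMeasure (d + 1) _ ≤ _ * surfaceMeasure (d + 1) C :=
    euclideanHausdorffMeasure_image_le (lipschitzOnWith_of_approximatesLinearOn_id hC') d
  have hle_image : surfaceMeasure (d + 1) C ≤ _ * surfaceMeasure (d + 1) _ :=
    euclideanHausdorffMeasure_le_image (antilipschitzWith_of_approximatesLinearOn_id hδ1 hC') d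
  rw [volume_image_eq_tangentJacobian_mul hν D hD, mul_left_comm (q : ℝ≥0∞),
    mul_left_comm (q : ℝ≥0∞)]
  constructor <;> gcongr
  · refine hle_image.trans ?_
    gcongr
    exact_mod_cast hδq'
  · refine himage_le.trans ?_
    gcongr
    exact_mod_cast hδq

end LocalComparison

/-! ### The area formula -/

section FiberCount

theorem exists_countable_partition {X : Type*} [TopologicalSpace X] [SecondCountableTopology X]
    [MeasurableSpace X] [BorelSpace X] {C : Set X} (hC : MeasurableSet C) {p : Set X → Prop}
    (hempty : p ∅) (h : ∀ y ∈ C, ∃ U ∈ 𝓝 y, ∀ s ⊆ C ∩ U, MeasurableSet s → p s) :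
    ∃ S : ℕ → Set X, (∀ i, MeasurableSet (S i) ∧ S i ⊆ C ∧ p (S i)) ∧
      Pairwise (Function.onFun Disjoint S) ∧ ⋃ i, S i = C := by
  rcases C.eq_empty_or_nonempty with rfl | ⟨y₀, hy₀⟩
  · exact ⟨fun _ => ∅, fun _ => ⟨.empty, subset_rfl, hempty⟩, fun _ _ _ => disjoint_bot_left,
      iUnion_empty⟩
  choose! U hU hUp using h
  obtain ⟨t, htC, ht, hcover⟩ := TopologicalSpace.countable_cover_nhdsWithin
    (f := fun y => interior (U y)) (s := C)
    fun y hy => mem_nhdsWithin_of_mem_nhds (interior_mem_nhds.2 (hU y hy))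
  obtain ⟨y₁, hy₁, -⟩ := mem_iUnion₂.1 (hcover hy₀)
  obtain ⟨g, rfl⟩ := ht.exists_eq_range ⟨y₁, hy₁⟩
  have hgC : ∀ i, g i ∈ C := fun i => htC (mem_range_self i)
  let S : ℕ → Set X := fun i => C ∩ interior (U (g i))
  have hS : ∀ i, MeasurableSet (disjointed S i) :=
    .disjointed fun i => hC.inter isOpen_interior.measurableSet
  have hSU : ∀ i, disjointed S i ⊆ C ∩ U (g i) := fun i =>
    (disjointed_subset S i).trans (inter_subset_inter_right _ interior_subset)
  refine ⟨disjointed S, fun i => ⟨hS i, (hSU i).trans inter_subset_left,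
    hUp _ (hgC i) _ (hSU i) (hS i)⟩, disjoint_disjointed S, ?_⟩
  rw [iUnion_disjointed, ← inter_iUnion, inter_eq_left]
  simpa using hcover

/-- The number of preimages in `C`. -/
def fiberCount {X Y : Type*} [MeasurableSpace X] (f : X → Y) (C : Set X) (z : Y) : ℝ≥0∞ :=
  Measure.count (C ∩ f ⁻¹' {z})

theorem fiberCount_iUnion {X Y ι : Type*} [Countable ι] [MeasurableSpace X] [MeasurableSpace Y]
    [MeasurableSingletonClass Y] {f : X → Y} (hf : Measurable f) {S : ι → Set X}
    (hS : ∀ i, MeasurableSet (S i)) (hd : Pairwise (Function.onFun Disjoint S)) :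
    fiberCount f (⋃ i, S i) = fun z => ∑' i, fiberCount f (S i) z := by
  ext z
  rw [fiberCount, iUnion_inter, measure_iUnion
    (fun i j hij => (hd hij).mono inter_subset_left inter_subset_left)
    fun i => (hS i).inter (hf (measurableSet_singleton z))]
  rfl

theorem fiberCount_preimage_inter {X Y : Type*} [MeasurableSpace X] (f : X → Y) (E : Set Y)
    (C : Set X) : fiberCount f (f ⁻¹' E ∩ C) = E.indicator (fiberCount f C) := by
  ext z
  by_cases hz : z ∈ E
  · rw [indicator_of_mem hz, fiberCount, inter_right_comm,
      inter_eq_right.2 (preimage_mono (singleton_subset_iff.2 hz)), inter_comm, fiberCount]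
  · rw [indicator_of_notMem hz, fiberCount, inter_right_comm, ← preimage_inter,
      inter_singleton_eq_empty.2 hz, preimage_empty, empty_inter, measure_empty]

theorem fiberCount_eq_zero {X Y : Type*} [MeasurableSpace X] {f : X → Y} {C : Set X} {z : Y}
    (h : z ∉ f '' C) : fiberCount f C z = 0 := by
  have hfiber : C ∩ f ⁻¹' {z} = ∅ :=
    eq_empty_of_forall_notMem fun y hy => h ⟨y, hy.1, hy.2⟩
  rw [fiberCount, hfiber, measure_empty]

theorem fiberCount_eq_top_or_natCast {X Y : Type*} [MeasurableSpace X]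
    [MeasurableSingletonClass X] (f : X → Y) (C : Set X) (z : Y) :
    fiberCount f C z = ∞ ∨ ∃ k : ℕ, fiberCount f C z = k := by
  obtain hfin | hinf := (C ∩ f ⁻¹' {z}).finite_or_infinite
  · exact .inr ⟨_, Measure.count_apply_finite _ hfin⟩
  · exact .inl (Measure.count_apply_infinite hinf)

theorem fiberCount_mono {X Y : Type*} [MeasurableSpace X] {f : X → Y} {C D : Set X} (h : C ⊆ D)
    (z : Y) : fiberCount f C z ≤ fiberCount f D z :=
  measure_mono (inter_subset_inter_left _ h)

theorem fiberCount_union_le {X Y : Type*} [MeasurableSpace X] (f : X → Y) (C D : Set X)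
    (z : Y) : fiberCount f (C ∪ D) z ≤ fiberCount f C z + fiberCount f D z := by
  rw [fiberCount, union_inter_distrib_right]
  exact measure_union_le _ _

theorem fiberCount_iUnion_le {X Y ι : Type*} [Fintype ι] [MeasurableSpace X] (f : X → Y)
    (C : ι → Set X) (z : Y) : fiberCount f (⋃ i, C i) z ≤ ∑ i, fiberCount f (C i) z := by
  rw [fiberCount, iUnion_inter]
  exact measure_iUnion_fintype_le _ _

theorem fiberCount_of_injOn {X Y : Type*} [MeasurableSpace X] [MeasurableSingletonClass X]
    {f : X → Y} {C : Set X} (hf : InjOn f C) : fiberCount f C = (f '' C).indicator 1 := by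
  ext z
  by_cases hz : z ∈ f '' C
  · obtain ⟨x, hx, rfl⟩ := hz
    have hfiber : C ∩ f ⁻¹' {f x} = {x} :=
      eq_singleton_iff_unique_mem.2 ⟨⟨hx, rfl⟩, fun y hy => hf hy.1 hx hy.2⟩
    rw [indicator_of_mem (mem_image_of_mem f hx), fiberCount, hfiber, Measure.count_singleton,
      Pi.one_apply]
  · rw [indicator_of_notMem hz, fiberCount_eq_zero hz]

theorem measurable_fiberCount_of_injOn {X Y : Type*} [TopologicalSpace X] [PolishSpace X]
    [MeasurableSpace X] [BorelSpace X] [TopologicalSpace Y] [T2Space Y] [SecondCountableTopology Y]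
    [MeasurableSpace Y] [BorelSpace Y] {f : X → Y} (hf : Measurable f) {C : Set X}
    (hC : MeasurableSet C) (hinj : InjOn f C) : Measurable (fiberCount f C) := by
  rw [fiberCount_of_injOn hinj]
  exact measurable_one.indicator (hC.image_of_measurable_injOn hf hinj)

theorem measurable_fiberCount {X Y : Type*} [TopologicalSpace X] [PolishSpace X]
    [MeasurableSpace X] [BorelSpace X] [TopologicalSpace Y] [T2Space Y] [SecondCountableTopology Y]
    [MeasurableSpace Y] [BorelSpace Y] {f : X → Y} (hf : Measurable f) {C : Set X}
    (hC : MeasurableSet C) (h : ∀ y ∈ C, ∃ U ∈ 𝓝 y, InjOn f (C ∩ U)) :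
    Measurable (fiberCount f C) := by
  obtain ⟨S, hS, hd, rfl⟩ := exists_countable_partition hC (injOn_empty f) fun y hy =>
    (h y hy).imp fun U hU => ⟨hU.1, fun s hs _ => hU.2.mono hs⟩
  rw [fiberCount_iUnion hf (fun i => (hS i).1) hd]
  exact .tsum fun i => measurable_fiberCount_of_injOn hf (hS i).1 (hS i).2.2

end FiberCount

section AreaFormula

/-- `C` is a Borel set with Borel unit normal field `ν`: a finite disjoint union of Borel sets to
which `ν` is normal. -/
structure IsNormalPair {n : ℕ} (C : Set (Space n)) (ν : Space n → Space n) : Prop where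
  measurableSet : MeasurableSet C
  measurable : Measurable ν
  norm_eq_one : ∀ y ∈ C, ‖ν y‖ = 1
  exists_partition : ∃ (N : ℕ) (P : Fin N → Set (Space n)), (∀ k, MeasurableSet (P k)) ∧
    Pairwise (Function.onFun Disjoint P) ∧ ⋃ k, P k = C ∧
    ∀ k, ∀ y ∈ P k, IsStrictNormalAt (P k) (ν y) y

theorem IsNormalPair.of_isStrictNormalAt {n : ℕ} {C : Set (Space n)} {ν : Space n → Space n}
    (hC : MeasurableSet C) (hν : Measurable ν) (hnorm : ∀ y ∈ C, ‖ν y‖ = 1)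
    (h : ∀ y ∈ C, IsStrictNormalAt C (ν y) y) : IsNormalPair C ν :=
  ⟨hC, hν, hnorm, 1, fun _ => C, fun _ => hC, fun i j hij => (hij (Subsingleton.elim i j)).elim,
    iUnion_const C, fun _ => h⟩

theorem IsNormalPair.mono {n : ℕ} {C D : Set (Space n)} {ν : Space n → Space n}
    (h : IsNormalPair C ν) (hD : MeasurableSet D) (hDC : D ⊆ C) : IsNormalPair D ν := by
  obtain ⟨N, P, hP, hd, hU, hnormal⟩ := h.exists_partition
  refine ⟨hD, h.measurable, fun y hy => h.norm_eq_one y (hDC hy), N,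
    fun k => D ∩ P k, fun k => hD.inter (hP k),
    fun i j hij => (hd hij).mono inter_subset_right inter_subset_right,
    ?_, fun k y hy => (hnormal k y hy.2).mono inter_subset_right⟩
  rw [← inter_iUnion, hU, inter_eq_left.2 hDC]

variable {d : ℕ} {C : Set (Space (d + 1))} {ν : Space (d + 1) → Space (d + 1)}
  {f : Space (d + 1) → Space d} {J : Space (d + 1) → ℝ≥0∞}

/-- On `C`, whose unit normal is `ν`, the Borel map `f` is strictly differentiable with nonvanishing
tangential Jacobian `J`. -/
structure HasRegularJacobianOn (f : Space (d + 1) → Space d) (J : Space (d + 1) → ℝ≥0∞)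
    (C : Set (Space (d + 1))) (ν : Space (d + 1) → Space (d + 1)) : Prop where
  measurable : Measurable f
  measurable_jacobian : Measurable J
  jacobian_ne_zero : ∀ y ∈ C, J y ≠ 0
  exists_hasStrictFDerivAt : ∀ y ∈ C, ∃ L : Space (d + 1) →L[ℝ] Space d,
    HasStrictFDerivAt f L y ∧ J y = ENNReal.ofReal (tangentJacobian (ν y) L)

theorem HasRegularJacobianOn.mono {D : Set (Space (d + 1))} (h : HasRegularJacobianOn f J C ν)
    (hDC : D ⊆ C) : HasRegularJacobianOn f J D ν :=
  ⟨h.measurable, h.measurable_jacobian, fun y hy => h.jacobian_ne_zero y (hDC hy),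
    fun y hy => h.exists_hasStrictFDerivAt y (hDC hy)⟩

/-- The area formula for `f` along `C`, up to a factor `q`. -/
def AreaBounds (q : ℝ≥0∞) (f : Space (d + 1) → Space d) (J : Space (d + 1) → ℝ≥0∞)
    (C : Set (Space (d + 1))) : Prop :=
  Measurable (fiberCount f C) ∧
    ∫⁻ z, fiberCount f C z ≤ q * ∫⁻ y in C, J y ∂surfaceMeasure (d + 1) ∧
    ∫⁻ y in C, J y ∂surfaceMeasure (d + 1) ≤ q * ∫⁻ z, fiberCount f C z

theorem areaBounds_empty (q : ℝ≥0∞) (f : Space (d + 1) → Space d) (J : Space (d + 1) → ℝ≥0∞) :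
    AreaBounds q f J ∅ := by
  simp [AreaBounds, fiberCount_of_injOn (injOn_empty f)]

theorem AreaBounds.iUnion {ι : Type*} [Countable ι] {q : ℝ≥0∞} (hf : Measurable f)
    {S : ι → Set (Space (d + 1))} (hS : ∀ i, MeasurableSet (S i))
    (hd : Pairwise (Function.onFun Disjoint S)) (h : ∀ i, AreaBounds q f J (S i)) :
    AreaBounds q f J (⋃ i, S i) := by
  rw [AreaBounds, fiberCount_iUnion hf hS hd, lintegral_tsum fun i => (h i).1.aemeasurable,
    lintegral_iUnion hS hd, ← ENNReal.tsum_mul_left, ← ENNReal.tsum_mul_left]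
  exact ⟨.tsum fun i => (h i).1, ENNReal.tsum_le_tsum fun i => (h i).2.1,
    ENNReal.tsum_le_tsum fun i => (h i).2.2⟩

theorem areaBounds_of_injOn {q a j : ℝ≥0∞} (hC : MeasurableSet C) (hf : Measurable f)
    (hinj : InjOn f C) (hJ : ∀ y ∈ C, J y ∈ Icc a (q * a)) (hj : j ∈ Icc a (q * a))
    (hle_image : j * surfaceMeasure (d + 1) C ≤ q * volume (f '' C))
    (himage_le : volume (f '' C) ≤ q * (j * surfaceMeasure (d + 1) C)) :
    AreaBounds (q ^ 2) f J C := by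
  have hint : ∫⁻ z, fiberCount f C z = volume (f '' C) := by
    rw [fiberCount_of_injOn hinj,
      lintegral_indicator_one (hC.image_of_measurable_injOn hf hinj)]
  have hlower : a * surfaceMeasure (d + 1) C ≤ ∫⁻ y in C, J y ∂surfaceMeasure (d + 1) := by
    rw [← setLIntegral_const]
    exact setLIntegral_mono' hC fun y hy => (hJ y hy).1
  have hupper : ∫⁻ y in C, J y ∂surfaceMeasure (d + 1) ≤ q * a * surfaceMeasure (d + 1) C := by
    rw [← setLIntegral_const]
    exact setLIntegral_mono' hC fun y hy => (hJ y hy).2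
  refine ⟨measurable_fiberCount_of_injOn hf hC hinj, ?_, ?_⟩ <;> rw [hint]
  · calc volume (f '' C) ≤ q * (j * surfaceMeasure (d + 1) C) := himage_le
      _ ≤ q * (q * a * surfaceMeasure (d + 1) C) := by gcongr; exact hj.2
      _ = q ^ 2 * (a * surfaceMeasure (d + 1) C) := by ring
      _ ≤ q ^ 2 * ∫⁻ y in C, J y ∂surfaceMeasure (d + 1) := by gcongr
  · calc ∫⁻ y in C, J y ∂surfaceMeasure (d + 1)
        ≤ q * (a * surfaceMeasure (d + 1) C) := hupper.trans_eq (mul_assoc _ _ _)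
      _ ≤ q * (j * surfaceMeasure (d + 1) C) := by gcongr; exact hj.1
      _ ≤ q * (q * volume (f '' C)) := by gcongr
      _ = q ^ 2 * volume (f '' C) := by ring

theorem HasRegularJacobianOn.areaBounds_of_jacobian_mem_Icc (hf : HasRegularJacobianOn f J C ν)
    (hC : MeasurableSet C) (hν : ∀ y ∈ C, ‖ν y‖ = 1)
    (hnormal : ∀ y ∈ C, IsStrictNormalAt C (ν y) y) {q : NNReal} (hq : 1 < q) {a : ℝ≥0∞}
    (hJ : ∀ y ∈ C, J y ∈ Icc a (q * a)) : AreaBounds (q ^ 2) f J C := by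
  obtain ⟨S, hS, hd, rfl⟩ := exists_countable_partition (p := AreaBounds (q ^ 2) f J) hC
    (areaBounds_empty _ f J) fun y hy => by
      obtain ⟨L, hL, hJL⟩ := hf.exists_hasStrictFDerivAt y hy
      have hne : tangentJacobian (ν y) L ≠ 0 := fun h0 =>
        hf.jacobian_ne_zero y hy (by rw [hJL, h0, ENNReal.ofReal_zero])
      obtain ⟨U, hU, hinj, hbounds⟩ := (hnormal y hy).exists_nhds_measure_image (hν y hy) hL hne hq
      refine ⟨U, hU, fun s hs hsm => ?_⟩
      obtain ⟨hle_image, himage_le⟩ := hbounds s hs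
      exact areaBounds_of_injOn hsm hf.measurable (hinj.mono hs) (fun x hx => hJ x (hs hx).1)
        (hJL ▸ hJ y hy) hle_image himage_le
  exact .iUnion hf.measurable (fun i => (hS i).1) hd fun i => (hS i).2.2

theorem HasRegularJacobianOn.areaBounds (hf : HasRegularJacobianOn f J C ν)
    (hC : MeasurableSet C) (hν : ∀ y ∈ C, ‖ν y‖ = 1)
    (hnormal : ∀ y ∈ C, IsStrictNormalAt C (ν y) y) {q : NNReal} (hq : 1 < q) :
    AreaBounds (q ^ 2) f J C := by
  have hq0 : (q : ℝ≥0∞) ≠ 0 := mod_cast (one_pos.trans hq).ne'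
  have hq1 : 1 < (q : ℝ≥0∞) := mod_cast hq
  let I : ℤ → Set ℝ≥0∞ := fun j => Ico ((q : ℝ≥0∞) ^ j) ((q : ℝ≥0∞) ^ (j + 1))
  have hI : Pairwise (Function.onFun Disjoint I) :=
    (ENNReal.monotone_zpow hq1.le).pairwise_disjoint_on_Ico_succ
  have hcover : ⋃ j, C ∩ J ⁻¹' I j = C := by
    rw [← inter_iUnion, inter_eq_left]
    intro y hy
    obtain ⟨L, -, hJL⟩ := hf.exists_hasStrictFDerivAt y hy
    exact mem_iUnion.2 (ENNReal.exists_mem_Ico_zpow (hf.jacobian_ne_zero y hy)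
      (hJL ▸ ENNReal.ofReal_ne_top) hq1 ENNReal.coe_ne_top)
  have hslice : ∀ j, MeasurableSet (C ∩ J ⁻¹' I j) := fun j =>
    hC.inter (hf.measurable_jacobian measurableSet_Ico)
  rw [← hcover]
  refine .iUnion hf.measurable hslice (fun i j hij =>
    ((hI hij).preimage J).mono inter_subset_right inter_subset_right) fun j => ?_
  refine (hf.mono inter_subset_left).areaBounds_of_jacobian_mem_Icc (hslice j)
    (fun y hy => hν y hy.1) (fun y hy => (hnormal y hy.1).mono inter_subset_left) hq
    (a := (q : ℝ≥0∞) ^ j) fun y hy => ⟨hy.2.1, hy.2.2.le.trans_eq ?_⟩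
  rw [ENNReal.zpow_add hq0 ENNReal.coe_ne_top, zpow_one, mul_comm]

theorem IsNormalPair.areaBounds (hC : IsNormalPair C ν) (hf : HasRegularJacobianOn f J C ν)
    {q : NNReal} (hq : 1 < q) : AreaBounds (q ^ 2) f J C := by
  obtain ⟨N, P, hP, hd, rfl, hnormal⟩ := hC.exists_partition
  exact .iUnion hf.measurable hP hd fun k => (hf.mono (subset_iUnion P k)).areaBounds (hP k)
    (fun y hy => hC.norm_eq_one y (mem_iUnion_of_mem k hy)) (hnormal k) hq

theorem IsNormalPair.measurable_fiberCount (hC : IsNormalPair C ν)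
    (hf : HasRegularJacobianOn f J C ν) : Measurable (fiberCount f C) :=
  (hC.areaBounds hf (q := 2) one_lt_two).1

theorem le_of_forall_sq_mul_le {a b : ℝ≥0∞} (h : ∀ q : NNReal, 1 < q → a ≤ q ^ 2 * b) :
    a ≤ b := by
  have hsq : Tendsto (fun q : NNReal => ((q ^ 2 : NNReal) : ℝ≥0∞)) (𝓝[>] 1) (𝓝 1) := by
    have : ContinuousAt (fun q : NNReal => ((q ^ 2 : NNReal) : ℝ≥0∞)) 1 := by fun_prop
    simpa [ContinuousAt] using this.tendsto.mono_left nhdsWithin_le_nhds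
  have hmul := ENNReal.Tendsto.mul_const (b := b) hsq (.inl one_ne_zero)
  rw [one_mul] at hmul
  refine ge_of_tendsto hmul ?_
  filter_upwards [self_mem_nhdsWithin] with q hq
  simpa using h q hq

theorem IsNormalPair.lintegral_fiberCount (hC : IsNormalPair C ν)
    (hf : HasRegularJacobianOn f J C ν) :
    ∫⁻ y in C, J y ∂surfaceMeasure (d + 1) = ∫⁻ z, fiberCount f C z :=
  le_antisymm (le_of_forall_sq_mul_le fun _ hq => (hC.areaBounds hf hq).2.2)
    (le_of_forall_sq_mul_le fun _ hq => (hC.areaBounds hf hq).2.1)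

theorem IsNormalPair.map_withDensity (hC : IsNormalPair C ν) (hf : HasRegularJacobianOn f J C ν) :
    (((surfaceMeasure (d + 1)).restrict C).withDensity J).map f =
      volume.withDensity (fiberCount f C) := by
  ext E hE
  have hfE := hf.measurable hE
  have hD : IsNormalPair (f ⁻¹' E ∩ C) ν :=
    hC.mono (hfE.inter hC.measurableSet) inter_subset_right
  rw [Measure.map_apply hf.measurable hE, withDensity_apply _ hfE, withDensity_apply _ hE,
    Measure.restrict_restrict hfE, hD.lintegral_fiberCount (hf.mono inter_subset_right),
    fiberCount_preimage_inter, lintegral_indicator hE]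

theorem IsNormalPair.lintegral_mul_comp (hC : IsNormalPair C ν)
    (hf : HasRegularJacobianOn f J C ν) {g : Space d → ℝ≥0∞} (hg : Measurable g) :
    ∫⁻ y in C, J y * g (f y) ∂surfaceMeasure (d + 1) = ∫⁻ z, fiberCount f C z * g z := by
  calc ∫⁻ y in C, J y * g (f y) ∂surfaceMeasure (d + 1)
      = ∫⁻ y, g (f y) ∂((surfaceMeasure (d + 1)).restrict C).withDensity J :=
        (lintegral_withDensity_eq_lintegral_mul _ hf.measurable_jacobian
          (hg.comp hf.measurable)).symm
    _ = ∫⁻ z, g z ∂volume.withDensity (fiberCount f C) := by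
        rw [← hC.map_withDensity hf, lintegral_map hg hf.measurable]
    _ = ∫⁻ z, fiberCount f C z * g z :=
        lintegral_withDensity_eq_lintegral_mul _ (hC.measurable_fiberCount hf) hg

end AreaFormula

/-! ### Unit normals of `C¹` hypersurfaces -/

section Normals

variable {n : ℕ}

theorem hasStrictFDerivAt_of_contDiffOn {U : Set (Space n)} {φ : Space n → ℝ} (hU : IsOpen U)
    (hφ : ContDiffOn ℝ 1 φ U) {x : Space n} (hx : x ∈ U) :
    HasStrictFDerivAt φ (innerSL ℝ (gradient φ x)) x := by
  have hfderiv : fderiv ℝ φ x = innerSL ℝ (gradient φ x) := by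
    ext v
    simp [gradient]
  exact hfderiv ▸ (hφ.contDiffAt (hU.mem_nhds hx)).hasStrictFDerivAt one_ne_zero

theorem continuousOn_gradient {U : Set (Space n)} {φ : Space n → ℝ} (hU : IsOpen U)
    (hφ : ContDiffOn ℝ 1 φ U) : ContinuousOn (gradient φ) U :=
  (InnerProductSpace.toDual ℝ (Space n)).symm.continuous.comp_continuousOn
    (hφ.continuousOn_fderiv_of_isOpen hU le_rfl)

theorem IsUnitNormalAt.norm_eq_one {S : Set (Space n)} {x v : Space n}
    (h : IsUnitNormalAt S x v) : ‖v‖ = 1 := by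
  obtain ⟨-, -, -, -, -, -, -, -, hv, -⟩ := h
  exact hv

theorem IsUnitNormalAt.isStrictNormalAt {S : Set (Space n)} {x v : Space n}
    (h : IsUnitNormalAt S x v) : IsStrictNormalAt S v x := by
  obtain ⟨-, U, φ, hU, hxU, hφ, -, hSU, -, hspan⟩ := h
  obtain ⟨c, rfl⟩ := Submodule.mem_span_singleton.1 hspan
  have hderiv := (hasStrictFDerivAt_of_contDiffOn hU hφ hxU).isLittleO.mono
    (nhdsWithin_le_nhds (s := S ×ˢ S))
  refine (hderiv.const_mul_left (-c)).congr' ?_ .rfl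
  filter_upwards [self_mem_nhdsWithin,
    nhdsWithin_le_nhds (prod_mem_nhds (hU.mem_nhds hxU) (hU.mem_nhds hxU))] with p hpS hpU
  have hp₁ : φ p.1 = 0 := (hSU.subset ⟨hpS.1, hpU.1⟩).2
  have hp₂ : φ p.2 = 0 := (hSU.subset ⟨hpS.2, hpU.2⟩).2
  rw [hp₁, hp₂, innerSL_apply_apply, real_inner_smul_left]
  ring

theorem exists_smul_add_smul_eq_zero_of_isLocalExtrOn {φ ψ : Space n → ℝ} {x u w : Space n}
    (hφ : HasStrictFDerivAt φ (innerSL ℝ u) x) (hψ : HasStrictFDerivAt ψ (innerSL ℝ w) x)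
    (hext : IsLocalExtrOn ψ {y | φ y = φ x} x) :
    ∃ a b : ℝ, (a, b) ≠ 0 ∧ a • u + b • w = 0 := by
  obtain ⟨a, b, hab, hsum⟩ := hext.exists_multipliers_of_hasStrictFDerivAt_1d hφ hψ
  refine ⟨a, b, hab, ext_inner_right ℝ fun z => ?_⟩
  simpa [inner_add_left, real_inner_smul_left] using congrArg (· z) hsum

theorem IsUnitNormalAt.exists_eq_smul_of_isLocalExtrOn {S : Set (Space n)} {x v : Space n}
    (h : IsUnitNormalAt S x v) {ψ : Space n → ℝ} {w : Space n}
    (hψ : HasStrictFDerivAt ψ (innerSL ℝ w) x) (hext : IsLocalExtrOn ψ S x) :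
    ∃ c : ℝ, w = c • v := by
  obtain ⟨hxS, U, φ, hU, hxU, hφ, hgradient, hSU, hv, hspan⟩ := h
  obtain ⟨c, rfl⟩ := Submodule.mem_span_singleton.1 hspan
  have hc : c ≠ 0 := by
    rintro rfl
    simp at hv
  have hnhds : 𝓝[{y | φ y = φ x}] x = 𝓝[S] x := by
    refine nhdsWithin_eq_nhdsWithin hxU hU ?_
    rw [hSU, (hSU.subset ⟨hxS, hxU⟩).2, inter_comm]
    rfl
  have hext' : IsLocalExtrOn ψ {y | φ y = φ x} x := by rwa [IsLocalExtrOn, hnhds]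
  obtain ⟨a, b, hab, hsum⟩ := exists_smul_add_smul_eq_zero_of_isLocalExtrOn
    (hasStrictFDerivAt_of_contDiffOn hU hφ hxU) hψ hext'
  have hb : b ≠ 0 := by
    rintro rfl
    rw [zero_smul, add_zero, smul_eq_zero] at hsum
    exact hab (Prod.ext (hsum.resolve_right hgradient) rfl)
  refine ⟨-(b⁻¹ * a) / c, (inv_smul_smul₀ hb w).symm.trans ?_⟩
  rw [eq_neg_of_add_eq_zero_right hsum, smul_neg, smul_smul, smul_smul, div_mul_cancel₀ _ hc,
    neg_smul]

theorem IsUnitNormalAt.abs_inner_eq {S : Set (Space n)} {x v w : Space n}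
    (hv : IsUnitNormalAt S x v) (hw : IsUnitNormalAt S x w) (u : Space n) :
    |inner ℝ v u| = |inner ℝ w u| := by
  obtain ⟨hxS, U, φ, hU, hxU, hφ, -, hSU, hw, hspan⟩ := hw
  have hext : IsLocalExtrOn φ S x := by
    left
    filter_upwards [self_mem_nhdsWithin, nhdsWithin_le_nhds (hU.mem_nhds hxU)] with y hy hyU
    rw [(hSU.subset ⟨hxS, hxU⟩).2, (hSU.subset ⟨hy, hyU⟩).2]
  obtain ⟨c, hc⟩ := hv.exists_eq_smul_of_isLocalExtrOn
    (hasStrictFDerivAt_of_contDiffOn hU hφ hxU) hext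
  obtain ⟨a, rfl⟩ := Submodule.mem_span_singleton.1 hspan
  rw [hc, smul_smul, norm_smul, hv.norm_eq_one, mul_one, Real.norm_eq_abs] at hw
  rw [hc, smul_smul, real_inner_smul_left, abs_mul, hw, one_mul]

theorem IsC1Hypersurface.exists_nhds_isUnitNormalAt {S : Set (Space n)} (hS : IsC1Hypersurface S)
    {x : Space n} (hx : x ∈ S) :
    ∃ V ∈ 𝓝 x, ∃ ν : Space n → Space n, Measurable ν ∧ ∀ y ∈ S ∩ V, IsUnitNormalAt S y (ν y) := by
  obtain ⟨-, -, U, φ, hU, hxU, hφ, hgradient, hSU, -, -⟩ := hS x hx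
  let V : Set (Space n) := U ∩ gradient φ ⁻¹' {0}ᶜ
  have hcont : ContinuousOn (gradient φ) U := continuousOn_gradient hU hφ
  have hV : IsOpen V := hcont.isOpen_inter_preimage hU isOpen_compl_singleton
  have hcontV : ContinuousOn (gradient φ) V := hcont.mono inter_subset_left
  classical
  refine ⟨V, hV.mem_nhds ⟨hxU, hgradient⟩,
    V.piecewise (fun y => ‖gradient φ y‖⁻¹ • gradient φ y) (fun _ => 0),
    ContinuousOn.measurable_piecewise
      ((hcontV.norm.inv₀ fun y hy => norm_ne_zero_iff.2 hy.2).smul hcontV) continuousOn_const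
      hV.measurableSet, fun y hy => ?_⟩
  rw [piecewise_eq_of_mem _ _ _ hy.2]
  refine ⟨hy.1, U, φ, hU, hy.2.1, hφ, hy.2.2, hSU, ?_,
    Submodule.smul_mem _ _ (Submodule.mem_span_singleton_self _)⟩
  exact norm_smul_inv_norm (𝕜 := ℝ) hy.2.2

theorem exists_measurable_eqOn_of_pairwise_disjoint {ι α β : Type*} [Countable ι]
    [MeasurableSpace α] [MeasurableSpace β] [Nonempty β] {P : ι → Set α}
    (hP : ∀ i, MeasurableSet (P i)) (hd : Pairwise (Function.onFun Disjoint P)) {g : ι → α → β}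
    (hg : ∀ i, Measurable (g i)) : ∃ f : α → β, Measurable f ∧ ∀ i, EqOn f (g i) (P i) := by
  cases isEmpty_or_nonempty ι
  · exact ⟨fun _ => Classical.arbitrary β, measurable_const, fun i => isEmptyElim i⟩
  · exact exists_measurable_piecewise P hP g hg fun i j hij y hy => ((hd hij).le_bot hy).elim

theorem IsC1Hypersurface.exists_measurable_normal {S M : Set (Space n)} (hS : IsC1Hypersurface S)
    (hM : MeasurableSet M) (hMS : M ⊆ S) :
    ∃ ν : Space n → Space n, Measurable ν ∧ ∀ y ∈ M, IsUnitNormalAt S y (ν y) := by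
  obtain ⟨P, hP, hd, rfl⟩ := exists_countable_partition hM
    (p := fun s => ∃ ν : Space n → Space n, Measurable ν ∧ ∀ y ∈ s, IsUnitNormalAt S y (ν y))
    ⟨fun _ => 0, measurable_const, fun y hy => hy.elim⟩ fun y hy => by
      obtain ⟨V, hV, ν, hν, hnormal⟩ := hS.exists_nhds_isUnitNormalAt (hMS hy)
      exact ⟨V, hV, fun s hs _ => ⟨ν, hν, fun z hz => hnormal z ⟨hMS (hs hz).1, (hs hz).2⟩⟩⟩
  choose hPm _ ν hν hnormal using hP
  obtain ⟨ν', hν', heq⟩ := exists_measurable_eqOn_of_pairwise_disjoint hPm hd hν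
  refine ⟨ν', hν', fun y hy => ?_⟩
  obtain ⟨i, hi⟩ := mem_iUnion.1 hy
  exact heq i hi ▸ hnormal i y hi

theorem IsC1Hypersurface.exists_isNormalPair {S M : Set (Space n)} (hS : IsC1Hypersurface S)
    (hM : MeasurableSet M) (hMS : M ⊆ S) :
    ∃ ν : Space n → Space n, IsNormalPair M ν ∧ ∀ y ∈ M, IsUnitNormalAt S y (ν y) := by
  obtain ⟨ν, hν, hnormal⟩ := hS.exists_measurable_normal hM hMS
  exact ⟨ν, .of_isStrictNormalAt hM hν (fun y hy => (hnormal y hy).norm_eq_one)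
    fun y hy => (hnormal y hy).isStrictNormalAt.mono hMS, hnormal⟩

theorem IsUnitNormalField.exists_isNormalPair {A : Set (Space n)} {ν : Space n → Space n}
    (h : IsUnitNormalField A ν) : ∃ (B : Set (Space n)) (ν' : Space n → Space n), B ⊆ A ∧
      surfaceMeasure n (A \ B) = 0 ∧ IsNormalPair B ν' ∧
      ∀ y ∈ B, ∀ u, |inner ℝ (ν y) u| = |inner ℝ (ν' y) u| := by
  obtain ⟨N, S, M, hM, hnull⟩ := h
  choose ν₀ hν₀ hnormal₀ using fun i =>
    (hM i).1.exists_measurable_normal (hM i).2.1 (hM i).2.2.1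
  have hPM : ∀ i, disjointed M i ⊆ M i := disjointed_subset M
  have hP : ∀ i, MeasurableSet (disjointed M i) := fun i =>
    disjointedRec (fun _ j ht => ht.diff (hM j).2.1) (hM i).2.1
  have hd := disjoint_disjointed M
  obtain ⟨ν', hν', heq⟩ := exists_measurable_eqOn_of_pairwise_disjoint hP hd hν₀
  have hnormal : ∀ i, ∀ y ∈ disjointed M i, IsUnitNormalAt (S i) y (ν' y) := fun i y hy =>
    heq i hy ▸ hnormal₀ i y (hPM i hy)
  have hmem : ∀ y ∈ ⋃ i, M i, ∃ i, y ∈ disjointed M i := fun y hy => by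
    rwa [← iUnion_disjointed, mem_iUnion] at hy
  refine ⟨⋃ i, M i, ν', iUnion_subset fun i => (hM i).2.2.2.1, hnull,
    ⟨.iUnion fun i => (hM i).2.1, hν', fun y hy => ?_, N, disjointed M, hP, hd,
      iUnion_disjointed, fun i y hy => ?_⟩, fun y hy u => ?_⟩
  · obtain ⟨i, hi⟩ := hmem y hy
    exact (hnormal i y hi).norm_eq_one
  · exact (hnormal i y hy).isStrictNormalAt.mono ((hPM i).trans (hM i).2.2.1)
  · obtain ⟨i, hi⟩ := hmem y hy
    exact ((hM i).2.2.2.2 y (hPM i hi)).abs_inner_eq (hnormal i y hi) u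

theorem isPiecewiseC1_empty : IsPiecewiseC1 (∅ : Set (Space n)) :=
  ⟨fun _ => 0, 0, Fin.elim0, Fin.elim0, fun i => i.elim0, by simp⟩

theorem IsPiecewiseC1.union {A S M : Set (Space n)} (hA : IsPiecewiseC1 A) (hAm : MeasurableSet A)
    (hS : IsC1Hypersurface S) (hM : MeasurableSet M) (hMS : M ⊆ S) : IsPiecewiseC1 (A ∪ M) := by
  classical
  obtain ⟨ν, N, T, P, hP, hnull⟩ := hA
  obtain ⟨ν', -, hν'⟩ := hS.exists_measurable_normal hM hMS
  refine ⟨A.piecewise ν ν', N + 1, Fin.cons S T, Fin.cons (M \ A) P,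
    fun i => ?_, ?_⟩
  · refine Fin.cases ?_ (fun i => ?_) i
    · refine ⟨hS, hM.diff hAm, sdiff_subset.trans hMS, sdiff_subset.trans subset_union_right,
        fun x hx => ?_⟩
      rw [piecewise_eq_of_notMem _ _ _ hx.2]
      exact hν' x hx.1
    · obtain ⟨hT, hPm, hPT, hPA, hν⟩ := hP i
      refine ⟨hT, hPm, hPT, hPA.trans subset_union_left, fun x hx => ?_⟩
      rw [piecewise_eq_of_mem _ _ _ (hPA hx)]
      exact hν x hx
  · refine measure_mono_null (fun x hx => ?_) hnull
    simp only [Set.mem_sdiff, mem_union, mem_iUnion, Fin.exists_fin_succ, Fin.cons_zero,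
      Fin.cons_succ] at hx ⊢
    tauto

theorem isPiecewiseC1_iUnion {m : ℕ} {S : Fin m → Set (Space n)}
    (hS : ∀ i, IsC1Hypersurface (S i)) (hm : ∀ i, MeasurableSet (S i)) :
    IsPiecewiseC1 (⋃ i, S i) := by
  induction m with
  | zero => simpa using isPiecewiseC1_empty
  | succ m ih =>
    have hsplit : ⋃ i, S i = (⋃ i : Fin m, S i.succ) ∪ S 0 := by
      ext x
      simp [Fin.exists_fin_succ, or_comm]
    rw [hsplit]
    exact (ih (fun i => hS i.succ) fun i => hm i.succ).union (.iUnion fun i => hm i.succ) (hS 0)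
      (hm 0) subset_rfl

end Normals

/-! ### The invariant measure on lines -/

section Directions

variable {d : ℕ}

theorem measurePreserving_consL :
    MeasurePreserving (consL d) ((volume : Measure ℝ).prod volume) volume := by
  let e : WithLp 2 (ℝ × Space d) ≃ₗᵢ[ℝ] Space (d + 1) :=
    { (WithLp.linearEquiv 2 ℝ (ℝ × Space d)).trans (consL d).toLinearEquiv with
      norm_map' := fun x => by
        have hnorm := norm_sq_eq_head_tail (consL d (WithLp.ofLp x))
        refine (pow_left_inj₀ (norm_nonneg _) (norm_nonneg _) two_ne_zero).1 (hnorm.trans ?_)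
        rw [WithLp.prod_norm_sq_eq_of_L2, head_consL, tail_consL, Real.norm_eq_abs, sq_abs]
        rfl }
  exact e.measurePreserving.comp (WithLp.volume_preserving_toLp ℝ (Space d))

theorem lintegral_eq_pow_mul_lintegral_smul {E : Type*} [NormedAddCommGroup E] [NormedSpace ℝ E]
    [FiniteDimensional ℝ E] [MeasurableSpace E] [BorelSpace E] (μ : Measure E)
    [μ.IsAddHaarMeasure] {r : ℝ} (hr : r ≠ 0) (g : E → ℝ≥0∞) :
    ∫⁻ z, g z ∂μ = ‖r‖ₑ ^ Module.finrank ℝ E * ∫⁻ z, g (r • z) ∂μ := by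
  have hsmul : ∫⁻ z, g (r • z) ∂μ =
      ENNReal.ofReal |(r ^ Module.finrank ℝ E)⁻¹| * ∫⁻ z, g z ∂μ := by
    rw [← smul_eq_mul, ← lintegral_smul_measure, ← Measure.map_addHaar_smul μ hr]
    exact (lintegral_map_equiv g (Homeomorph.smulOfNeZero r hr).toMeasurableEquiv).symm
  rw [hsmul, ← mul_assoc, abs_inv, abs_pow, ENNReal.ofReal_inv_of_pos (by positivity),
    ENNReal.ofReal_pow (abs_nonneg _), ← Real.enorm_eq_ofReal_abs, ENNReal.mul_inv_cancel, one_mul]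
  · exact pow_ne_zero _ (enorm_ne_zero.2 hr)
  · exact ENNReal.pow_ne_top enorm_ne_top

@[fun_prop]
theorem measurable_dir : Measurable (dir : Space d → Space (d + 1)) := continuous_dir.measurable

theorem lintegral_eq_lintegral_smul_dir {F : Space (d + 1) → ℝ≥0∞} (hF : Measurable F) :
    ∫⁻ w, F w = ∫⁻ b : Space d, ∫⁻ s : ℝ, ‖s‖ₑ ^ d * F (s • dir b) := by
  have hslice : ∀ s : ℝ, s ≠ 0 → ∫⁻ z : Space d, F (consL d (s, z)) =
      ∫⁻ b : Space d, ‖s‖ₑ ^ d * F (s • dir b) := by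
    intro s hs
    have hsmul : ∀ b : Space d, consL d (s, s • b) = s • dir b := fun b => by
      apply ext_head_tail <;> simp
    simp_rw [← hsmul]
    rw [lintegral_eq_pow_mul_lintegral_smul volume hs, lintegral_const_mul,
      finrank_euclideanSpace_fin]
    exact hF.comp (by fun_prop)
  have hne : ∀ᵐ s : ℝ, s ≠ 0 := by simp [ae_iff]
  rw [← measurePreserving_consL.lintegral_comp hF, lintegral_prod _ (by fun_prop),
    lintegral_congr_ae (hne.mono hslice), lintegral_lintegral_swap]
  exact (Measurable.mul (by fun_prop) (hF.comp (by fun_prop))).aemeasurable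

/-- The density, in the chart `b ↦ dir b`, of the rotation invariant measure on directions. -/
def lineWeight (b : Space d) : ℝ≥0∞ := (‖dir b‖ₑ ^ (d + 2))⁻¹

@[fun_prop]
theorem measurable_lineWeight : Measurable (lineWeight : Space d → ℝ≥0∞) := by
  unfold lineWeight
  fun_prop

/-- The mean over all directions of the area of the projection of a hypersurface element with
normal `ν`. -/
def directionIntegral (ν : Space (d + 1)) : ℝ≥0∞ :=
  ∫⁻ b : Space d, lineWeight b * ‖(inner ℝ ν (dir b) : ℝ)‖ₑ

theorem lintegral_indicator_ball_smul {E : Type*} [NormedAddCommGroup E] [InnerProductSpace ℝ E]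
    (d : ℕ) (ν : E) {w : E} (hw : w ≠ 0) :
    ∫⁻ s : ℝ, ‖s‖ₑ ^ d * (Metric.ball (0 : E) 1).indicator
        (fun x => ‖(inner ℝ ν x : ℝ)‖ₑ) (s • w) =
      (∫⁻ r in Metric.ball (0 : ℝ) 1, ‖r‖ₑ ^ (d + 1)) *
        ((‖w‖ₑ ^ (d + 2))⁻¹ * ‖(inner ℝ ν w : ℝ)‖ₑ) := by
  have hnorm : ‖w‖ ≠ 0 := norm_ne_zero_iff.2 hw
  have hmem (r : ℝ) : (‖w‖⁻¹ • r) • w ∈ Metric.ball (0 : E) 1 ↔ r ∈ Metric.ball (0 : ℝ) 1 := by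
    rw [mem_ball_zero_iff, mem_ball_zero_iff, norm_smul, norm_smul, norm_inv, norm_norm,
      mul_right_comm, inv_mul_cancel₀ hnorm, one_mul]
  have hscale (r : ℝ) : ‖‖w‖⁻¹ • r‖ₑ ^ d * (Metric.ball (0 : E) 1).indicator
        (fun x => ‖(inner ℝ ν x : ℝ)‖ₑ) ((‖w‖⁻¹ • r) • w) =
      (‖w‖ₑ⁻¹ ^ (d + 1) * ‖(inner ℝ ν w : ℝ)‖ₑ) *
        (Metric.ball (0 : ℝ) 1).indicator (fun r => ‖r‖ₑ ^ (d + 1)) r := by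
    by_cases hr : r ∈ Metric.ball (0 : ℝ) 1
    · rw [indicator_of_mem ((hmem r).2 hr), indicator_of_mem hr, real_inner_smul_right, enorm_mul,
        smul_eq_mul, enorm_mul, enorm_inv hnorm, enorm_norm]
      ring
    · rw [indicator_of_notMem (mt (hmem r).1 hr), indicator_of_notMem hr, mul_zero, mul_zero]
  rw [lintegral_eq_pow_mul_lintegral_smul volume (inv_ne_zero hnorm)]
  simp_rw [hscale]
  rw [lintegral_const_mul _ (Measurable.indicator (by fun_prop) measurableSet_ball),
    lintegral_indicator measurableSet_ball, enorm_inv hnorm, enorm_norm, Module.finrank_self,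
    pow_one, ENNReal.inv_pow]
  ring

theorem lintegral_ball_inner (ν : Space (d + 1)) :
    ∫⁻ w in Metric.ball (0 : Space (d + 1)) 1, ‖(inner ℝ ν w : ℝ)‖ₑ =
      (∫⁻ r in Metric.ball (0 : ℝ) 1, ‖r‖ₑ ^ (d + 1)) * directionIntegral ν := by
  rw [← lintegral_indicator measurableSet_ball, lintegral_eq_lintegral_smul_dir
    (Measurable.indicator (by fun_prop) measurableSet_ball), directionIntegral,
    ← lintegral_const_mul _ (by fun_prop)]
  exact lintegral_congr fun b => lintegral_indicator_ball_smul d ν (dir_ne_zero b)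

theorem radialIntegral_ne_zero (k : ℕ) : ∫⁻ r in Metric.ball (0 : ℝ) 1, ‖r‖ₑ ^ k ≠ 0 := by
  rw [← pos_iff_ne_zero, setLIntegral_pos_iff (by fun_prop)]
  have hsupport : ({0}ᶜ : Set ℝ) ⊆ Function.support fun r : ℝ => ‖r‖ₑ ^ k := fun r hr =>
    pow_ne_zero k (enorm_ne_zero.2 hr)
  calc 0 < volume (Metric.ball (0 : ℝ) 1) := Metric.measure_ball_pos volume _ one_pos
    _ = volume (Metric.ball (0 : ℝ) 1 ∩ {0}ᶜ) := (measure_inter_conull (by simp)).symm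
    _ ≤ _ := by
      rw [inter_comm]
      exact measure_mono (inter_subset_inter_left _ hsupport)

theorem setLIntegral_ball_ne_top {E : Type*} [NormedAddCommGroup E] [MeasurableSpace E]
    [ProperSpace E] [OpensMeasurableSpace E] {μ : Measure E} [IsFiniteMeasureOnCompacts μ]
    {f : E → ℝ≥0∞} (hf : ∀ w, ‖w‖ ≤ 1 → f w ≤ 1) :
    ∫⁻ w in Metric.ball 0 1, f w ∂μ ≠ ∞ :=
  (setLIntegral_lt_top_of_le_nnreal measure_ball_lt_top.ne
    ⟨1, fun w hw => hf w (mem_ball_zero_iff.1 hw).le⟩).ne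

theorem radialIntegral_ne_top (k : ℕ) : ∫⁻ r in Metric.ball (0 : ℝ) 1, ‖r‖ₑ ^ k ≠ ∞ :=
  setLIntegral_ball_ne_top fun r hr =>
    pow_le_one₀ (by positivity) (by simpa [← ofReal_norm] using hr)

/-- The constant of the Crofton formula: the value of `directionIntegral` at any unit vector. -/
def croftonConst (d : ℕ) : ℝ≥0∞ := directionIntegral (dir (0 : Space d))

theorem directionIntegral_eq {ν : Space (d + 1)} (hν : ‖ν‖ = 1) :
    directionIntegral ν = croftonConst d := by
  let R : Space (d + 1) ≃ₗᵢ[ℝ] Space (d + 1) :=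
    Submodule.reflection (Submodule.span ℝ {ν - dir 0})ᗮ
  have hRν : R ν = dir 0 := Submodule.reflection_sub (hν.trans norm_dir_zero.symm)
  have hball : ∫⁻ w in Metric.ball (0 : Space (d + 1)) 1, ‖(inner ℝ (dir 0) w : ℝ)‖ₑ =
      ∫⁻ w in Metric.ball (0 : Space (d + 1)) 1, ‖(inner ℝ ν w : ℝ)‖ₑ := by
    rw [← R.measurePreserving.setLIntegral_comp_preimage measurableSet_ball (by fun_prop),
      R.preimage_ball, map_zero, ← hRν]
    simp only [R.inner_map_map]
  rw [lintegral_ball_inner, lintegral_ball_inner] at hball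
  exact ((ENNReal.mul_right_inj (radialIntegral_ne_zero _) (radialIntegral_ne_top _)).1 hball).symm

theorem croftonConst_ne_top : croftonConst d ≠ ∞ := by
  intro h
  have hball := lintegral_ball_inner (dir (0 : Space d))
  rw [← croftonConst, h, ENNReal.mul_top (radialIntegral_ne_zero _)] at hball
  refine setLIntegral_ball_ne_top (fun w hw => ?_) hball
  rw [← ofReal_norm]
  refine ENNReal.ofReal_le_one.2 ((norm_inner_le_norm _ _).trans ?_)
  rwa [norm_dir_zero, one_mul]

end Directions

/-! ### Crofton's formula -/

section Crofton

variable {d : ℕ}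

/-- The number of points where `B`, with normal field `ν`, is crossed transversally by the line with
direction `dir b` through the points that `proj b` maps to `a`. -/
def lineCount (B : Set (Space (d + 1))) (ν : Space (d + 1) → Space (d + 1)) (b a : Space d) :
    ℝ≥0∞ :=
  fiberCount (proj b) (B ∩ {y | inner ℝ (ν y) (dir b) ≠ 0}) a

theorem continuous_proj_uncurried :
    Continuous fun p : Space (d + 1) × Space d => proj p.2 p.1 := by
  simp only [proj_apply]
  fun_prop

@[fun_prop]
theorem measurable_proj_uncurried :
    Measurable fun p : Space (d + 1) × Space d => proj p.2 p.1 :=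
  continuous_proj_uncurried.measurable

theorem IsStrictNormalAt.exists_nhds_injOn {P : Set (Space (d + 1))} {ν y₀ : Space (d + 1)}
    (hP : IsStrictNormalAt P ν y₀) {b₀ : Space d} (hb₀ : inner ℝ ν (dir b₀) ≠ 0) :
    ∃ U ∈ 𝓝 (y₀, b₀), InjOn (fun p : Space (d + 1) × Space d => (p.2, proj p.2 p.1))
      ((P ×ˢ univ) ∩ U) := by
  obtain ⟨ε, hε, hlt⟩ := exists_pos_mul_lt (abs_pos.2 hb₀) ‖dir b₀‖
  have hnear : ∀ᶠ p : Space (d + 1) × Space (d + 1) in 𝓝 (y₀, y₀), p ∈ P ×ˢ P →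
      |inner ℝ ν (p.1 - p.2)| ≤ ε * ‖p.1 - p.2‖ :=
    eventually_nhdsWithin_iff.1 (hP.def hε)
  obtain ⟨U₁, hU₁, U₂, hU₂, hprod⟩ := mem_nhds_prod_iff.1 hnear
  have hV : ∀ᶠ b in 𝓝 b₀, ‖dir b‖ * ε < |inner ℝ ν (dir b)| :=
    (continuous_dir.norm.mul_const ε).continuousAt.eventually_lt
      (continuous_const.inner continuous_dir).abs.continuousAt hlt
  refine ⟨(U₁ ∩ U₂) ×ˢ {b | ‖dir b‖ * ε < |inner ℝ ν (dir b)|},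
    prod_mem_nhds (inter_mem hU₁ hU₂) hV, ?_⟩
  rintro ⟨y, b⟩ ⟨⟨hyP, -⟩, hyU, hb⟩ ⟨y', b'⟩ ⟨⟨hyP', -⟩, hyU', -⟩ heq
  obtain ⟨rfl, hproj⟩ := Prod.mk.inj heq
  have hsub := sub_eq_smul_dir hproj.symm
  have hle : |inner ℝ ν (y - y')| ≤ ε * ‖y - y'‖ :=
    hprod (mk_mem_prod hyU.1 hyU'.2) (mk_mem_prod hyP hyP')
  rw [hsub, real_inner_smul_right, abs_mul, norm_smul, mul_left_comm, mul_comm ε,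
    Real.norm_eq_abs] at hle
  have hhead : head (y - y') = 0 := by
    by_contra hne
    exact (le_of_mul_le_mul_left hle (abs_pos.2 hne)).not_gt hb
  rw [hhead, zero_smul, sub_eq_zero] at hsub
  exact Prod.ext hsub rfl

theorem lineCount_eq_fiberCount (B : Set (Space (d + 1))) (ν : Space (d + 1) → Space (d + 1))
    (b a : Space d) :
    lineCount B ν b a = fiberCount (fun p : Space (d + 1) × Space d => (p.2, proj p.2 p.1))
      {p | p.1 ∈ B ∧ inner ℝ (ν p.1) (dir p.2) ≠ 0} (b, a) := by
  rw [lineCount, fiberCount, fiberCount, ← Measure.count_injective_image (f := fun y => (y, b))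
    (fun y y' h => (Prod.mk.inj h).1)]
  congr 1
  ext ⟨y, b'⟩
  simp only [mem_image, mem_inter_iff, mem_preimage, mem_singleton_iff, mem_ofPred_eq,
    Prod.mk.injEq]
  constructor
  · rintro ⟨y, ⟨⟨hy, hb⟩, ha⟩, rfl, rfl⟩
    exact ⟨⟨hy, hb⟩, rfl, ha⟩
  · rintro ⟨⟨hy, hb⟩, rfl, ha⟩
    exact ⟨y, ⟨⟨hy, hb⟩, ha⟩, rfl, rfl⟩

theorem IsNormalPair.measurable_lineCount {B : Set (Space (d + 1))}
    {ν : Space (d + 1) → Space (d + 1)} (hB : IsNormalPair B ν) :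
    Measurable fun p : Space d × Space d => lineCount B ν p.1 p.2 := by
  obtain ⟨N, P, hP, hd, hU, hnormal⟩ := hB.exists_partition
  have hν := hB.measurable
  let T (k : Fin N) : Set (Space (d + 1) × Space d) :=
    {p | p.1 ∈ P k ∧ inner ℝ (ν p.1) (dir p.2) ≠ 0}
  have hinner : Measurable fun p : Space (d + 1) × Space d => (inner ℝ (ν p.1) (dir p.2) : ℝ) := by
    fun_prop
  have hT (k : Fin N) : MeasurableSet (T k) :=
    ((hP k).preimage measurable_fst).inter (hinner (measurableSet_singleton 0).compl)
  have hTd : Pairwise (Function.onFun Disjoint T) := fun i j hij =>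
    Set.disjoint_left.2 fun p hi hj => (hd hij).le_bot ⟨hi.1, hj.1⟩
  have hline : Measurable fun p : Space (d + 1) × Space d => (p.2, proj p.2 p.1) := by fun_prop
  have hUT : {p : Space (d + 1) × Space d | p.1 ∈ B ∧ inner ℝ (ν p.1) (dir p.2) ≠ 0} =
      ⋃ k, T k := by
    ext p
    simp [T, ← hU]
  simp_rw [lineCount_eq_fiberCount, hUT, fiberCount_iUnion hline hT hTd]
  refine Measurable.tsum fun k => QuadraticCrofton.measurable_fiberCount hline (hT k) ?_
  rintro ⟨y, b⟩ ⟨hy, hb⟩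
  obtain ⟨U, hU, hinj⟩ := (hnormal k y hy).exists_nhds_injOn hb
  exact ⟨U, hU, hinj.mono
    (inter_subset_inter_left U fun p (hp : p ∈ T k) => mk_mem_prod hp.1 (mem_univ _))⟩

theorem setLIntegral_inter_eq {X : Type*} [MeasurableSpace X] {μ : Measure X} {B E : Set X}
    {F : X → ℝ≥0∞} (hE : MeasurableSet E) (hF : ∀ y ∉ E, F y = 0) :
    ∫⁻ y in B ∩ E, F y ∂μ = ∫⁻ y in B, F y ∂μ := by
  have hFE : E.indicator F = F := indicator_eq_self.2 (Function.support_subset_iff'.2 hF)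
  rw [inter_comm, ← setLIntegral_indicator hE, hFE]

theorem IsNormalPair.lintegral_proj {B : Set (Space (d + 1))}
    {ν : Space (d + 1) → Space (d + 1)} (hB : IsNormalPair B ν) (b : Space d)
    {g : Space d → ℝ≥0∞} (hg : Measurable g) :
    ∫⁻ y in B, ‖(inner ℝ (ν y) (dir b) : ℝ)‖ₑ * g (proj b y) ∂surfaceMeasure (d + 1) =
      ∫⁻ a, lineCount B ν b a * g a := by
  have hν := hB.measurable
  have hinner : Measurable fun y => (inner ℝ (ν y) (dir b) : ℝ) := by fun_prop
  have hE : MeasurableSet {y | inner ℝ (ν y) (dir b) ≠ (0 : ℝ)} :=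
    hinner (measurableSet_singleton 0).compl
  have hproj : HasRegularJacobianOn (proj b) (fun y => ‖(inner ℝ (ν y) (dir b) : ℝ)‖ₑ)
      (B ∩ {y | inner ℝ (ν y) (dir b) ≠ (0 : ℝ)}) ν :=
    ⟨(proj b).continuous.measurable, by fun_prop, fun y hy => enorm_ne_zero.2 hy.2, fun y _ =>
      ⟨proj b, (proj b).hasStrictFDerivAt, by rw [tangentJacobian_proj, Real.enorm_eq_ofReal_abs]⟩⟩
  rw [← setLIntegral_inter_eq hE fun y hy => ?_]
  · exact (hB.mono (hB.measurableSet.inter hE) inter_subset_left).lintegral_mul_comp hproj hg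
  · rw [not_not.1 hy, enorm_zero, zero_mul]

/-- The integral over all lines, with respect to the invariant measure; `F b a` is the value at the
line `{y | proj b y = a}`. -/
def lineIntegral (F : Space d → Space d → ℝ≥0∞) : ℝ≥0∞ :=
  ∫⁻ b, lineWeight b * ∫⁻ a, F b a

theorem IsNormalPair.crofton {B : Set (Space (d + 1))}
    {ν : Space (d + 1) → Space (d + 1)} (hB : IsNormalPair B ν)
    (hfin : surfaceMeasure (d + 1) B ≠ ∞) :
    lineIntegral (lineCount B ν) = croftonConst d * surfaceMeasure (d + 1) B := by
  have hν := hB.measurable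
  have : IsFiniteMeasure ((surfaceMeasure (d + 1)).restrict B) :=
    isFiniteMeasure_restrict.2 hfin
  have hdir (b : Space d) : lineWeight b * ∫⁻ a, lineCount B ν b a =
      ∫⁻ y in B, lineWeight b * ‖(inner ℝ (ν y) (dir b) : ℝ)‖ₑ ∂surfaceMeasure (d + 1) := by
    rw [lintegral_const_mul _ (by fun_prop)]
    simpa only [mul_one] using
      congrArg (lineWeight b * ·) (hB.lintegral_proj b (g := fun _ => 1) measurable_const).symm
  simp_rw [lineIntegral, hdir]
  rw [lintegral_lintegral_swap (Measurable.aemeasurable (by unfold Function.uncurry; fun_prop)),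
    ← setLIntegral_const]
  exact setLIntegral_congr_fun hB.measurableSet
    fun y hy => directionIntegral_eq (hB.norm_eq_one y hy)

end Crofton

/-! ### The quadratic Crofton formula -/

section CentralProjection

variable {d : ℕ}

/-- The central projection from `o`, in the chart `b ↦ dir b` of directions. -/
def centralProj (o y : Space (d + 1)) : Space d := (head (y - o))⁻¹ • tail (y - o)

@[fun_prop]
theorem measurable_centralProj :
    Measurable fun p : Space (d + 1) × Space (d + 1) => centralProj p.1 p.2 := by
  unfold centralProj
  fun_prop

theorem sub_eq_smul_dir_centralProj {o y : Space (d + 1)} (h : head (y - o) ≠ 0) :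
    y - o = head (y - o) • dir (centralProj o y) := by
  apply ext_head_tail
  · simp
  · rw [map_smul, tail_dir, centralProj, smul_inv_smul₀ h]

theorem centralProj_eq_iff {o y : Space (d + 1)} (h : head (y - o) ≠ 0) (b : Space d) :
    centralProj o y = b ↔ proj b y = proj b o := by
  rw [centralProj, inv_smul_eq_iff₀ h, ← sub_eq_zero (a := proj b y), ← map_sub, proj_apply,
    sub_eq_zero]

theorem hasStrictFDerivAt_centralProj {o y : Space (d + 1)} (h : head (y - o) ≠ 0) :
    HasStrictFDerivAt (centralProj o) ((head (y - o))⁻¹ • proj (centralProj o y)) y := by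
  have hhead : HasStrictFDerivAt (fun y : Space (d + 1) => head (y - o)) head y :=
    head.hasStrictFDerivAt.comp y ((hasStrictFDerivAt_id y).sub_const o)
  have htail : HasStrictFDerivAt (fun y : Space (d + 1) => tail (y - o)) tail y :=
    tail.hasStrictFDerivAt.comp y ((hasStrictFDerivAt_id y).sub_const o)
  refine (((hasStrictDerivAt_inv h).comp_hasStrictFDerivAt y hhead).smul htail).congr_fderiv ?_
  ext1 v
  change (head (y - o))⁻¹ • tail v + (-(head (y - o) ^ 2)⁻¹ * head v) • tail (y - o) =
    (head (y - o))⁻¹ • (tail v - head v • (head (y - o))⁻¹ • tail (y - o))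
  module

theorem tangentJacobian_ne_zero {ν : Space (d + 1)} {L : Space (d + 1) →L[ℝ] Space d}
    (h : ∀ v, inner ℝ ν v = 0 → L v = 0 → v = 0) : tangentJacobian ν L ≠ 0 := by
  intro hdet
  obtain ⟨v, hv, hv0⟩ := Submodule.exists_mem_ne_zero_of_ne_bot
    (LinearMap.bot_lt_ker_of_det_eq_zero (abs_eq_zero.1 hdet)).ne'
  have hbordered : bordered ν L v = 0 := hv
  exact hv0 (h v (by simpa using congrArg head hbordered) (by simpa using congrArg tail hbordered))

theorem continuous_tangentJacobian (L : Space (d + 1) →L[ℝ] Space d) :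
    Continuous fun ν => tangentJacobian ν L := by
  refine (ContinuousLinearMap.continuous_det.comp (g := ContinuousLinearMap.det)
    (f := fun ν => bordered ν L) ?_).abs
  exact continuous_const.clm_comp ((ContinuousLinearMap.prodₗᵢ ℝ).continuous.comp
    ((innerSL ℝ).continuous.prodMk continuous_const))

theorem HasRegularJacobianOn.surfaceMeasure_eq_zero {C : Set (Space (d + 1))}
    {ν : Space (d + 1) → Space (d + 1)} {f : Space (d + 1) → Space d} {J : Space (d + 1) → ℝ≥0∞}
    (hf : HasRegularJacobianOn f J C ν) (hC : IsNormalPair C ν) {Z : Set (Space d)}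
    (hCZ : MapsTo f C Z) (hZ : volume Z = 0) : surfaceMeasure (d + 1) C = 0 := by
  have hfiber : ∀ᵐ z, fiberCount f C z = 0 := by
    filter_upwards [measure_eq_zero_iff_ae_notMem.1 hZ] with z hz
    exact fiberCount_eq_zero fun hzC => hz (hCZ.image_subset hzC)
  have hJ : ∫⁻ y in C, J y ∂surfaceMeasure (d + 1) = 0 := by
    rw [hC.lintegral_fiberCount hf, lintegral_congr_ae hfiber, lintegral_zero]
  by_contra hne
  refine ((setLIntegral_pos_iff hf.measurable_jacobian).2 ?_).ne' hJ
  have hsupport : C ⊆ Function.support J := hf.jacobian_ne_zero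
  rwa [inter_eq_right.2 hsupport, pos_iff_ne_zero]

/-- The projection of `ℝ^(d+1)` along the coordinate axis `i + 1`, with the first coordinate moved
to place `i`. -/
def replaceCoord (i : Fin d) : Space (d + 1) →L[ℝ] Space d :=
  tail + (head - EuclideanSpace.proj i.succ).smulRight (EuclideanSpace.single i (1 : ℝ))

theorem replaceCoord_apply_self (i : Fin d) (v : Space (d + 1)) :
    replaceCoord i v i = head v := by
  simp [replaceCoord, tail_apply]

theorem replaceCoord_apply_of_ne {i j : Fin d} (h : j ≠ i) (v : Space (d + 1)) :
    replaceCoord i v j = v j.succ := by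
  simp [replaceCoord, tail_apply, h]

theorem eq_single_of_replaceCoord_eq_zero {i : Fin d} {v : Space (d + 1)}
    (h : replaceCoord i v = 0) : v = EuclideanSpace.single i.succ (v i.succ) := by
  have hzero (j : Fin d) : replaceCoord i v j = 0 := by rw [h]; rfl
  ext k
  induction k using Fin.cases with
  | zero =>
    have hhead : v 0 = 0 := (replaceCoord_apply_self i v).symm.trans (hzero i)
    simpa [(Fin.succ_ne_zero i).symm] using hhead
  | succ j =>
    obtain rfl | hj := eq_or_ne j i
    · simp
    · simpa [hj] using (replaceCoord_apply_of_ne hj v).symm.trans (hzero j)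

theorem tangentJacobian_replaceCoord_ne_zero {ν : Space (d + 1)} {i : Fin d} (hν : ν i.succ ≠ 0) :
    tangentJacobian ν (replaceCoord i) ≠ 0 := by
  refine tangentJacobian_ne_zero fun v hinner hv => ?_
  have hv' := eq_single_of_replaceCoord_eq_zero hv
  rw [hv', EuclideanSpace.inner_single_right] at hinner
  rw [hv', (mul_eq_zero.1 hinner).resolve_right (by simpa using hν)]
  simp

theorem volume_coord_eq (i : Fin d) (c : ℝ) : volume {z : Space d | z i = c} = 0 := by
  have hm : MeasurableSet {z : Fin d → ℝ | z i = c} :=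
    measurableSet_eq_fun (measurable_pi_apply i) measurable_const
  refine ((PiLp.volume_preserving_ofLp (Fin d)).measure_preimage hm.nullMeasurableSet).trans ?_
  rw [volume_pi]
  exact Measure.pi_hyperplane (fun _ => (volume : Measure ℝ)) i c

theorem IsNormalPair.ae_tail_eq_zero {B : Set (Space (d + 1))}
    {ν : Space (d + 1) → Space (d + 1)} (hB : IsNormalPair B ν) (c : ℝ) :
    ∀ᵐ y ∂(surfaceMeasure (d + 1)).restrict B, head y = c → tail (ν y) = 0 := by
  have hν := hB.measurable
  have hslice (i : Fin d) :
      surfaceMeasure (d + 1) (B ∩ {y | head y = c ∧ ν y i.succ ≠ 0}) = 0 := by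
    have hm : MeasurableSet {y : Space (d + 1) | head y = c ∧ ν y i.succ ≠ 0} :=
      (measurableSet_eq_fun (by fun_prop) (by fun_prop)).inter
        (measurableSet_eq_fun (by fun_prop) (by fun_prop)).compl
    refine HasRegularJacobianOn.surfaceMeasure_eq_zero (f := replaceCoord i)
      (J := fun y => ENNReal.ofReal (tangentJacobian (ν y) (replaceCoord i)))
      ⟨(replaceCoord i).continuous.measurable, ?_, fun y hy => ?_, fun y _ =>
        ⟨_, (replaceCoord i).hasStrictFDerivAt, rfl⟩⟩
      (hB.mono (hB.measurableSet.inter hm) inter_subset_left)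
      (fun y hy => (replaceCoord_apply_self i y).trans hy.2.1) (volume_coord_eq i c)
    · exact ((continuous_tangentJacobian _).measurable.comp hν).ennreal_ofReal
    · rw [Ne, ENNReal.ofReal_eq_zero, not_le]
      exact (abs_nonneg _).lt_of_ne' (tangentJacobian_replaceCoord_ne_zero hy.2.2)
  rw [ae_restrict_iff' hB.measurableSet]
  refine measure_mono_null (fun y hy => ?_) (measure_iUnion_null hslice)
  obtain ⟨hyB, hyc, hytail⟩ : y ∈ B ∧ head y = c ∧ tail (ν y) ≠ 0 := by
    simpa only [mem_compl_iff, mem_ofPred_eq, Classical.not_imp] using hy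
  obtain ⟨i, hi⟩ : ∃ i : Fin d, ν y i.succ ≠ 0 := by
    by_contra! h
    exact hytail (by ext i; exact h i)
  exact mem_iUnion.2 ⟨i, hyB, hyc, hi⟩

/-- The integrand of the energy of a set with normal field `ν`. -/
def energyKernel (ν : Space (d + 1) → Space (d + 1)) (o y : Space (d + 1)) : ℝ≥0∞ :=
  ENNReal.ofReal (|inner ℝ (ν y) (o - y) * inner ℝ (o - y) (ν o)| / ‖y - o‖ ^ (d + 2))

/-- The tangential Jacobian at `y` of the central projection from `o`, along a hypersurface with
normal field `ν`. -/
def centralJacobian (ν : Space (d + 1) → Space (d + 1)) (o y : Space (d + 1)) : ℝ≥0∞ :=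
  ‖(head (y - o))⁻¹‖ₑ ^ d * ‖(inner ℝ (ν y) (dir (centralProj o y)) : ℝ)‖ₑ

/-- The points at which a hypersurface with normal field `ν` is crossed transversally by their
connecting line with `o`, provided that this line is not horizontal. -/
def transversalSet (ν : Space (d + 1) → Space (d + 1)) (o : Space (d + 1)) : Set (Space (d + 1)) :=
  {y | head (y - o) ≠ 0 ∧ inner ℝ (ν y) (dir (centralProj o y)) ≠ 0}

theorem lineWeight_eq_ofReal (b : Space d) :
    lineWeight b = ENNReal.ofReal (‖dir b‖ ^ (d + 2))⁻¹ := by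
  have hdir : 0 < ‖dir b‖ := norm_pos_iff.2 (dir_ne_zero b)
  rw [lineWeight, ENNReal.ofReal_inv_of_pos (by positivity), ENNReal.ofReal_pow hdir.le,
    ofReal_norm]

theorem energyKernel_eq {ν : Space (d + 1) → Space (d + 1)} {o y : Space (d + 1)}
    (h : head (y - o) ≠ 0) :
    energyKernel ν o y = centralJacobian ν o y *
      (lineWeight (centralProj o y) * ‖(inner ℝ (ν o) (dir (centralProj o y)) : ℝ)‖ₑ) := by
  have hsub := sub_eq_smul_dir_centralProj h
  rw [energyKernel, centralJacobian, ← neg_sub y o, inner_neg_left, inner_neg_right, neg_mul_neg]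
  generalize centralProj o y = b at hsub ⊢
  generalize head (y - o) = s at h hsub ⊢
  have hdir : 0 < ‖dir b‖ := norm_pos_iff.2 (dir_ne_zero b)
  have hreal : |inner ℝ (ν y) (s • dir b) * inner ℝ (s • dir b) (ν o)| / ‖s • dir b‖ ^ (d + 2) =
      |s⁻¹| ^ d * |inner ℝ (ν y) (dir b)| *
        ((‖dir b‖ ^ (d + 2))⁻¹ * |inner ℝ (ν o) (dir b)|) := by
    rw [real_inner_smul_right, real_inner_smul_left, real_inner_comm (ν o), norm_smul,
      Real.norm_eq_abs, abs_mul, abs_mul, abs_mul, abs_inv, mul_pow, inv_pow]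
    field_simp
    ring
  rw [hsub, hreal, lineWeight_eq_ofReal, ENNReal.ofReal_mul (by positivity),
    ENNReal.ofReal_mul (by positivity), ENNReal.ofReal_mul (by positivity),
    ENNReal.ofReal_pow (abs_nonneg _)]
  simp only [Real.enorm_eq_ofReal_abs]

theorem lineCount_proj_eq_fiberCount_centralProj_add_one {B : Set (Space (d + 1))}
    {ν : Space (d + 1) → Space (d + 1)} {o : Space (d + 1)} (ho : o ∈ B) {b : Space d}
    (hb : inner ℝ (ν o) (dir b) ≠ 0) :
    lineCount B ν b (proj b o) = fiberCount (centralProj o) (B ∩ transversalSet ν o) b + 1 := by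
  have hsplit : B ∩ {y | inner ℝ (ν y) (dir b) ≠ 0} ∩ proj b ⁻¹' {proj b o} =
      (B ∩ transversalSet ν o ∩ centralProj o ⁻¹' {b}) ∪ {o} := by
    ext y
    constructor
    · rintro ⟨⟨hy, hyν⟩, hyo⟩
      by_cases hs : head (y - o) = 0
      · right
        have hsub := sub_eq_smul_dir (mem_singleton_iff.1 hyo).symm
        rwa [hs, zero_smul, sub_eq_zero] at hsub
      · left
        obtain rfl := (centralProj_eq_iff hs b).2 hyo
        exact ⟨⟨hy, hs, hyν⟩, rfl⟩
    · rintro (⟨⟨hy, hs, hyν⟩, rfl⟩ | rfl)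
      · exact ⟨⟨hy, hyν⟩, (centralProj_eq_iff hs _).1 rfl⟩
      · exact ⟨⟨ho, hb⟩, rfl⟩
  rw [lineCount, fiberCount, hsplit, measure_union _ (measurableSet_singleton o),
    Measure.count_singleton, fiberCount]
  rw [Set.disjoint_singleton_right]
  rintro ⟨⟨-, hs, -⟩, -⟩
  simp at hs

theorem measurableSet_transversalSet {ν : Space (d + 1) → Space (d + 1)} (hν : Measurable ν)
    (o : Space (d + 1)) : MeasurableSet (transversalSet ν o) := by
  have hhead : Measurable fun y : Space (d + 1) => head (y - o) := by fun_prop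
  have hinner : Measurable fun y => (inner ℝ (ν y) (dir (centralProj o y)) : ℝ) := by fun_prop
  exact (hhead (measurableSet_singleton 0).compl).inter (hinner (measurableSet_singleton 0).compl)

theorem hasRegularJacobianOn_centralProj {ν : Space (d + 1) → Space (d + 1)} (hν : Measurable ν)
    (o : Space (d + 1)) :
    HasRegularJacobianOn (centralProj o) (centralJacobian ν o) (transversalSet ν o) ν := by
  refine ⟨by fun_prop, by unfold centralJacobian; fun_prop, fun y hy => ?_, fun y hy =>
    ⟨_, hasStrictFDerivAt_centralProj hy.1, ?_⟩⟩
  · exact mul_ne_zero (pow_ne_zero _ (enorm_ne_zero.2 (inv_ne_zero hy.1))) (enorm_ne_zero.2 hy.2)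
  · rw [tangentJacobian_smul, tangentJacobian_proj, ENNReal.ofReal_mul (by positivity),
      ENNReal.ofReal_pow (abs_nonneg _), ← Real.enorm_eq_ofReal_abs, ← Real.enorm_eq_ofReal_abs,
      centralJacobian]

theorem IsNormalPair.energyKernel_ae_eq {B : Set (Space (d + 1))}
    {ν : Space (d + 1) → Space (d + 1)} (hB : IsNormalPair B ν) (o : Space (d + 1)) :
    energyKernel ν o =ᵐ[(surfaceMeasure (d + 1)).restrict B] (transversalSet ν o).indicator
      fun y => centralJacobian ν o y *
        (lineWeight (centralProj o y) * ‖(inner ℝ (ν o) (dir (centralProj o y)) : ℝ)‖ₑ) := by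
  filter_upwards [hB.ae_tail_eq_zero (head o)] with y hy
  by_cases hs : head (y - o) = 0
  · have htail : tail (ν y) = 0 := hy (by rwa [map_sub, sub_eq_zero] at hs)
    have hhead : head (o - y) = 0 := by rw [← neg_sub, map_neg, hs, neg_zero]
    rw [indicator_of_notMem fun h : y ∈ transversalSet ν o => h.1 hs, energyKernel,
      inner_eq_head_tail (ν y), htail, hhead]
    simp
  · rw [energyKernel_eq hs]
    by_cases hinner : inner ℝ (ν y) (dir (centralProj o y)) = (0 : ℝ)
    · rw [indicator_of_notMem fun h : y ∈ transversalSet ν o => h.2 hinner, centralJacobian, hinner]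
      simp
    · rw [indicator_of_mem (show y ∈ transversalSet ν o from ⟨hs, hinner⟩)]

theorem IsNormalPair.lintegral_energyKernel {B : Set (Space (d + 1))}
    {ν : Space (d + 1) → Space (d + 1)} (hB : IsNormalPair B ν) {o : Space (d + 1)} (ho : o ∈ B) :
    ∫⁻ y in B, energyKernel ν o y ∂surfaceMeasure (d + 1) =
      ∫⁻ b, lineWeight b *
        (‖(inner ℝ (ν o) (dir b) : ℝ)‖ₑ * (lineCount B ν b (proj b o) - 1)) := by
  have hE := measurableSet_transversalSet hB.measurable o
  have hBE := hB.mono (hB.measurableSet.inter hE) inter_subset_left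
  rw [lintegral_congr_ae (hB.energyKernel_ae_eq o), setLIntegral_indicator hE, inter_comm,
    hBE.lintegral_mul_comp ((hasRegularJacobianOn_centralProj hB.measurable o).mono
      inter_subset_right) (g := fun b => lineWeight b * ‖(inner ℝ (ν o) (dir b) : ℝ)‖ₑ)
      (by fun_prop)]
  refine lintegral_congr fun b => ?_
  by_cases hb : inner ℝ (ν o) (dir b) = (0 : ℝ)
  · simp [hb]
  · rw [lineCount_proj_eq_fiberCount_centralProj_add_one ho hb,
      ENNReal.add_sub_cancel_right ENNReal.one_ne_top]
    ring

theorem IsNormalPair.quadratic_crofton {B : Set (Space (d + 1))}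
    {ν : Space (d + 1) → Space (d + 1)} (hB : IsNormalPair B ν)
    (hfin : surfaceMeasure (d + 1) B ≠ ∞) :
    ∫⁻ o in B, ∫⁻ y in B, energyKernel ν o y ∂surfaceMeasure (d + 1) ∂surfaceMeasure (d + 1) =
      lineIntegral fun b a => lineCount B ν b a * (lineCount B ν b a - 1) := by
  have hν := hB.measurable
  have hN := hB.measurable_lineCount
  have : IsFiniteMeasure ((surfaceMeasure (d + 1)).restrict B) :=
    isFiniteMeasure_restrict.2 hfin
  rw [setLIntegral_congr_fun hB.measurableSet fun o ho => hB.lintegral_energyKernel ho,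
    lintegral_lintegral_swap, lineIntegral]
  · refine lintegral_congr fun b => ?_
    have hNb : Measurable fun a => lineCount B ν b a - 1 := by fun_prop
    rw [← hB.lintegral_proj b hNb, lintegral_const_mul]
    exact Measurable.mul (by fun_prop) (hNb.comp (proj b).continuous.measurable)
  · have hNp : Measurable fun p : Space (d + 1) × Space d => lineCount B ν p.2 (proj p.2 p.1) := by
      fun_prop
    exact (Measurable.mul (by fun_prop)
      (Measurable.mul (by fun_prop) (hNp.sub measurable_const))).aemeasurable

end CentralProjection

/-! ### Integrals over lines -/

section LineIntegral

variable {d : ℕ}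

theorem lineIntegral_mono {F G : Space d → Space d → ℝ≥0∞}
    (h : ∀ᵐ b, ∀ᵐ a, F b a ≤ G b a) : lineIntegral F ≤ lineIntegral G := by
  refine lintegral_mono_ae ?_
  filter_upwards [h] with b hb
  exact mul_le_mul_right (lintegral_mono_ae hb) _

theorem lineIntegral_congr {F G : Space d → Space d → ℝ≥0∞}
    (h : ∀ᵐ b, ∀ᵐ a, F b a = G b a) : lineIntegral F = lineIntegral G := by
  refine lintegral_congr_ae ?_
  filter_upwards [h] with b hb
  rw [lintegral_congr_ae hb]

theorem lineIntegral_add {F G : Space d → Space d → ℝ≥0∞}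
    (hF : Measurable fun p : Space d × Space d => F p.1 p.2) :
    lineIntegral (fun b a => F b a + G b a) = lineIntegral F + lineIntegral G := by
  have hmeas : Measurable fun b => lineWeight b * ∫⁻ a, F b a :=
    measurable_lineWeight.mul hF.lintegral_prod_right'
  rw [lineIntegral, lineIntegral, lineIntegral, ← lintegral_add_left hmeas]
  congr 1 with b
  rw [← mul_add, lintegral_add_left (by fun_prop)]

theorem lineIntegral_const_mul {F : Space d → Space d → ℝ≥0∞}
    (hF : Measurable fun p : Space d × Space d => F p.1 p.2) (c : ℝ≥0∞) :
    lineIntegral (fun b a => c * F b a) = c * lineIntegral F := by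
  have hmeas : Measurable fun b => lineWeight b * ∫⁻ a, F b a :=
    measurable_lineWeight.mul hF.lintegral_prod_right'
  rw [lineIntegral, lineIntegral, ← lintegral_const_mul _ hmeas]
  congr 1 with b
  rw [lintegral_const_mul _ (by fun_prop), mul_left_comm]

theorem IsPiecewiseC1.isUnitNormalField_unitNormal {n : ℕ} {A : Set (Space n)}
    (hA : IsPiecewiseC1 A) : IsUnitNormalField A (unitNormal A) := by
  rw [unitNormal, dif_pos hA]
  exact hA.choose_spec

theorem IsPiecewiseC1.exists_lineIntegral {A : Set (Space (d + 1))} (hA : IsPiecewiseC1 A)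
    (hfin : surfaceMeasure (d + 1) A ≠ ∞) :
    ∃ (B : Set (Space (d + 1))) (ν : Space (d + 1) → Space (d + 1)), B ⊆ A ∧ IsNormalPair B ν ∧
      lineIntegral (lineCount B ν) = croftonConst d * surfaceMeasure (d + 1) A ∧
      energy A = lineIntegral fun b a => lineCount B ν b a * (lineCount B ν b a - 1) := by
  obtain ⟨B, ν, hBA, hnull, hB, hν⟩ := hA.isUnitNormalField_unitNormal.exists_isNormalPair
  have hae : B =ᵐ[surfaceMeasure (d + 1)] A :=
    hBA.eventuallyLE.antisymm (ae_le_set.2 hnull)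
  have hmeas := measure_congr hae
  have hfinB : surfaceMeasure (d + 1) B ≠ ∞ := hmeas ▸ hfin
  refine ⟨B, ν, hBA, hB, by rw [hB.crofton hfinB, hmeas], ?_⟩
  rw [← hB.quadratic_crofton hfinB, energy, ← Measure.restrict_congr_set hae]
  refine setLIntegral_congr_fun hB.measurableSet fun o ho =>
    setLIntegral_congr_fun hB.measurableSet fun y hy => ?_
  have habs : |inner ℝ (unitNormal A y) (o - y) * inner ℝ (o - y) (unitNormal A o)| =
      |inner ℝ (ν y) (o - y) * inner ℝ (o - y) (ν o)| := by
    rw [abs_mul, abs_mul, hν y hy, real_inner_comm (unitNormal A o), hν o ho,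
      real_inner_comm (ν o)]
  simp only [habs, energyKernel]

end LineIntegral

section Transversality

variable {d : ℕ}

theorem exists_inner_dir_ne_zero {v : Space (d + 1)} (hv : v ≠ 0) :
    ∃ b : Space d, inner ℝ v (dir b) ≠ 0 := by
  simp only [inner_eq_head_tail, head_dir, tail_dir, mul_one]
  by_cases hhead : head v = 0
  · refine ⟨tail v, ?_⟩
    rw [hhead, zero_add]
    exact inner_self_ne_zero.2 fun htail =>
      hv (ext_head_tail (by simpa using hhead) (by simpa using htail))
  · exact ⟨0, by simpa using hhead⟩

theorem ae_inner_dir_ne_zero {v : Space (d + 1)} (hv : v ≠ 0) :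
    ∀ᵐ b : Space d, inner ℝ v (dir b) ≠ 0 := by
  obtain ⟨b₀, hb₀⟩ := exists_inner_dir_ne_zero hv
  let f : Space d →ᵃ[ℝ] ℝ := (innerSL ℝ (tail v)).toLinearMap.toAffineMap +
    AffineMap.const ℝ (Space d) (head v)
  have hf (b : Space d) : f b = inner ℝ v (dir b) := by
    rw [inner_eq_head_tail, head_dir, tail_dir, mul_one, add_comm]
    rfl
  let s : AffineSubspace ℝ (Space d) := (AffineSubspace.mk' (0 : ℝ) ⊥).comap f
  have hs (b : Space d) : b ∈ s ↔ inner ℝ v (dir b) = 0 := by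
    simp [s, AffineSubspace.mem_mk', hf]
  have hnull : volume (s : Set (Space d)) = 0 := Measure.addHaar_affineSubspace _ _
    fun htop => hb₀ ((hs b₀).1 (htop ▸ AffineSubspace.mem_top ℝ _ _))
  exact measure_mono_null (fun b hb => (hs b).2 (not_not.1 hb)) hnull

theorem IsC1Hypersurface.measure_lt_top {S C : Set (Space (d + 1))} (hS : IsC1Hypersurface S)
    (hC : IsCompact C) (hCS : C ⊆ S) : surfaceMeasure (d + 1) C < ∞ := by
  refine hC.measure_lt_top_of_nhdsWithin fun y hy => ?_
  obtain ⟨v, hv⟩ := hS y (hCS hy)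
  have hv0 : v ≠ 0 := norm_ne_zero_iff.1 (hv.norm_eq_one.trans_ne one_ne_zero)
  obtain ⟨b, hb⟩ := exists_inner_dir_ne_zero hv0
  have hJ : 0 < tangentJacobian v (proj b) := by
    rw [tangentJacobian_proj]
    exact abs_pos.2 hb
  obtain ⟨U, hU, -, hmeas⟩ := hv.isStrictNormalAt.exists_nhds_measure_image hv.norm_eq_one
    (proj b).hasStrictFDerivAt hJ.ne' one_lt_two
  refine ⟨C ∩ (U ∩ Metric.ball y 1),
    inter_mem_nhdsWithin _ (inter_mem hU (Metric.ball_mem_nhds y one_pos)), ?_⟩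
  have hvol : volume (proj b '' (C ∩ (U ∩ Metric.ball y 1))) < ∞ :=
    ((proj b).lipschitz.isBounded_image
      (Metric.isBounded_ball.subset fun x hx => hx.2.2)).measure_lt_top
  have hle := (hmeas (C ∩ (U ∩ Metric.ball y 1)) fun x hx => ⟨hCS hx.1, hx.2.1⟩).1
  exact ENNReal.lt_top_of_mul_ne_top_right
    (hle.trans_lt (ENNReal.mul_lt_top ENNReal.coe_lt_top hvol)).ne (ENNReal.ofReal_pos.2 hJ).ne'

end Transversality

/-! ### Lines meeting a convex body -/

section Hypersurfaces

variable {n d : ℕ}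

theorem mem_frontier_iff_eq_zero {Ω U : Set (Space n)} {φ : Space n → ℝ} (hΩ : IsOpen Ω)
    (hU : IsOpen U) (hφ : ContDiffOn ℝ 1 φ U) (hΩU : Ω ∩ U = {y ∈ U | φ y < 0}) {y : Space n}
    (hy : y ∈ U) (hgrad : gradient φ y ≠ 0) : y ∈ frontier Ω ↔ φ y = 0 := by
  have hmem : ∀ z ∈ U, (z ∈ Ω ↔ φ z < 0) := fun z hz => by
    simpa [hz] using Set.ext_iff.1 hΩU z
  rw [hΩ.frontier_eq]
  constructor
  · rintro ⟨hcl, hyΩ⟩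
    refine le_antisymm (not_lt.1 fun hpos => ?_) (not_lt.1 fun hneg => hyΩ ((hmem y hy).2 hneg))
    have hnear : ∀ᶠ z in 𝓝 y, 0 < φ z ∧ z ∈ U :=
      ((hφ.continuousOn.continuousAt (hU.mem_nhds hy)).eventually (lt_mem_nhds hpos)).and
        (hU.mem_nhds hy)
    obtain ⟨z, ⟨hzpos, hzU⟩, hzΩ⟩ := mem_closure_iff_nhds.1 hcl _ hnear
    exact lt_asymm hzpos ((hmem z hzU).1 hzΩ)
  · refine fun hzero => ⟨by_contra fun hcl => hgrad ?_, fun hyΩ => hzero.not_lt ((hmem y hy).1 hyΩ)⟩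
    have hmin : IsLocalMin φ y := by
      filter_upwards [isClosed_closure.isOpen_compl.mem_nhds hcl, hU.mem_nhds hy] with z hz hzU
      rw [hzero]
      exact not_lt.1 fun hneg => hz (subset_closure ((hmem z hzU).2 hneg))
    rw [gradient, hmin.fderiv_eq_zero, map_zero]

theorem HasC1Boundary.isC1Hypersurface_frontier {Ω : Set (Space n)}
    (hΩ : HasC1Boundary Ω) (ho : IsOpen Ω) : IsC1Hypersurface (frontier Ω) := by
  intro x hx
  obtain ⟨U, φ, hU, hxU, hφ, hgrad, hΩU⟩ := hΩ x hx
  have hV : IsOpen (U ∩ gradient φ ⁻¹' {0}ᶜ) :=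
    (continuousOn_gradient hU hφ).isOpen_inter_preimage hU isOpen_compl_singleton
  refine ⟨‖gradient φ x‖⁻¹ • gradient φ x, hx, _, φ, hV, ⟨hxU, hgrad⟩, hφ.mono inter_subset_left,
    hgrad, ?_, norm_smul_inv_norm (𝕜 := ℝ) hgrad,
    Submodule.smul_mem _ _ (Submodule.mem_span_singleton_self _)⟩
  ext y
  rw [inter_comm]
  exact and_congr_right fun hy => mem_frontier_iff_eq_zero ho hU hφ hΩU hy.1 hy.2

theorem isUnitNormalAt_hyperplane {v : Space n} (hv : v ≠ 0) {b : ℝ} {x : Space n}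
    (hx : x ∈ hyperplane v b) : IsUnitNormalAt (hyperplane v b) x (‖v‖⁻¹ • v) := by
  have hgrad : gradient (fun y => (inner ℝ v y : ℝ) - b) x = v := by
    refine HasGradientAt.gradient ?_
    rw [hasGradientAt_iff_hasFDerivAt]
    exact ((innerSL ℝ v).hasFDerivAt (x := x)).sub_const b
  refine ⟨hx, univ, fun y => inner ℝ v y - b, isOpen_univ, mem_univ x,
    ((innerSL ℝ v).contDiff.sub contDiff_const).contDiffOn, hgrad.trans_ne hv, ?_,
    norm_smul_inv_norm (𝕜 := ℝ) hv, ?_⟩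
  · ext y
    simp [hyperplane, sub_eq_zero]
  · rw [hgrad]
    exact Submodule.smul_mem _ _ (Submodule.mem_span_singleton_self _)

theorem isC1Hypersurface_hyperplane {v : Space n} (hv : v ≠ 0) (b : ℝ) :
    IsC1Hypersurface (hyperplane v b) :=
  fun _ hx => ⟨_, isUnitNormalAt_hyperplane hv hx⟩

theorem isClosed_hyperplane (v : Space n) (b : ℝ) : IsClosed (hyperplane v b) :=
  isClosed_eq (continuous_const.inner continuous_id) continuous_const

theorem IsFlatPiece.subset {Ω K : Set (Space n)} (hK : IsFlatPiece Ω K) : K ⊆ Ω := by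
  obtain ⟨-, _, _, -, hKv⟩ := hK
  exact hKv.trans inter_subset_left

theorem IsFlatPiece.exists_isNormalPair_const {Ω K : Set (Space n)} (hK : IsFlatPiece Ω K) :
    ∃ v : Space n, v ≠ 0 ∧ IsNormalPair K fun _ => v := by
  obtain ⟨hm, v, b, hv, hKv⟩ := hK
  have hnorm : ‖‖v‖⁻¹ • v‖ = 1 := norm_smul_inv_norm (𝕜 := ℝ) hv
  exact ⟨‖v‖⁻¹ • v, norm_ne_zero_iff.1 (hnorm.trans_ne one_ne_zero),
    .of_isStrictNormalAt hm measurable_const (fun _ _ => hnorm) fun y hy =>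
      (isUnitNormalAt_hyperplane hv (hKv hy).2).isStrictNormalAt.mono fun z hz => (hKv hz).2⟩

theorem IsFlatPiece.measure_lt_top {Ω K : Set (Space (d + 1))} (hK : IsFlatPiece Ω K)
    (hΩ : Bornology.IsBounded Ω) : surfaceMeasure (d + 1) K < ∞ := by
  obtain ⟨-, v, b, hv, hKv⟩ := hK
  exact (measure_mono (hKv.trans (inter_subset_inter_left _ subset_closure))).trans_lt
    ((isC1Hypersurface_hyperplane hv b).measure_lt_top
      (hΩ.isCompact_closure.inter_right (isClosed_hyperplane v b)) inter_subset_right)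

theorem IsFlatPiece.ae_fiberCount_le_one {Ω K : Set (Space (d + 1))} (hK : IsFlatPiece Ω K) :
    ∀ᵐ b, ∀ a, fiberCount (proj b) K a ≤ 1 := by
  obtain ⟨-, v, c, hv, hKv⟩ := hK
  filter_upwards [ae_inner_dir_ne_zero hv] with b hb a
  have hinj : InjOn (proj b) K := by
    intro y hy y' hy' hproj
    have hsub := sub_eq_smul_dir hproj.symm
    have hinner : (inner ℝ v (y - y') : ℝ) = 0 := by
      rw [inner_sub_right, (hKv hy).2, (hKv hy').2, sub_self]
    rw [hsub, real_inner_smul_right, mul_eq_zero] at hinner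
    rwa [hinner.resolve_right hb, zero_smul, sub_eq_zero] at hsub
  rw [fiberCount_of_injOn hinj]
  exact indicator_le_self' (fun _ _ => zero_le_one) a

theorem ae_lineCount_const_eq (K : Set (Space (d + 1))) {v : Space (d + 1)} (hv : v ≠ 0) :
    ∀ᵐ b, ∀ a, lineCount K (fun _ => v) b a = fiberCount (proj b) K a := by
  filter_upwards [ae_inner_dir_ne_zero hv] with b hb a
  simp [lineCount, hb]

end Hypersurfaces

section Convex

variable {d : ℕ} {D : Set (Space (d + 1))}

theorem exists_forall_pos_mem_frontier_iff {E : Type*} [NormedAddCommGroup E] [NormedSpace ℝ E]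
    {D : Set E} (ho : IsOpen D) (hc : Convex ℝ D) (hb : Bornology.IsBounded D) {o u : E}
    (hoD : o ∈ D) (hu : u ≠ 0) :
    ∃ β : ℝ, 0 < β ∧ ∀ s : ℝ, 0 < s → (o + s • u ∈ frontier D ↔ s = β) := by
  let D₀ := Homeomorph.addLeft o ⁻¹' D
  have hD₀ : D₀ ∈ 𝓝 0 :=
    (ho.preimage (Homeomorph.addLeft o).continuous).mem_nhds (by simpa [D₀] using hoD)
  have hconvex : Convex ℝ D₀ := hc.translate_preimage_right o
  have hbounded : Bornology.IsVonNBounded ℝ D₀ :=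
    (NormedSpace.isVonNBounded_iff ℝ).2
      ((IsometryEquiv.addLeft o).isometry.antilipschitz.isBounded_preimage hb)
  have hgauge : 0 < gauge D₀ u := (gauge_pos (absorbent_nhds_zero hD₀) hbounded).2 hu
  refine ⟨(gauge D₀ u)⁻¹, inv_pos.2 hgauge, fun s hs => ?_⟩
  rw [← mul_eq_one_iff_eq_inv₀ hgauge.ne', ← smul_eq_mul, ← gauge_smul_of_nonneg hs.le,
    gauge_eq_one_iff_mem_frontier hconvex hD₀, ← Homeomorph.preimage_frontier]
  rfl

theorem fiberCount_frontier_eq_two (ho : IsOpen D) (hc : Convex ℝ D) (hb : Bornology.IsBounded D)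
    {b a : Space d} (ha : a ∈ proj b '' D) : fiberCount (proj b) (frontier D) a = 2 := by
  obtain ⟨o, hoD, rfl⟩ := ha
  obtain ⟨β, hβ, hfwd⟩ := exists_forall_pos_mem_frontier_iff ho hc hb hoD (dir_ne_zero b)
  obtain ⟨γ, hγ, hbwd⟩ :=
    exists_forall_pos_mem_frontier_iff ho hc hb hoD (neg_ne_zero.2 (dir_ne_zero b))
  have hfiber : frontier D ∩ proj b ⁻¹' {proj b o} = {o + β • dir b, o + γ • -dir b} := by
    ext y
    constructor
    · rintro ⟨hy, hyo⟩
      obtain ⟨s, rfl⟩ : ∃ s : ℝ, y = o + s • dir b :=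
        ⟨_, sub_eq_iff_eq_add'.1 (sub_eq_smul_dir (mem_singleton_iff.1 hyo).symm)⟩
      rcases lt_trichotomy s 0 with hs | rfl | hs
      · right
        rw [mem_singleton_iff, ← (hbwd (-s) (neg_pos.2 hs)).1 (by simpa using hy), neg_smul_neg]
      · rw [zero_smul, add_zero, ho.frontier_eq] at hy
        exact absurd hoD hy.2
      · left
        rw [← (hfwd s hs).1 hy]
    · rintro (rfl | rfl)
      · exact ⟨(hfwd β hβ).2 rfl, by simp⟩
      · exact ⟨(hbwd γ hγ).2 rfl, by simp⟩
  have hne : o + β • dir b ≠ o + γ • -dir b := fun heq => by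
    have hhead := congrArg head heq
    simp only [map_add, map_smul, map_neg, head_dir, smul_eq_mul] at hhead
    linarith
  rw [fiberCount, hfiber, Measure.count_apply (toFinite _).measurableSet, encard_pair hne]
  rfl

theorem IsUnitNormalAt.inner_ne_zero {n : ℕ} {D : Set (Space n)} (ho : IsOpen D) (hc : Convex ℝ D)
    {o y v : Space n} (hoD : o ∈ D) (hv : IsUnitNormalAt (frontier D) y v) :
    inner ℝ v (y - o) ≠ 0 := by
  have hy : y ∈ closure D \ D := ho.frontier_eq ▸ hv.1
  obtain ⟨f, hf⟩ := geometric_hahn_banach_open_point hc ho hy.2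
  have hext : IsLocalExtrOn f (frontier D) y := by
    right
    filter_upwards [self_mem_nhdsWithin] with z hz
    exact closure_minimal (fun x hx => (hf x hx).le)
      (isClosed_le f.continuous continuous_const) (frontier_subset_closure hz)
  obtain ⟨w, rfl⟩ := (InnerProductSpace.toDual ℝ (Space n)).surjective f
  obtain ⟨c, rfl⟩ := hv.exists_eq_smul_of_isLocalExtrOn
    (InnerProductSpace.toDual ℝ (Space n) w).hasStrictFDerivAt hext
  intro hinner
  refine (hf o hoD).ne' (sub_eq_zero.1 ?_)
  rw [← map_sub, InnerProductSpace.toDual_apply_apply, real_inner_smul_left, hinner, mul_zero]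

theorem lineCount_eq_zero {B T : Set (Space (d + 1))} (hBT : B ⊆ T)
    {ν : Space (d + 1) → Space (d + 1)} {b a : Space d} (ha : a ∉ proj b '' T) :
    lineCount B ν b a = 0 :=
  fiberCount_eq_zero fun h => ha (image_mono (inter_subset_left.trans hBT) h)

/-- The indicator function of the lines that meet `D`, in the coordinates of `lineIntegral`. -/
def lineIndicator (D : Set (Space (d + 1))) (b a : Space d) : ℝ≥0∞ := (proj b '' D).indicator 1 a

theorem isOpen_setOf_mem_image_proj (ho : IsOpen D) :
    IsOpen {p : Space d × Space d | p.2 ∈ proj p.1 '' D} := by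
  have hunion : {p : Space d × Space d | p.2 ∈ proj p.1 '' D} =
      ⋃ s : ℝ, (fun p : Space d × Space d => consL d (s, p.2 + s • p.1)) ⁻¹' D := by
    ext ⟨b, a⟩
    simp only [mem_ofPred_eq, mem_image, mem_iUnion, mem_preimage]
    constructor
    · rintro ⟨y, hy, rfl⟩
      exact ⟨head y, by rwa [proj_apply, sub_add_cancel, consL_head_tail]⟩
    · rintro ⟨s, hs⟩
      exact ⟨_, hs, by simp [proj_apply]⟩
  rw [hunion]
  exact isOpen_iUnion fun s => ho.preimage (by fun_prop)

theorem measurable_lineIndicator (ho : IsOpen D) :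
    Measurable fun p : Space d × Space d => lineIndicator D p.1 p.2 :=
  measurable_one.indicator (isOpen_setOf_mem_image_proj ho).measurableSet

theorem ae_mem_image_or_notMem_image_closure (ho : IsOpen D) (hc : Convex ℝ D) (b : Space d) :
    ∀ᵐ a, a ∈ proj b '' D ∨ a ∉ proj b '' closure D := by
  have hopen : IsOpen (proj b '' D) :=
    (isOpen_setOf_mem_image_proj ho).preimage (f := fun a => (b, a)) (by fun_prop)
  have hconvex : Convex ℝ (proj b '' D) := hc.linear_image (proj b).toLinearMap
  refine measure_mono_null (fun a ha => ?_) (hconvex.addHaar_frontier volume)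
  obtain ⟨hD, hcl⟩ := not_or.1 ha
  rw [hopen.frontier_eq]
  exact ⟨image_closure_subset_closure_image (proj b).continuous (not_not.1 hcl), hD⟩

theorem fiberCount_frontier_ae_le_two (ho : IsOpen D) (hc : Convex ℝ D)
    (hb : Bornology.IsBounded D) (b : Space d) :
    ∀ᵐ a, fiberCount (proj b) (frontier D) a ≤ 2 := by
  filter_upwards [ae_mem_image_or_notMem_image_closure ho hc b] with a ha
  rcases ha with ha | ha
  · exact (fiberCount_frontier_eq_two ho hc hb ha).le
  · rw [fiberCount_eq_zero fun h => ha (image_mono frontier_subset_closure h)]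
    exact zero_le

theorem lineCount_frontier_eq_fiberCount (ho : IsOpen D) (hc : Convex ℝ D)
    {ν : Space (d + 1) → Space (d + 1)} (hν : ∀ y ∈ frontier D, IsUnitNormalAt (frontier D) y (ν y))
    {b a : Space d} (ha : a ∈ proj b '' D) :
    lineCount (frontier D) ν b a = fiberCount (proj b) (frontier D) a := by
  obtain ⟨o, hoD, rfl⟩ := ha
  rw [lineCount, fiberCount, fiberCount]
  congr 1
  refine (inter_subset_inter_left _ inter_subset_left).antisymm fun y ⟨hy, hyo⟩ =>
    ⟨⟨hy, fun hzero => (hν y hy).inner_ne_zero ho hc hoD ?_⟩, hyo⟩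
  rw [sub_eq_smul_dir (mem_singleton_iff.1 hyo).symm, real_inner_smul_right, hzero, mul_zero]

theorem lineCount_frontier_ae_eq (ho : IsOpen D) (hc : Convex ℝ D) (hb : Bornology.IsBounded D)
    {ν : Space (d + 1) → Space (d + 1)} (hν : ∀ y ∈ frontier D, IsUnitNormalAt (frontier D) y (ν y))
    (b : Space d) : ∀ᵐ a, lineCount (frontier D) ν b a = 2 * lineIndicator D b a := by
  filter_upwards [ae_mem_image_or_notMem_image_closure ho hc b] with a ha
  rcases ha with ha | ha
  · rw [lineCount_frontier_eq_fiberCount ho hc hν ha, fiberCount_frontier_eq_two ho hc hb ha,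
      lineIndicator, indicator_of_mem ha, Pi.one_apply, mul_one]
  · rw [lineIndicator, indicator_of_notMem fun h => ha (image_mono subset_closure h), mul_zero,
      lineCount_eq_zero frontier_subset_closure ha]

theorem croftonConst_mul_frontier (ho : IsOpen D) (hc : Convex ℝ D) (hb : Bornology.IsBounded D)
    (hD : HasC1Boundary D) :
    croftonConst d * surfaceMeasure (d + 1) (frontier D) = 2 * lineIntegral (lineIndicator D) := by
  have hS := hD.isC1Hypersurface_frontier ho
  have hcompact : IsCompact (frontier D) :=
    hb.isCompact_closure.of_isClosed_subset isClosed_frontier frontier_subset_closure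
  obtain ⟨ν, hν, hnormal⟩ := hS.exists_isNormalPair isClosed_frontier.measurableSet subset_rfl
  rw [← hν.crofton (hS.measure_lt_top hcompact subset_rfl).ne,
    ← lineIntegral_const_mul (measurable_lineIndicator ho)]
  exact lineIntegral_congr (.of_forall (lineCount_frontier_ae_eq ho hc hb hnormal))

end Convex

/-! ### Bounds for the energy -/

section EnergyBounds

theorem natCast_mul_pred (N : ℕ) : ((N * (N - 1) : ℕ) : ℤ) = N * (N - 1) := by
  cases N <;> simp

-- The product `(N - 2 * m) * (N - (2 * m + 1))` of consecutive integers is nonnegative.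
theorem four_mul_le_mul_pred_add (m N : ℕ) : 4 * m * N ≤ N * (N - 1) + 2 * m * (2 * m + 1) := by
  have hconsecutive : (0 : ℤ) ≤ (N - 2 * m) * (N - (2 * m + 1)) := by
    rcases le_or_gt (N : ℤ) (2 * m) with h | h
    · exact mul_nonneg_of_nonpos_of_nonpos (by linarith) (by linarith)
    · exact mul_nonneg (by linarith) (by linarith)
  zify
  rw [← Nat.cast_mul, natCast_mul_pred]
  linarith

theorem mul_pred_le_of_le_add {m N k j : ℕ} (hk : k ≤ 1) (hj : j ≤ 1) (h : N ≤ 2 * m + k + j) :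
    N * (N - 1) ≤ 2 * m * (2 * m - 1) + 4 * m * (k + j) + 2 * j := by
  refine (Nat.mul_le_mul h (Nat.sub_le_sub_right h 1)).trans ?_
  have hbound := natCast_mul_pred (2 * m + k + j)
  have hm := natCast_mul_pred (2 * m)
  zify
  push_cast at hbound hm
  rw [hbound, hm]
  interval_cases k <;> interval_cases j <;> push_cast <;> linarith

section FiberCount

variable {X Y : Type*} [MeasurableSpace X] {f : X → Y} {z : Y}

theorem fiberCount_le_of_subset_iUnion_union {m : ℕ} {S : Fin m → Set X} {C K J : Set X}
    (hS : ∀ i, fiberCount f (S i) z ≤ 2) (hC : C ⊆ (⋃ i, S i) ∪ K ∪ J) :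
    fiberCount f C z ≤ 2 * m + fiberCount f K z + fiberCount f J z := by
  have hiUnion : fiberCount f (⋃ i, S i) z ≤ 2 * m :=
    (fiberCount_iUnion_le f S z).trans
      ((Finset.sum_le_sum fun i _ => hS i).trans_eq (by simp [mul_comm]))
  calc fiberCount f C z ≤ fiberCount f ((⋃ i, S i) ∪ K ∪ J) z := fiberCount_mono hC z
    _ ≤ fiberCount f ((⋃ i, S i) ∪ K) z + fiberCount f J z := fiberCount_union_le ..
    _ ≤ fiberCount f (⋃ i, S i) z + fiberCount f K z + fiberCount f J z := by
      gcongr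
      exact fiberCount_union_le ..
    _ ≤ _ := by gcongr

variable [MeasurableSingletonClass X]

theorem four_mul_fiberCount_le (f : X → Y) (C : Set X) (z : Y) (m : ℕ) :
    ((4 * m : ℕ) : ℝ≥0∞) * fiberCount f C z ≤
      fiberCount f C z * (fiberCount f C z - 1) + ((2 * m * (2 * m + 1) : ℕ) : ℝ≥0∞) := by
  rcases fiberCount_eq_top_or_natCast f C z with hC | ⟨N, hC⟩
  · simp [hC]
  · rw [hC, ← Nat.cast_one, ← ENNReal.natCast_sub]
    exact_mod_cast four_mul_le_mul_pred_add m N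

theorem exists_fiberCount_eq_natCast {C : Set X} (h : fiberCount f C z ≠ ∞) :
    ∃ N : ℕ, fiberCount f C z = N :=
  (fiberCount_eq_top_or_natCast f C z).resolve_left h

theorem fiberCount_mul_sub_one_le {m : ℕ} {C K J : Set X} (hK : fiberCount f K z ≤ 1)
    (hJ : fiberCount f J z ≤ 1)
    (hC : fiberCount f C z ≤ 2 * m + fiberCount f K z + fiberCount f J z) :
    fiberCount f C z * (fiberCount f C z - 1) ≤ ((2 * m * (2 * m - 1) : ℕ) : ℝ≥0∞) +
      ((4 * m : ℕ) : ℝ≥0∞) * (fiberCount f K z + fiberCount f J z) + 2 * fiberCount f J z := by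
  obtain ⟨k, hk⟩ := exists_fiberCount_eq_natCast (ne_top_of_le_ne_top ENNReal.one_ne_top hK)
  obtain ⟨j, hj⟩ := exists_fiberCount_eq_natCast (ne_top_of_le_ne_top ENNReal.one_ne_top hJ)
  rw [hk] at hK hC ⊢
  rw [hj] at hJ hC ⊢
  have hbound : fiberCount f C z ≤ ((2 * m + k + j : ℕ) : ℝ≥0∞) := by exact_mod_cast hC
  obtain ⟨N, hN⟩ :=
    exists_fiberCount_eq_natCast (ne_top_of_le_ne_top (ENNReal.natCast_ne_top _) hbound)
  rw [hN] at hbound ⊢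
  rw [← Nat.cast_one, ← ENNReal.natCast_sub]
  exact_mod_cast mul_pred_le_of_le_add (by exact_mod_cast hK) (by exact_mod_cast hJ)
    (by exact_mod_cast hbound)

end FiberCount

variable {d : ℕ} {Ω A : Set (Space (d + 1))}

theorem four_mul_surfaceMeasure_le_energy (ho : IsOpen Ω) (hc : Convex ℝ Ω)
    (hAΩ : A ⊆ closure Ω) (hA : IsPiecewiseC1 A) (hfin : surfaceMeasure (d + 1) A ≠ ∞) (m : ℕ) :
    ((4 * m : ℕ) : ℝ≥0∞) * (croftonConst d * surfaceMeasure (d + 1) A) ≤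
      energy A + ((2 * m * (2 * m + 1) : ℕ) : ℝ≥0∞) * lineIntegral (lineIndicator Ω) := by
  obtain ⟨B, ν, hBA, hB, hArea, hEnergy⟩ := hA.exists_lineIntegral hfin
  have hN := hB.measurable_lineCount
  rw [← hArea, hEnergy, ← lineIntegral_const_mul hN,
    ← lineIntegral_const_mul (measurable_lineIndicator ho),
    ← lineIntegral_add (hN.mul (hN.sub measurable_const))]
  refine lineIntegral_mono (.of_forall fun b => ?_)
  filter_upwards [ae_mem_image_or_notMem_image_closure ho hc b] with a ha
  rcases ha with ha | ha
  · rw [lineIndicator, indicator_of_mem ha, Pi.one_apply, mul_one]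
    exact four_mul_fiberCount_le _ _ _ m
  · rw [lineCount_eq_zero (hBA.trans hAΩ) ha, mul_zero]
    exact zero_le

theorem energy_le_of_subset_iUnion_frontier_union (ho : IsOpen Ω) (hc : Convex ℝ Ω)
    (hAΩ : A ⊆ closure Ω) (hA : IsPiecewiseC1 A) (hfin : surfaceMeasure (d + 1) A ≠ ∞) {m : ℕ}
    {D : Fin m → Set (Space (d + 1))} (hDo : ∀ i, IsOpen (D i)) (hDc : ∀ i, Convex ℝ (D i))
    (hDb : ∀ i, Bornology.IsBounded (D i)) {K J : Set (Space (d + 1))} (hK : IsFlatPiece Ω K)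
    (hJ : IsFlatPiece Ω J) (hKfin : surfaceMeasure (d + 1) K ≠ ∞)
    (hJfin : surfaceMeasure (d + 1) J ≠ ∞) (hsub : A ⊆ (⋃ i, frontier (D i)) ∪ K ∪ J) :
    energy A ≤ ((2 * m * (2 * m - 1) : ℕ) : ℝ≥0∞) * lineIntegral (lineIndicator Ω) +
      ((4 * m : ℕ) : ℝ≥0∞) * (croftonConst d * surfaceMeasure (d + 1) K +
        croftonConst d * surfaceMeasure (d + 1) J) +
      2 * (croftonConst d * surfaceMeasure (d + 1) J) := by
  obtain ⟨B, ν, hBA, -, -, hEnergy⟩ := hA.exists_lineIntegral hfin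
  obtain ⟨v, hv, hKv⟩ := hK.exists_isNormalPair_const
  obtain ⟨w, hw, hJw⟩ := hJ.exists_isNormalPair_const
  have hKm := hKv.measurable_lineCount
  have hJm := hJw.measurable_lineCount
  have hKJm : Measurable fun p : Space d × Space d =>
      lineCount K (fun _ => v) p.1 p.2 + lineCount J (fun _ => w) p.1 p.2 := hKm.add hJm
  have hΩm := (measurable_lineIndicator ho).const_mul ((2 * m * (2 * m - 1) : ℕ) : ℝ≥0∞)
  rw [hEnergy, ← hKv.crofton hKfin, ← hJw.crofton hJfin, ← lineIntegral_add hKm,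
    ← lineIntegral_const_mul (F := fun b a =>
      lineCount K (fun _ => v) b a + lineCount J (fun _ => w) b a) hKJm,
    ← lineIntegral_const_mul hJm,
    ← lineIntegral_const_mul (measurable_lineIndicator ho), ← lineIntegral_add hΩm,
    ← lineIntegral_add (hΩm.add (hKJm.const_mul _))]
  refine lineIntegral_mono ?_
  filter_upwards [hK.ae_fiberCount_le_one, hJ.ae_fiberCount_le_one, ae_lineCount_const_eq K hv,
    ae_lineCount_const_eq J hw] with b hKone hJone hKcount hJcount
  filter_upwards [ae_mem_image_or_notMem_image_closure ho hc b,
    ae_all_iff.2 fun i => fiberCount_frontier_ae_le_two (hDo i) (hDc i) (hDb i) b] with a ha hD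
  rcases ha with ha | ha
  · rw [hKcount, hJcount, lineIndicator, indicator_of_mem ha, Pi.one_apply, mul_one]
    exact fiberCount_mul_sub_one_le (hKone a) (hJone a)
      (fiberCount_le_of_subset_iUnion_union hD (inter_subset_left.trans (hBA.trans hsub)))
  · rw [lineCount_eq_zero (hBA.trans hAΩ) ha, zero_mul]
    exact zero_le

end EnergyBounds

/-! ### Homothetic images of a convex body -/

section Homothety

section Normed

variable {E : Type*} [NormedAddCommGroup E] [NormedSpace ℝ E]

/-- The homothety with center `p` and nonzero factor `t`, as a homeomorphism. -/
def homothetyHomeo (p : E) {t : ℝ} (ht : t ≠ 0) : E ≃ₜ E where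
  toFun := AffineMap.homothety p t
  invFun := AffineMap.homothety p t⁻¹
  left_inv y := by
    rw [← AffineMap.homothety_mul_apply, inv_mul_cancel₀ ht, AffineMap.homothety_one,
      AffineMap.id_apply]
  right_inv y := by
    rw [← AffineMap.homothety_mul_apply, mul_inv_cancel₀ ht, AffineMap.homothety_one,
      AffineMap.id_apply]
  continuous_toFun := AffineMap.homothety_continuous p t
  continuous_invFun := AffineMap.homothety_continuous p t⁻¹

theorem homothety_inv_homothety (p : E) {t : ℝ} (ht : t ≠ 0) (y : E) :
    AffineMap.homothety p t⁻¹ (AffineMap.homothety p t y) = y :=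
  (homothetyHomeo p ht).symm_apply_apply y

theorem image_homothety_eq_preimage (p : E) {t : ℝ} (ht : t ≠ 0) (S : Set E) :
    AffineMap.homothety p t '' S = AffineMap.homothety p t⁻¹ ⁻¹' S :=
  (homothetyHomeo p ht).image_eq_preimage_symm S

theorem frontier_image_homothety (p : E) {t : ℝ} (ht : t ≠ 0) (S : Set E) :
    frontier (AffineMap.homothety p t '' S) = AffineMap.homothety p t '' frontier S :=
  ((homothetyHomeo p ht).image_frontier S).symm

theorem isOpen_image_homothety {S : Set E} (hS : IsOpen S) (p : E) {t : ℝ} (ht : t ≠ 0) :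
    IsOpen (AffineMap.homothety p t '' S) :=
  AffineMap.homothety_isOpenMap p t ht S hS

theorem image_homothety_subset_self {S : Set E} (hc : Convex ℝ S) {p : E} (hp : p ∈ S) {t : ℝ}
    (ht : t ∈ Icc (0 : ℝ) 1) : AffineMap.homothety p t '' S ⊆ S := by
  rintro _ ⟨y, hy, rfl⟩
  rw [AffineMap.homothety_eq_lineMap]
  exact hc.lineMap_mem hp hy ht

theorem image_homothety_closure_subset {S : Set E} (ho : IsOpen S) (hc : Convex ℝ S) {p : E}
    (hp : p ∈ S) {s t : ℝ} (hs : 0 < s) (hst : s < t) :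
    AffineMap.homothety p s '' closure S ⊆ AffineMap.homothety p t '' S := by
  rintro _ ⟨y, hy, rfl⟩
  obtain ⟨z, hz, rfl⟩ := hc.closure_subset_image_homothety_interior_of_one_lt
    (ho.interior_eq.symm ▸ hp) (t / s) ((one_lt_div hs).2 hst) hy
  refine ⟨z, interior_subset hz, ?_⟩
  rw [← AffineMap.homothety_mul_apply, mul_div_cancel₀ _ hs.ne']

theorem image_homothety_subset {S : Set E} (ho : IsOpen S) (hc : Convex ℝ S) {p : E}
    (hp : p ∈ S) {s t : ℝ} (hs : 0 < s) (hst : s ≤ t) :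
    AffineMap.homothety p s '' S ⊆ AffineMap.homothety p t '' S := by
  rcases hst.eq_or_lt with rfl | hst
  · rfl
  · exact (image_mono subset_closure).trans (image_homothety_closure_subset ho hc hp hs hst)

theorem disjoint_frontier_image_homothety {S : Set E} (ho : IsOpen S) (hc : Convex ℝ S) {p : E}
    (hp : p ∈ S) {s t : ℝ} (hs : 0 < s) (hst : s ≤ t) :
    Disjoint (frontier (AffineMap.homothety p t '' S)) (AffineMap.homothety p s '' S) :=
  (disjoint_frontier_iff_isOpen.2 (isOpen_image_homothety ho p (hs.trans_le hst).ne')).mono_right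
    (image_homothety_subset ho hc hp hs hst)

theorem disjoint_image_homothety_frontier {S : Set E} (ho : IsOpen S) (hc : Convex ℝ S) {p : E}
    (hp : p ∈ S) {s t : ℝ} (hs : 0 < s) (hst : s < t) :
    Disjoint (AffineMap.homothety p s '' frontier S) (AffineMap.homothety p t '' frontier S) := by
  rw [← frontier_image_homothety p (hs.trans hst).ne']
  exact (disjoint_frontier_iff_isOpen.2
    (isOpen_image_homothety ho p (hs.trans hst).ne')).symm.mono_left
      ((image_mono frontier_subset_closure).trans
        (image_homothety_closure_subset ho hc hp hs hst))

theorem eventually_mem_image_homothety {S : Set E} (ho : IsOpen S) (p : E) {x : E} (hx : x ∈ S) :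
    ∀ᶠ r : ℝ in 𝓝 1, x ∈ AffineMap.homothety p r '' S := by
  have hinv : Tendsto (fun r : ℝ => r⁻¹) (𝓝 1) (𝓝 1) := by
    simpa using (continuousAt_inv₀ (one_ne_zero (α := ℝ))).tendsto
  filter_upwards [hinv.eventually (eventually_homothety_mem_of_mem_interior ℝ p
    (ho.interior_eq.symm ▸ hx)), isOpen_ne.mem_nhds (one_ne_zero (α := ℝ))] with r hr hr0
  rwa [image_homothety_eq_preimage p hr0]

end Normed

theorem gradient_comp_homothety {F : Type*} [NormedAddCommGroup F] [InnerProductSpace ℝ F]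
    [CompleteSpace F] {φ : F → ℝ} {p y : F} {t : ℝ}
    (hφ : DifferentiableAt ℝ φ (AffineMap.homothety p t y)) :
    gradient (φ ∘ AffineMap.homothety p t) y = t • gradient φ (AffineMap.homothety p t y) := by
  have hder : HasFDerivAt (AffineMap.homothety p t) (t • ContinuousLinearMap.id ℝ F) y :=
    (((hasFDerivAt_id y).sub_const p).const_smul t).add_const p
  refine HasGradientAt.gradient (hasGradientAt_iff_hasFDerivAt.2 ?_)
  refine (hφ.hasGradientAt.hasFDerivAt.comp y hder).congr_fderiv ?_
  ext u
  simp

variable {n : ℕ}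

theorem IsUnitNormalAt.image_homothety {S : Set (Space n)} {x v : Space n}
    (h : IsUnitNormalAt S x v) (p : Space n) {t : ℝ} (ht : t ≠ 0) :
    IsUnitNormalAt (AffineMap.homothety p t '' S) (AffineMap.homothety p t x) v := by
  obtain ⟨hx, U, φ, hU, hxU, hφ, hgrad, hSU, hnorm, hspan⟩ := h
  have hinv := homothety_inv_homothety p ht x
  have hsmooth : ContDiff ℝ 1 (AffineMap.homothety p t⁻¹) := by
    simp only [AffineMap.coe_homothety, vsub_eq_sub, vadd_eq_add]
    fun_prop
  have hgrad' : gradient (φ ∘ AffineMap.homothety p t⁻¹) (AffineMap.homothety p t x) =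
      t⁻¹ • gradient φ x := by
    rw [gradient_comp_homothety, hinv]
    rw [hinv]
    exact (hasStrictFDerivAt_of_contDiffOn hU hφ hxU).hasFDerivAt.differentiableAt
  refine ⟨mem_image_of_mem _ hx, AffineMap.homothety p t⁻¹ ⁻¹' U, φ ∘ AffineMap.homothety p t⁻¹,
    hU.preimage (AffineMap.homothety_continuous p t⁻¹), by rwa [mem_preimage, hinv],
    hφ.comp hsmooth.contDiffOn fun y hy => hy, ?_, ?_, hnorm, ?_⟩
  · rw [hgrad']
    exact smul_ne_zero (inv_ne_zero ht) hgrad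
  · rw [image_homothety_eq_preimage p ht, ← preimage_inter, hSU]
    rfl
  · rwa [hgrad', Submodule.span_singleton_smul_eq (inv_ne_zero ht).isUnit]

theorem IsC1Hypersurface.image_homothety {S : Set (Space n)} (hS : IsC1Hypersurface S)
    (p : Space n) {t : ℝ} (ht : t ≠ 0) : IsC1Hypersurface (AffineMap.homothety p t '' S) := by
  rintro _ ⟨x, hx, rfl⟩
  obtain ⟨v, hv⟩ := hS x hx
  exact ⟨v, hv.image_homothety p ht⟩

theorem surfaceMeasure_image_homothety {d : ℕ} (p : Space (d + 1)) {t : ℝ} (ht : t ≠ 0)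
    (S : Set (Space (d + 1))) :
    surfaceMeasure (d + 1) (AffineMap.homothety p t '' S) =
      ‖t‖ₑ ^ d * surfaceMeasure (d + 1) S :=
  euclideanHausdorffMeasure_homothety_image d p ht S

end Homothety

section FlatPieces

theorem exists_enorm_pow_mul_eq {d : ℕ} (hd : d ≠ 0) {δ M : ℝ≥0∞} (hδ : δ ≠ 0) (hδM : δ ≤ M)
    (hM : M ≠ ∞) : ∃ s : ℝ, 0 < s ∧ s ≤ 1 ∧ ‖s‖ₑ ^ d * M = δ := by
  have hM0 : M ≠ 0 := (hδ.bot_lt.trans_le hδM).ne'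
  have hle : (δ / M) ^ ((d : ℝ)⁻¹) ≤ 1 :=
    ENNReal.rpow_le_one (ENNReal.div_le_of_le_mul (by rwa [one_mul])) (by positivity)
  have hpow : ((δ / M) ^ ((d : ℝ)⁻¹)) ^ d = δ / M := by
    rw [← ENNReal.rpow_natCast, ENNReal.rpow_inv_rpow (Nat.cast_ne_zero.2 hd)]
  have hpos : (δ / M) ^ ((d : ℝ)⁻¹) ≠ 0 := fun h => by
    rw [h, zero_pow hd] at hpow
    exact (ENNReal.div_pos hδ hM).ne hpow
  have htop := ne_top_of_le_ne_top ENNReal.one_ne_top hle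
  refine ⟨((δ / M) ^ ((d : ℝ)⁻¹)).toReal, ENNReal.toReal_pos hpos htop,
    ENNReal.toReal_le_of_le_ofReal zero_le_one (by rwa [ENNReal.ofReal_one]), ?_⟩
  rw [Real.enorm_eq_ofReal ENNReal.toReal_nonneg, ENNReal.ofReal_toReal htop, hpow,
    ENNReal.div_mul_cancel hM0 hM]

theorem isFlatPiece_empty {d : ℕ} (Ω : Set (Space (d + 1))) : IsFlatPiece Ω ∅ :=
  ⟨.empty, dir 0, 0, dir_ne_zero 0, empty_subset _⟩

theorem isFlatPiece_inter_hyperplane {n : ℕ} {Ω : Set (Space n)} (ho : IsOpen Ω) {v : Space n}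
    (hv : v ≠ 0) (b : ℝ) : IsFlatPiece Ω (Ω ∩ hyperplane v b) :=
  ⟨ho.measurableSet.inter (isClosed_hyperplane v b).measurableSet, v, b, hv, subset_rfl⟩

theorem IsFlatPiece.mono {n : ℕ} {Ω Ω' K K' : Set (Space n)} (hK : IsFlatPiece Ω K)
    (hKK : K' ⊆ K) (hK' : K' ⊆ Ω') (hm : MeasurableSet K') : IsFlatPiece Ω' K' := by
  obtain ⟨-, v, b, hv, hKv⟩ := hK
  exact ⟨hm, v, b, hv, subset_inter hK' (hKK.trans (hKv.trans inter_subset_right))⟩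

theorem convex_hyperplane {n : ℕ} (v : Space n) (b : ℝ) : Convex ℝ (hyperplane v b) :=
  (convex_singleton b).linear_preimage (innerSL ℝ v).toLinearMap

variable {d : ℕ} {Ω : Set (Space (d + 1))}

theorem IsFlatPiece.exists_convex_subset (hd : d ≠ 0) {X : Set (Space (d + 1))}
    (hX : IsFlatPiece Ω X) (hXc : Convex ℝ X) (hfin : surfaceMeasure (d + 1) X ≠ ∞) {δ : ℝ≥0∞}
    (hδ : δ ≤ surfaceMeasure (d + 1) X) :
    ∃ K ⊆ X, IsFlatPiece Ω K ∧ Convex ℝ K ∧ surfaceMeasure (d + 1) K = δ := by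
  rcases eq_or_ne δ 0 with rfl | hδ0
  · exact ⟨∅, empty_subset X, isFlatPiece_empty Ω, convex_empty, measure_empty⟩
  obtain ⟨p, hp⟩ := nonempty_of_measure_ne_zero (hδ0.bot_lt.trans_le hδ).ne'
  obtain ⟨s, hs0, hs1, hs⟩ := exists_enorm_pow_mul_eq hd hδ0 hδ hfin
  have hsub : AffineMap.homothety p s '' X ⊆ X :=
    image_homothety_subset_self hXc hp ⟨hs0.le, hs1⟩
  have hmeas : MeasurableSet (AffineMap.homothety p s '' X) := by
    rw [image_homothety_eq_preimage p hs0.ne']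
    exact (AffineMap.homothety_continuous p _).measurable hX.1
  exact ⟨_, hsub, hX.mono hsub (hsub.trans hX.subset) hmeas, hXc.affine_image _,
    (surfaceMeasure_image_homothety p hs0.ne' X).trans hs⟩

/-- The disc of radius `ρ` about `q` in the hyperplane of constant first coordinate. -/
def disc (q : Space (d + 1)) (ρ : ℝ) : Set (Space (d + 1)) :=
  Metric.ball q ρ ∩ hyperplane (dir 0) (head q)

theorem isFlatPiece_disc (q : Space (d + 1)) (ρ : ℝ) : IsFlatPiece (Metric.ball q ρ) (disc q ρ) :=
  isFlatPiece_inter_hyperplane Metric.isOpen_ball (dir_ne_zero 0) _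

theorem convex_disc (q : Space (d + 1)) (ρ : ℝ) : Convex ℝ (disc q ρ) :=
  (convex_ball q ρ).inter (convex_hyperplane _ _)

theorem image_ball_subset_disc (q : Space (d + 1)) (ρ : ℝ) :
    (fun z : Space d => q + incl z) '' Metric.ball 0 ρ ⊆ disc q ρ := by
  rintro _ ⟨z, hz, rfl⟩
  constructor
  · rwa [mem_ball_iff_norm, add_sub_cancel_left, incl.norm_map, ← mem_ball_zero_iff]
  · change inner ℝ (dir 0) (q + incl z) = head q
    simp [inner_eq_head_tail]

theorem surfaceMeasure_disc_pos (q : Space (d + 1)) {ρ : ℝ} (hρ : 0 < ρ) :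
    0 < surfaceMeasure (d + 1) (disc q ρ) := by
  have hiso : Isometry fun z : Space d => q + incl z :=
    (IsometryEquiv.addLeft q).isometry.comp incl.isometry
  calc 0 < volume (Metric.ball (0 : Space d) ρ) := Metric.measure_ball_pos _ _ hρ
    _ = surfaceMeasure (d + 1) ((fun z : Space d => q + incl z) '' Metric.ball 0 ρ) := by
      rw [← EuclideanSpace.euclideanHausdorffMeasure_eq_volume,
        ← hiso.euclideanHausdorffMeasure_image]
      rfl
    _ ≤ _ := measure_mono (image_ball_subset_disc q ρ)

theorem exists_hyperplane_surfaceMeasure_pos (ho : IsOpen Ω) (hne : Ω.Nonempty) :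
    ∃ (v : Space (d + 1)) (b : ℝ), v ≠ 0 ∧ 0 < surfaceMeasure (d + 1) (Ω ∩ hyperplane v b) := by
  obtain ⟨p, hp⟩ := hne
  obtain ⟨ρ, hρ, hball⟩ := Metric.isOpen_iff.1 ho p hp
  exact ⟨dir 0, head p, dir_ne_zero 0, (surfaceMeasure_disc_pos p hρ).trans_le
    (measure_mono (inter_subset_inter_left _ hball))⟩

theorem exists_mem_notMem_hyperplane {n : ℕ} {Ω : Set (Space n)} (ho : IsOpen Ω)
    (hne : Ω.Nonempty) {v : Space n} (hv : v ≠ 0) (b : ℝ) : ∃ q ∈ Ω, q ∉ hyperplane v b := by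
  obtain ⟨p, hp⟩ := hne
  by_cases hpb : p ∈ hyperplane v b
  · have hline : Tendsto (fun e : ℝ => p + e • v) (𝓝 0) (𝓝 p) :=
      Continuous.tendsto' (by fun_prop) _ _ (by simp)
    obtain ⟨e, heΩ, he⟩ := (((hline.mono_left nhdsWithin_le_nhds).eventually
      (ho.mem_nhds hp)).and (self_mem_nhdsWithin (s := Ioi (0 : ℝ)))).exists
    refine ⟨_, heΩ, fun heb => ?_⟩
    have hp_eq : inner ℝ v p = b := hpb
    have he_eq : inner ℝ v (p + e • v) = b := heb
    rw [inner_add_right, hp_eq, inner_smul_right, add_eq_left] at he_eq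
    exact mul_ne_zero (ne_of_gt he) (inner_self_ne_zero.2 hv) he_eq
  · exact ⟨p, hp, hpb⟩

end FlatPieces

section BoundaryCopies

theorem exists_tendsto_measure_inter_image_homothety {E : Type*} [NormedAddCommGroup E]
    [NormedSpace ℝ E] [MeasurableSpace E] (μ : Measure E) {Ω : Set E} (ho : IsOpen Ω)
    (hc : Convex ℝ Ω) {p : E} (hp : p ∈ Ω) {K : Set E} (hK : K ⊆ Ω) :
    ∃ r : ℕ → ℝ, (∀ k, r k ∈ Ioo (0 : ℝ) 1) ∧
      Tendsto (fun k => μ (K ∩ AffineMap.homothety p (r k) '' Ω)) atTop (𝓝 (μ K)) := by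
  obtain ⟨r, hmono, hr, hlim⟩ := exists_seq_strictMono_tendsto' (zero_lt_one (α := ℝ))
  refine ⟨r, hr, ?_⟩
  have hexhaust : ⋃ k, K ∩ AffineMap.homothety p (r k) '' Ω = K := by
    rw [← inter_iUnion, inter_eq_left]
    intro x hx
    exact mem_iUnion.2 (hlim.eventually (eventually_mem_image_homothety ho p (hK hx))).exists
  have hincr : Monotone fun k => K ∩ AffineMap.homothety p (r k) '' Ω := fun k l hkl =>
    inter_subset_inter_right _ (image_homothety_subset ho hc hp (hr k).1 (hmono.monotone hkl))
  have hlim' := tendsto_measure_iUnion_atTop (μ := μ) hincr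
  rwa [hexhaust] at hlim'

theorem eventually_forall_lt {ι : Type*} [Finite ι] {r c : ℝ} (hr : r < c) :
    ∀ᶠ t : ι → ℝ in 𝓝 fun _ => c, ∀ i, r < t i :=
  eventually_all.2 fun i => ((continuous_apply i).tendsto _).eventually (lt_mem_nhds hr)

theorem nhdsWithin_distinctFactors_neBot (m : ℕ) :
    (𝓝[distinctFactors m] fun _ : Fin m => (1 : ℝ)).NeBot := by
  have hlim : Tendsto (fun (e : ℝ) (i : Fin m) => 1 - e * (i : ℕ)) (𝓝[>] 0) (𝓝 fun _ => 1) :=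
    (Continuous.tendsto' (by fun_prop) _ _ (by simp)).mono_left nhdsWithin_le_nhds
  refine Tendsto.neBot (tendsto_nhdsWithin_iff.2 ⟨hlim, ?_⟩)
  filter_upwards [self_mem_nhdsWithin, hlim.eventually (eventually_forall_lt zero_lt_one)]
    with e he hpos
  refine ⟨fun i j hij => ?_, fun i => ⟨hpos i, ?_⟩⟩
  · exact Fin.ext (Nat.cast_injective (mul_left_cancel₀ (ne_of_gt he) (sub_right_injective hij)))
  · exact sub_le_self _ (mul_nonneg (le_of_lt he) (Nat.cast_nonneg _))

theorem IsPiecewiseC1.union_isFlatPiece {n : ℕ} {Ω A K : Set (Space n)} (hA : IsPiecewiseC1 A)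
    (hAm : MeasurableSet A) (hK : IsFlatPiece Ω K) : IsPiecewiseC1 (A ∪ K) := by
  obtain ⟨hKm, v, b, hv, hKv⟩ := hK
  exact hA.union hAm (isC1Hypersurface_hyperplane hv b) hKm (hKv.trans inter_subset_right)

/-- A bounded open convex set with `C¹` boundary. -/
structure IsC1ConvexBody {n : ℕ} (Ω : Set (Space n)) : Prop where
  isOpen : IsOpen Ω
  convex : Convex ℝ Ω
  isBounded : Bornology.IsBounded Ω
  hasC1Boundary : HasC1Boundary Ω

variable {n m : ℕ} {t : Fin m → ℝ}

theorem boundaryCopies_eq {Ω : Set (Space n)} {p : Space n} (ht : t ∈ distinctFactors m) :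
    boundaryCopies Ω p t = ⋃ i, frontier (AffineMap.homothety p (t i) '' Ω) :=
  iUnion_congr fun i => (frontier_image_homothety p (ht.2 i).1.ne' Ω).symm

theorem measurableSet_boundaryCopies {Ω : Set (Space n)} {p : Space n}
    (ht : t ∈ distinctFactors m) : MeasurableSet (boundaryCopies Ω p t) := by
  rw [boundaryCopies_eq ht]
  exact .iUnion fun i => isClosed_frontier.measurableSet

namespace IsC1ConvexBody

section

variable {Ω : Set (Space n)} {p : Space n}

theorem boundaryCopies_subset (h : IsC1ConvexBody Ω) (hp : p ∈ Ω) (ht : t ∈ distinctFactors m) :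
    boundaryCopies Ω p t ⊆ closure Ω :=
  iUnion_subset fun i => (image_mono frontier_subset_closure).trans
    (image_homothety_subset_self h.convex.closure (subset_closure hp) ⟨(ht.2 i).1.le, (ht.2 i).2⟩)

theorem disjoint_boundaryCopies (h : IsC1ConvexBody Ω) (hp : p ∈ Ω) (ht : t ∈ distinctFactors m)
    {s : ℝ} (hs : 0 < s) (hst : ∀ i, s ≤ t i) :
    Disjoint (boundaryCopies Ω p t) (AffineMap.homothety p s '' Ω) := by
  rw [boundaryCopies_eq ht, disjoint_iUnion_left]
  exact fun i => disjoint_frontier_image_homothety h.isOpen h.convex hp hs (hst i)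

theorem pairwise_disjoint_copies (h : IsC1ConvexBody Ω) (hp : p ∈ Ω)
    (ht : t ∈ distinctFactors m) :
    Pairwise fun i j => Disjoint (AffineMap.homothety p (t i) '' frontier Ω)
      (AffineMap.homothety p (t j) '' frontier Ω) := by
  intro i j hij
  rcases lt_or_gt_of_ne (ht.1.ne hij) with hlt | hlt
  · exact disjoint_image_homothety_frontier h.isOpen h.convex hp (ht.2 i).1 hlt
  · exact (disjoint_image_homothety_frontier h.isOpen h.convex hp (ht.2 j).1 hlt).symm

theorem isPiecewiseC1_boundaryCopies (h : IsC1ConvexBody Ω) (ht : t ∈ distinctFactors m) :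
    IsPiecewiseC1 (boundaryCopies Ω p t) := by
  refine isPiecewiseC1_iUnion (fun i => ?_) fun i => ?_
  · exact (h.hasC1Boundary.isC1Hypersurface_frontier h.isOpen).image_homothety p (ht.2 i).1.ne'
  · rw [← frontier_image_homothety p (ht.2 i).1.ne']
    exact isClosed_frontier.measurableSet

theorem boundaryCopies_union_mem_competitors (h : IsC1ConvexBody Ω) (hp : p ∈ Ω)
    (ht : t ∈ distinctFactors m) {K J : Set (Space n)} (hK : IsFlatPiece Ω K)
    (hJ : IsFlatPiece Ω J) {L : ℝ≥0∞} (hL : surfaceMeasure n (boundaryCopies Ω p t ∪ K ∪ J) = L) :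
    boundaryCopies Ω p t ∪ K ∪ J ∈ competitors Ω L := by
  refine ⟨union_subset (union_subset (h.boundaryCopies_subset hp ht)
    (hK.subset.trans subset_closure)) (hJ.subset.trans subset_closure), ?_, hL⟩
  have hm := measurableSet_boundaryCopies (Ω := Ω) (p := p) ht
  exact ((h.isPiecewiseC1_boundaryCopies ht).union_isFlatPiece hm hK).union_isFlatPiece
    (hm.union hK.1) hJ

end

variable {d : ℕ} {Ω : Set (Space (d + 1))} {p : Space (d + 1)} {K J : Set (Space (d + 1))}

theorem surfaceMeasure_frontier_ne_top (h : IsC1ConvexBody Ω) :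
    surfaceMeasure (d + 1) (frontier Ω) ≠ ∞ :=
  ((h.hasC1Boundary.isC1Hypersurface_frontier h.isOpen).measure_lt_top
    (h.isBounded.isCompact_closure.of_isClosed_subset isClosed_frontier frontier_subset_closure)
    subset_rfl).ne

theorem natCast_mul_surfaceMeasure_frontier_ne_top (h : IsC1ConvexBody Ω) (m : ℕ) :
    m * surfaceMeasure (d + 1) (frontier Ω) ≠ ∞ :=
  ENNReal.mul_ne_top (ENNReal.natCast_ne_top m) h.surfaceMeasure_frontier_ne_top

theorem surfaceMeasure_boundaryCopies (h : IsC1ConvexBody Ω) (hp : p ∈ Ω)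
    (ht : t ∈ distinctFactors m) :
    surfaceMeasure (d + 1) (boundaryCopies Ω p t) =
      ∑ i, ‖t i‖ₑ ^ d * surfaceMeasure (d + 1) (frontier Ω) := by
  rw [boundaryCopies, measure_iUnion (h.pairwise_disjoint_copies hp ht), tsum_fintype]
  · exact Finset.sum_congr rfl fun i _ => surfaceMeasure_image_homothety p (ht.2 i).1.ne' _
  · intro i
    rw [← frontier_image_homothety p (ht.2 i).1.ne']
    exact isClosed_frontier.measurableSet

theorem surfaceMeasure_boundaryCopies_le (h : IsC1ConvexBody Ω) (hp : p ∈ Ω)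
    (ht : t ∈ distinctFactors m) :
    surfaceMeasure (d + 1) (boundaryCopies Ω p t) ≤ m * surfaceMeasure (d + 1) (frontier Ω) := by
  have hone : ∀ i, ‖t i‖ₑ ≤ 1 := fun i => by
    rw [Real.enorm_eq_ofReal (ht.2 i).1.le]
    exact ENNReal.ofReal_le_one.2 (ht.2 i).2
  calc surfaceMeasure (d + 1) (boundaryCopies Ω p t)
      = ∑ i, ‖t i‖ₑ ^ d * surfaceMeasure (d + 1) (frontier Ω) :=
        h.surfaceMeasure_boundaryCopies hp ht
    _ ≤ ∑ _i : Fin m, surfaceMeasure (d + 1) (frontier Ω) :=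
        Finset.sum_le_sum fun i _ => mul_le_of_le_one_left zero_le (pow_le_one₀ zero_le (hone i))
    _ = m * surfaceMeasure (d + 1) (frontier Ω) := by simp

theorem surfaceMeasure_boundaryCopies_union_le (h : IsC1ConvexBody Ω) (hp : p ∈ Ω)
    (ht : t ∈ distinctFactors m) :
    surfaceMeasure (d + 1) (boundaryCopies Ω p t ∪ K) ≤
      m * surfaceMeasure (d + 1) (frontier Ω) + surfaceMeasure (d + 1) K :=
  (measure_union_le _ _).trans (add_le_add_left (h.surfaceMeasure_boundaryCopies_le hp ht) _)

theorem tendsto_surfaceMeasure_boundaryCopies (h : IsC1ConvexBody Ω) (hp : p ∈ Ω) :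
    Tendsto (fun t : Fin m → ℝ => surfaceMeasure (d + 1) (boundaryCopies Ω p t))
      (𝓝[distinctFactors m] fun _ => 1) (𝓝 (m * surfaceMeasure (d + 1) (frontier Ω))) := by
  have hterm : ∀ i, Tendsto (fun t : Fin m → ℝ => ‖t i‖ₑ ^ d) (𝓝 fun _ => 1) (𝓝 1) := fun i => by
    simpa using ENNReal.Tendsto.pow (n := d)
      ((continuous_enorm.comp (continuous_apply i)).tendsto fun _ : Fin m => (1 : ℝ))
  have hsum : Tendsto
      (fun t : Fin m → ℝ => ∑ i, ‖t i‖ₑ ^ d * surfaceMeasure (d + 1) (frontier Ω))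
      (𝓝 fun _ => 1) (𝓝 (∑ _i : Fin m, 1 * surfaceMeasure (d + 1) (frontier Ω))) :=
    tendsto_finsetSum _ fun i _ =>
      ENNReal.Tendsto.mul_const (hterm i) (Or.inr h.surfaceMeasure_frontier_ne_top)
  simp only [one_mul, Finset.sum_const, Finset.card_univ, Fintype.card_fin, nsmul_eq_mul] at hsum
  refine (hsum.mono_left nhdsWithin_le_nhds).congr' ?_
  filter_upwards [self_mem_nhdsWithin] with t ht
  exact (h.surfaceMeasure_boundaryCopies hp ht).symm

theorem tendsto_surfaceMeasure_boundaryCopies_union (h : IsC1ConvexBody Ω) (hp : p ∈ Ω)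
    (hK : K ⊆ Ω) :
    Tendsto (fun t : Fin m → ℝ => surfaceMeasure (d + 1) (boundaryCopies Ω p t ∪ K))
      (𝓝[distinctFactors m] fun _ => 1)
      (𝓝 (m * surfaceMeasure (d + 1) (frontier Ω) + surfaceMeasure (d + 1) K)) := by
  refine tendsto_order.2 ⟨fun a ha => ?_, fun a ha => ?_⟩
  · obtain ⟨r, hr, hlim⟩ := exists_tendsto_measure_inter_image_homothety (surfaceMeasure (d + 1))
      h.isOpen h.convex hp hK
    obtain ⟨k, hk⟩ := ((hlim.const_add (m * surfaceMeasure (d + 1) (frontier Ω))).eventually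
      (lt_mem_nhds ha)).exists
    have hcopies := (h.tendsto_surfaceMeasure_boundaryCopies (m := m) hp).add_const
      (surfaceMeasure (d + 1) (K ∩ AffineMap.homothety p (r k) '' Ω))
    filter_upwards [self_mem_nhdsWithin, hcopies.eventually (lt_mem_nhds hk),
      nhdsWithin_le_nhds (eventually_forall_lt (hr k).2)] with t ht hta htr
    have hdisj := (h.disjoint_boundaryCopies hp ht (hr k).1 fun i => (htr i).le).mono_right
      (inter_subset_right (s := K))
    rw [← measure_union' hdisj (measurableSet_boundaryCopies ht)] at hta
    exact hta.trans_le (measure_mono (union_subset_union_right _ inter_subset_left))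
  · filter_upwards [self_mem_nhdsWithin] with t ht
    exact (h.surfaceMeasure_boundaryCopies_union_le hp ht).trans_lt ha

end IsC1ConvexBody

end BoundaryCopies

section MinEnergy

variable {d : ℕ}

/-- The minimal energy of sets of area `m * |∂Ω| + κ`. -/
def minEnergy (Ω : Set (Space (d + 1))) (m : ℕ) (κ : ℝ≥0∞) : ℝ≥0∞ :=
  ((2 * m * (2 * m - 1) : ℕ) : ℝ≥0∞) * lineIntegral (lineIndicator Ω) +
    ((4 * m : ℕ) : ℝ≥0∞) * (croftonConst d * κ)

variable {Ω : Set (Space (d + 1))} {p : Space (d + 1)} {m : ℕ} {t : Fin m → ℝ}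
  {K J : Set (Space (d + 1))}

namespace IsC1ConvexBody

theorem lineIntegral_lineIndicator_ne_top (h : IsC1ConvexBody Ω) :
    lineIntegral (lineIndicator Ω) ≠ ∞ := by
  intro htop
  have hcrofton := croftonConst_mul_frontier h.isOpen h.convex h.isBounded h.hasC1Boundary
  rw [htop, ENNReal.mul_top two_ne_zero] at hcrofton
  exact ENNReal.mul_ne_top croftonConst_ne_top h.surfaceMeasure_frontier_ne_top hcrofton

theorem natCast_mul_lineIntegral_ne_top (h : IsC1ConvexBody Ω) (N : ℕ) :
    N * lineIntegral (lineIndicator Ω) ≠ ∞ :=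
  ENNReal.mul_ne_top (ENNReal.natCast_ne_top N) h.lineIntegral_lineIndicator_ne_top

theorem four_mul_surfaceMeasure_eq_minEnergy_add (h : IsC1ConvexBody Ω) (m : ℕ) (κ : ℝ≥0∞) :
    ((4 * m : ℕ) : ℝ≥0∞) *
        (croftonConst d * (m * surfaceMeasure (d + 1) (frontier Ω) + κ)) =
      minEnergy Ω m κ +
        ((2 * m * (2 * m + 1) : ℕ) : ℝ≥0∞) * lineIntegral (lineIndicator Ω) := by
  have hcoeff : ((4 * m : ℕ) : ℝ≥0∞) * (m * 2) =
      ((2 * m * (2 * m - 1) : ℕ) : ℝ≥0∞) + ((2 * m * (2 * m + 1) : ℕ) : ℝ≥0∞) := by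
    have : 4 * m * (m * 2) = 2 * m * (2 * m - 1) + 2 * m * (2 * m + 1) := by
      cases m with
      | zero => rfl
      | succ k =>
        rw [show 2 * (k + 1) - 1 = 2 * k + 1 by omega]
        ring
    exact_mod_cast this
  calc _ = ((4 * m : ℕ) : ℝ≥0∞) * (m * (croftonConst d * surfaceMeasure (d + 1) (frontier Ω))) +
        ((4 * m : ℕ) : ℝ≥0∞) * (croftonConst d * κ) := by ring
    _ = ((4 * m : ℕ) : ℝ≥0∞) * (m * 2) * lineIntegral (lineIndicator Ω) +
        ((4 * m : ℕ) : ℝ≥0∞) * (croftonConst d * κ) := by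
      rw [croftonConst_mul_frontier h.isOpen h.convex h.isBounded h.hasC1Boundary]
      ring
    _ = _ := by
      rw [hcoeff, minEnergy]
      ring

theorem minEnergy_le_energy (h : IsC1ConvexBody Ω) {κ : ℝ≥0∞} (hκ : κ ≠ ∞)
    {A : Set (Space (d + 1))}
    (hA : A ∈ competitors Ω (m * surfaceMeasure (d + 1) (frontier Ω) + κ)) :
    minEnergy Ω m κ ≤ energy A := by
  obtain ⟨hAΩ, hAp, hArea⟩ := hA
  have hfin : surfaceMeasure (d + 1) A ≠ ∞ := by
    rw [hArea]
    exact ENNReal.add_ne_top.2 ⟨h.natCast_mul_surfaceMeasure_frontier_ne_top m, hκ⟩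
  have hlower := four_mul_surfaceMeasure_le_energy h.isOpen h.convex hAΩ hAp hfin m
  rw [hArea, h.four_mul_surfaceMeasure_eq_minEnergy_add] at hlower
  exact (ENNReal.add_le_add_iff_right (h.natCast_mul_lineIntegral_ne_top _)).1 hlower

theorem surfaceMeasure_boundaryCopies_union_ne_top (h : IsC1ConvexBody Ω) (hp : p ∈ Ω)
    (ht : t ∈ distinctFactors m) (hK : IsFlatPiece Ω K) :
    surfaceMeasure (d + 1) (boundaryCopies Ω p t ∪ K) ≠ ∞ :=
  ne_top_of_le_ne_top (ENNReal.add_ne_top.2 ⟨h.natCast_mul_surfaceMeasure_frontier_ne_top m,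
    (hK.measure_lt_top h.isBounded).ne⟩) (h.surfaceMeasure_boundaryCopies_union_le hp ht)

theorem energy_boundaryCopies_union_union_le (h : IsC1ConvexBody Ω) (hp : p ∈ Ω)
    (ht : t ∈ distinctFactors m) (hK : IsFlatPiece Ω K) (hJ : IsFlatPiece Ω J) :
    energy (boundaryCopies Ω p t ∪ K ∪ J) ≤ minEnergy Ω m (surfaceMeasure (d + 1) K) +
      (4 * m + 2 : ℕ) * (croftonConst d * surfaceMeasure (d + 1) J) := by
  have hKfin := (hK.measure_lt_top h.isBounded).ne
  have hJfin := (hJ.measure_lt_top h.isBounded).ne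
  obtain ⟨hAΩ, hAp, -⟩ := h.boundaryCopies_union_mem_competitors hp ht hK hJ rfl
  have hAfin := measure_union_ne_top (h.surfaceMeasure_boundaryCopies_union_ne_top hp ht hK) hJfin
  have hbdd : ∀ i, Bornology.IsBounded (AffineMap.homothety p (t i) '' Ω) := fun i =>
    h.isBounded.subset (image_homothety_subset_self h.convex hp ⟨(ht.2 i).1.le, (ht.2 i).2⟩)
  refine (energy_le_of_subset_iUnion_frontier_union h.isOpen h.convex hAΩ hAp hAfin
    (fun i => isOpen_image_homothety h.isOpen p (ht.2 i).1.ne')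
    (fun i => h.convex.affine_image _) hbdd hK hJ hKfin hJfin
    (by rw [boundaryCopies_eq ht])).trans_eq ?_
  rw [minEnergy]
  push_cast
  ring

theorem energy_boundaryCopies_union_le (h : IsC1ConvexBody Ω) (hp : p ∈ Ω)
    (ht : t ∈ distinctFactors m) (hK : IsFlatPiece Ω K) :
    energy (boundaryCopies Ω p t ∪ K) ≤ minEnergy Ω m (surfaceMeasure (d + 1) K) := by
  simpa using h.energy_boundaryCopies_union_union_le hp ht hK (isFlatPiece_empty Ω)

end IsC1ConvexBody

end MinEnergy

/-! ### Minimization of the energy -/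

section Minimization

variable {d m : ℕ} {Ω : Set (Space (d + 1))} {K : Set (Space (d + 1))}

theorem IsFlatPiece.exists_disc_disjoint (ho : IsOpen Ω) (hne : Ω.Nonempty)
    (hK : IsFlatPiece Ω K) {s : ℝ} (hs : s ≠ 0) :
    ∃ q ∈ Ω, ∃ ρ > 0, disc q ρ ⊆ AffineMap.homothety q s '' Ω ∧ Disjoint K (disc q ρ) := by
  obtain ⟨-, v, b, hv, hKv⟩ := hK
  obtain ⟨q, hq, hqv⟩ := exists_mem_notMem_hyperplane ho hne hv b
  have hopen : IsOpen (AffineMap.homothety q s '' Ω ∩ (hyperplane v b)ᶜ) :=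
    (isOpen_image_homothety ho q hs).inter (isClosed_hyperplane v b).isOpen_compl
  obtain ⟨ρ, hρ, hball⟩ := Metric.isOpen_iff.1 hopen q
    ⟨⟨q, hq, AffineMap.homothety_apply_same _ _⟩, hqv⟩
  have hdisc : disc q ρ ⊆ AffineMap.homothety q s '' Ω ∩ (hyperplane v b)ᶜ :=
    inter_subset_left.trans hball
  refine ⟨q, hq, ρ, hρ, hdisc.trans inter_subset_left, ?_⟩
  exact disjoint_left.2 fun x hxK hx => (hdisc hx).2 (hKv hxK).2

namespace IsC1ConvexBody

-- Shrinking the copies of the boundary loses area; a small flat piece `J` makes up for it.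
theorem iInf_energy_le_add (h : IsC1ConvexBody Ω) (hd : d ≠ 0) (hK : IsFlatPiece Ω K)
    {q : Space (d + 1)} (hq : q ∈ Ω) {s ρ : ℝ} (hs : s ∈ Ioo (0 : ℝ) 1)
    (hdisc : disc q ρ ⊆ AffineMap.homothety q s '' Ω) (hKdisc : Disjoint K (disc q ρ))
    {t : Fin m → ℝ} (ht : t ∈ distinctFactors m) (hst : ∀ i, s < t i) {L : ℝ≥0∞}
    (hL : surfaceMeasure (d + 1) (boundaryCopies Ω q t ∪ K) ≤ L)
    (hLdisc : L - surfaceMeasure (d + 1) (boundaryCopies Ω q t ∪ K) ≤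
      surfaceMeasure (d + 1) (disc q ρ)) :
    ⨅ A ∈ competitors Ω L, energy A ≤ minEnergy Ω m (surfaceMeasure (d + 1) K) +
      (4 * m + 2 : ℕ) * (croftonConst d *
        (L - surfaceMeasure (d + 1) (boundaryCopies Ω q t ∪ K))) := by
  have hdiscΩ : disc q ρ ⊆ Ω :=
    hdisc.trans (image_homothety_subset_self h.convex hq (Ioo_subset_Icc_self hs))
  have hflat : IsFlatPiece Ω (disc q ρ) :=
    (isFlatPiece_disc q ρ).mono subset_rfl hdiscΩ (isFlatPiece_disc q ρ).1
  obtain ⟨J, hJdisc, hJ, -, hJarea⟩ :=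
    hflat.exists_convex_subset hd (convex_disc q ρ) (hflat.measure_lt_top h.isBounded).ne hLdisc
  have hdisj : Disjoint (boundaryCopies Ω q t ∪ K) J :=
    .union_left ((h.disjoint_boundaryCopies hq ht hs.1 fun i => (hst i).le).mono_right
      (hJdisc.trans hdisc)) (hKdisc.mono_right hJdisc)
  have harea : surfaceMeasure (d + 1) (boundaryCopies Ω q t ∪ K ∪ J) = L := by
    rw [measure_union hdisj hJ.1, hJarea, add_tsub_cancel_of_le hL]
  rw [← hJarea]
  exact (iInf₂_le _ (h.boundaryCopies_union_mem_competitors hq ht hK hJ harea)).trans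
    (h.energy_boundaryCopies_union_union_le hq ht hK hJ)

theorem iInf_energy_le_minEnergy (h : IsC1ConvexBody Ω) (hd : d ≠ 0) (hne : Ω.Nonempty)
    (hK : IsFlatPiece Ω K) :
    ⨅ A ∈ competitors Ω (m * surfaceMeasure (d + 1) (frontier Ω) + surfaceMeasure (d + 1) K),
      energy A ≤ minEnergy Ω m (surfaceMeasure (d + 1) K) := by
  set L := m * surfaceMeasure (d + 1) (frontier Ω) + surfaceMeasure (d + 1) K
  have hLfin : L ≠ ∞ := ENNReal.add_ne_top.2
    ⟨h.natCast_mul_surfaceMeasure_frontier_ne_top m, (hK.measure_lt_top h.isBounded).ne⟩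
  obtain ⟨q, hq, ρ, hρ, hdisc, hKdisc⟩ :=
    hK.exists_disc_disjoint h.isOpen hne (one_half_pos (α := ℝ)).ne'
  have hdefect : Tendsto (fun t : Fin m → ℝ =>
      L - surfaceMeasure (d + 1) (boundaryCopies Ω q t ∪ K))
      (𝓝[distinctFactors m] fun _ => 1) (𝓝 0) := by
    have hlim := ENNReal.Tendsto.sub (tendsto_const_nhds (x := L))
      (h.tendsto_surfaceMeasure_boundaryCopies_union (m := m) hq hK.subset) (Or.inl hLfin)
    rwa [tsub_self] at hlim
  have hbound : Tendsto (fun t : Fin m → ℝ => minEnergy Ω m (surfaceMeasure (d + 1) K) +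
      (4 * m + 2 : ℕ) * (croftonConst d *
        (L - surfaceMeasure (d + 1) (boundaryCopies Ω q t ∪ K))))
      (𝓝[distinctFactors m] fun _ => 1) (𝓝 (minEnergy Ω m (surfaceMeasure (d + 1) K))) := by
    simpa only [mul_zero, add_zero] using (ENNReal.Tendsto.const_mul
      (ENNReal.Tendsto.const_mul hdefect (Or.inr croftonConst_ne_top))
      (Or.inr (ENNReal.natCast_ne_top (4 * m + 2)))).const_add _
  have := nhdsWithin_distinctFactors_neBot m
  refine ge_of_tendsto hbound ?_
  filter_upwards [self_mem_nhdsWithin, nhdsWithin_le_nhds (eventually_forall_lt one_half_lt_one),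
    hdefect.eventually (gt_mem_nhds (surfaceMeasure_disc_pos q hρ))] with t ht hst htd
  exact h.iInf_energy_le_add hd hK hq ⟨one_half_pos, one_half_lt_one⟩ hdisc hKdisc ht hst
    (h.surfaceMeasure_boundaryCopies_union_le hq ht) htd.le

theorem iInf_energy_eq_minEnergy (h : IsC1ConvexBody Ω) (hd : d ≠ 0) (hne : Ω.Nonempty)
    (hK : IsFlatPiece Ω K) :
    ⨅ A ∈ competitors Ω (m * surfaceMeasure (d + 1) (frontier Ω) + surfaceMeasure (d + 1) K),
      energy A = minEnergy Ω m (surfaceMeasure (d + 1) K) :=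
  (h.iInf_energy_le_minEnergy hd hne hK).antisymm
    (le_iInf₂ fun _ hA => h.minEnergy_le_energy (hK.measure_lt_top h.isBounded).ne hA)

theorem tendsto_energy_boundaryCopies_union (h : IsC1ConvexBody Ω) {p : Space (d + 1)}
    (hp : p ∈ Ω) (hK : IsFlatPiece Ω K) :
    Tendsto (fun t : Fin m → ℝ => energy (boundaryCopies Ω p t ∪ K))
      (𝓝[distinctFactors m] fun _ => 1)
      (𝓝 (minEnergy Ω m (surfaceMeasure (d + 1) K))) := by
  have hfin := h.natCast_mul_lineIntegral_ne_top (2 * m * (2 * m + 1))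
  have hlower : Tendsto (fun t : Fin m → ℝ => ((4 * m : ℕ) : ℝ≥0∞) *
      (croftonConst d * surfaceMeasure (d + 1) (boundaryCopies Ω p t ∪ K)) -
      ((2 * m * (2 * m + 1) : ℕ) : ℝ≥0∞) * lineIntegral (lineIndicator Ω))
      (𝓝[distinctFactors m] fun _ => 1) (𝓝 (minEnergy Ω m (surfaceMeasure (d + 1) K))) := by
    have hlim := ENNReal.Tendsto.sub (ENNReal.Tendsto.const_mul (ENNReal.Tendsto.const_mul
      (h.tendsto_surfaceMeasure_boundaryCopies_union (m := m) hp hK.subset)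
      (Or.inr (croftonConst_ne_top (d := d)))) (Or.inr (ENNReal.natCast_ne_top (4 * m))))
      tendsto_const_nhds (Or.inr hfin)
    rwa [h.four_mul_surfaceMeasure_eq_minEnergy_add, ENNReal.add_sub_cancel_right hfin] at hlim
  refine tendsto_of_tendsto_of_tendsto_of_le_of_le' hlower tendsto_const_nhds ?_ ?_
  · filter_upwards [self_mem_nhdsWithin] with t ht
    have hmem := h.boundaryCopies_union_mem_competitors hp ht hK (isFlatPiece_empty Ω) rfl
    rw [union_empty] at hmem
    exact tsub_le_iff_right.2 (four_mul_surfaceMeasure_le_energy h.isOpen h.convex hmem.1 hmem.2.1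
      (h.surfaceMeasure_boundaryCopies_union_ne_top hp ht hK) m)
  · filter_upwards [self_mem_nhdsWithin] with t ht
    exact h.energy_boundaryCopies_union_le hp ht hK

theorem iUnion_frontier_union_mem_competitors (h : IsC1ConvexBody Ω) (hne : Ω.Nonempty)
    (hm : m ≤ 1) (hK : IsFlatPiece Ω K) :
    (⋃ _ : Fin m, frontier Ω) ∪ K ∈ competitors Ω
        (m * surfaceMeasure (d + 1) (frontier Ω) + surfaceMeasure (d + 1) K) ∧
      energy ((⋃ _ : Fin m, frontier Ω) ∪ K) ≤ minEnergy Ω m (surfaceMeasure (d + 1) K) := by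
  obtain ⟨p, hp⟩ := hne
  have hsing : Subsingleton (Fin m) := Fin.subsingleton_iff_le_one.2 hm
  have ht : (fun _ : Fin m => (1 : ℝ)) ∈ distinctFactors m :=
    ⟨Function.injective_of_subsingleton _, fun _ => ⟨zero_lt_one, le_rfl⟩⟩
  have hcopies : (⋃ _ : Fin m, frontier Ω) = boundaryCopies Ω p fun _ : Fin m => 1 := by
    simp [boundaryCopies]
  have hdisj : Disjoint (⋃ _ : Fin m, frontier Ω) K := disjoint_iUnion_left.2 fun _ =>
    (disjoint_frontier_iff_isOpen.2 h.isOpen).mono_right hK.subset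
  rw [hcopies] at hdisj ⊢
  have harea : surfaceMeasure (d + 1) ((boundaryCopies Ω p fun _ : Fin m => 1) ∪ K ∪ ∅) =
      m * surfaceMeasure (d + 1) (frontier Ω) + surfaceMeasure (d + 1) K := by
    rw [union_empty, measure_union hdisj hK.1, h.surfaceMeasure_boundaryCopies hp ht]
    simp
  have hmem := h.boundaryCopies_union_mem_competitors hp ht hK (isFlatPiece_empty Ω) harea
  rw [union_empty] at hmem
  exact ⟨hmem, h.energy_boundaryCopies_union_le hp ht hK⟩

theorem minimizedByCopies (h : IsC1ConvexBody Ω) (hd : d ≠ 0) (hne : Ω.Nonempty)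
    {X : Set (Space (d + 1))} (hX : IsFlatPiece Ω X) (hXc : Convex ℝ X) {L : ℝ≥0∞}
    (hL : m * surfaceMeasure (d + 1) (frontier Ω) ≤ L)
    (hLX : L ≤ m * surfaceMeasure (d + 1) (frontier Ω) + surfaceMeasure (d + 1) X) :
    MinimizedByCopies Ω m L := by
  refine ⟨?_, ?_⟩
  · obtain ⟨K, -, hK, hKc, hKarea⟩ := hX.exists_convex_subset hd hXc
      (hX.measure_lt_top h.isBounded).ne (tsub_le_iff_left.2 hLX)
    exact ⟨K, hK, hKc, by rw [hKarea, add_tsub_cancel_of_le hL]⟩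
  · rintro K hK rfl
    rw [h.iInf_energy_eq_minEnergy hd hne hK]
    refine ⟨fun p hp => h.tendsto_energy_boundaryCopies_union hp hK, fun hm => ?_⟩
    obtain ⟨hmem, hle⟩ := h.iUnion_frontier_union_mem_competitors hne hm hK
    exact ⟨hmem, fun A hA =>
      hle.trans (h.minEnergy_le_energy (hK.measure_lt_top h.isBounded).ne hA)⟩

end IsC1ConvexBody

end Minimization

end QuadraticCrofton

end

theorem theorem2 (n : ℕ) (hn : 2 ≤ n) (Ω : Set (QuadraticCrofton.Space n))
    (hopen : IsOpen Ω) (hne : Ω.Nonempty) (hconv : Convex ℝ Ω)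
    (hbdd : Bornology.IsBounded Ω) (hC1 : QuadraticCrofton.HasC1Boundary Ω) :
    (∃ c : ENNReal, 0 < c ∧ ∀ (m : ℕ) (L : ENNReal),
      m * QuadraticCrofton.surfaceMeasure n (frontier Ω) ≤ L →
      L ≤ m * QuadraticCrofton.surfaceMeasure n (frontier Ω) + c →
      QuadraticCrofton.MinimizedByCopies Ω m L) ∧
    (∀ (v : QuadraticCrofton.Space n) (b : ℝ), v ≠ 0 → ∀ (m : ℕ) (L : ENNReal),
      m * QuadraticCrofton.surfaceMeasure n (frontier Ω) ≤ L →
      L ≤ m * QuadraticCrofton.surfaceMeasure n (frontier Ω) +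
        QuadraticCrofton.surfaceMeasure n (Ω ∩ QuadraticCrofton.hyperplane v b) →
      QuadraticCrofton.MinimizedByCopies Ω m L) := by
  obtain ⟨d, rfl⟩ : ∃ d, n = d + 1 := ⟨n - 1, by omega⟩
  have hd : d ≠ 0 := by omega
  have h : QuadraticCrofton.IsC1ConvexBody Ω := ⟨hopen, hconv, hbdd, hC1⟩
  have hsection : ∀ (v : QuadraticCrofton.Space (d + 1)) (b : ℝ), v ≠ 0 → ∀ (m : ℕ) (L : ENNReal),
      m * QuadraticCrofton.surfaceMeasure (d + 1) (frontier Ω) ≤ L →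
      L ≤ m * QuadraticCrofton.surfaceMeasure (d + 1) (frontier Ω) +
        QuadraticCrofton.surfaceMeasure (d + 1) (Ω ∩ QuadraticCrofton.hyperplane v b) →
      QuadraticCrofton.MinimizedByCopies Ω m L := fun v b hv m L =>
    h.minimizedByCopies hd hne (QuadraticCrofton.isFlatPiece_inter_hyperplane hopen hv b)
      (hconv.inter (QuadraticCrofton.convex_hyperplane v b))
  obtain ⟨v, b, hv, hpos⟩ := QuadraticCrofton.exists_hyperplane_surfaceMeasure_pos hopen hne
  exact ⟨⟨_, hpos, hsection v b hv⟩, hsection⟩
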